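/- **Setting.** Let $n\ge p\ge 1$, let $\|\cdot\|$ and $\langle\cdot,\cdot\rangle$ be the Frobenius norm and inner product, and let $\mathrm{St}(n,p)=\{X\in\mathbb R^{n\times p}: X^\top X=I\}$. Let $f:\mathbb R^{n\times p}\to\mathbb R$, and let $\Omega\subseteq\mathbb R^{n\times p}$ be a bounded convex set that is a neighborhood of every point of $\mathrm{St}(n,p)$, such that $f+\frac{\tau}{2}\|\cdot\|^2$ is convex on $\Omega$ and $f$ is $L$-Lipschitz on $\Omega$, where $\tau\ge 0$ and $L>0$. Let $C_1,\dots,C_\ell$ ($\ell\ge 2$) be pairwise disjoint sets with union $\{1,\dots,p\}$, and write $\mathfrak C=\{C_1,\dots,C_\ell\}$. For $C\subseteq\{1,\dots,p\}$, $X_C$ denotes the submatrix of the columns of $X$ with index in $C$; $I_C$ denotes the corresponding columns of the $p\times p$ identity; $C_{ij}=C_i\cup C_j$; and $X_{ij}=X_{C_{ij}}$, $X_{-ij}=X_{\{1,\dots,p\}\setminus C_{ij}}$, $I_{ij}=I_{C_{ij}}$. For a set $S$ of matrices, $\mathcal P_S$ is the nearest-point projection onto $S$. For $X\in\mathrm{St}(n,p)$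 put $$\mathcal M_{X_{-ij}}=\{Y: Y^\top Y=I,\ X_{-ij}^\top Y=0\},\qquad T_{X_{ij}}\mathcal M_{X_{-ij}}=\{\xi:\ \xi^\top X_{ij}+X_{ij}^\top\xi=0,\ X_{-ij}^\top\xi=0\}.$$ Let $\partial f(X)$ be the Clarke subdifferential of $f$, let $T_X\mathrm{St}(n,p)=\{\xi:\xi^\top X+X^\top\xi=0\}$, and let $\partial_{\mathrm{St}(n,p)}f(X)=\mathcal P_{T_X\mathrm{St}(n,p)}(\partial f(X))$. A point $X\in\mathrm{St}(n,p)$ is a stationary point of $f$ over $\mathrm{St}(n,p)$ if $0\in\partial_{\mathrm{St}(n,p)}f(X)$. **Algorithm (RSSM).** Let $X^0\in\mathrm{St}(n,p)$ and let $(\gamma_k)_{k\ge0}$ be stepsizes. Let $\{i_0,j_0\},\{i_1,j_1\},\dots$ be independent and uniformly distributed unordered pairs of distinct elements of $\{1,\dots,\ell\}$, realized as the coordinates of the infinite product probability space of sequences of pairs, with probability measure $\mathbb P$. At step $k$, a subgradient $G^k\in\partial f(X^k)$ is fixed; its choice may depend on the pairs drawn before step $k$, but not on $\{i_k,j_k\}$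 or later pairs. With $\{i,j\}=\{i_k,j_k\}$, set $$g^k=\mathcal P_{T_{X^k_{ij}}\mathcal M_{X^k_{-ij}}}\big(G^kI_{ij}\big),\qquad X^{k+1}_{ij}=\mathcal P_{\mathcal M_{X^k_{-ij}}}\big(X^k_{ij}-\gamma_k g^k\big),\qquad X^{k+1}_{-ij}=X^k_{-ij}.$$ **Surrogate measure.** For $X\in\mathrm{St}(n,p)$ let $$\mathcal A_X(\xi)=\binom{\ell}{2}^{-1}\sum_{\{i,j\}}\big(I-X_{-ij}X_{-ij}^\top\big)\,\xi_{ij}\,I_{ij}^\top ,$$ the sum being over all unordered pairs of distinct elements of $\{1,\dots,\ell\}$. This operator is self-adjoint and positive definite; let $\|\xi\|_{\mathcal A_X^{-1}}=\sqrt{\langle\mathcal A_X^{-1}(\xi),\xi\rangle}$. For $\lambda>0$ let $$P^{\mathfrak C}_{\lambda f}(X)=\operatorname*{argmin}_{Y\in\mathrm{St}(n,p)}\Big\{f(Y)+\tfrac1{2\lambda}\|Y-X\|^2_{\mathcal A_X^{-1}}\Big\},\qquad \Theta^{\mathfrak C}_{\lambda f}(X)=\tfrac1\lambda\big\|P^{\mathfrak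 C}_{\lambda f}(X)-X\big\|_{\mathcal A_X^{-1}}.$$ **Theorem (Almost-Sure Convergence).** Suppose that $0<\gamma_k<\frac1L$ for all $k\ge 0$, $\sum_{k\ge0}\gamma_k=\infty$ and $\sum_{k\ge0}\gamma_k^2<\infty$. Then for every $\lambda\in\big(0,\frac{\ell}{2(\tau+(2\ell-1)L)}\big)$, the map $P^{\mathfrak C}_{\lambda f}$ is single-valued on $\mathrm{St}(n,p)$ and $\lim_{k\to\infty}\Theta^{\mathfrak C}_{\lambda f}(X^k)=0$ $\mathbb P$-almost surely. Hence, $\mathbb P$-almost surely, every accumulation point of $(X^k)_{k\ge0}$ is a stationary point of $f$ over $\mathrm{St}(n,p)$. -/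

import Mathlib

open Matrix Filter Topology MeasureTheory ProbabilityTheory

noncomputable section

namespace RSSM

/-- Frobenius inner product `tr(ξᵀ η)`. -/
def frobInner {m k : Type*} [Fintype m] [Fintype k] (ξ η : Matrix m k ℝ) : ℝ :=
  (ξᵀ * η).trace

/-- Frobenius norm. -/
def frobNorm {m k : Type*} [Fintype m] [Fintype k] (ξ : Matrix m k ℝ) : ℝ :=
  √(frobInner ξ ξ)

/-- The Stiefel manifold of `m × k` matrices with orthonormal columns. -/
def stiefel (m k : Type*) [Fintype m] [DecidableEq k] : Set (Matrix m k ℝ) :=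
  {X | Xᵀ * X = 1}

/-- The (set-valued) projection of `X` onto `S` in the Frobenius norm: all nearest points. -/
def projSet {m k : Type*} [Fintype m] [Fintype k] (S : Set (Matrix m k ℝ)) (X : Matrix m k ℝ) :
    Set (Matrix m k ℝ) :=
  {Y | Y ∈ S ∧ ∀ Z ∈ S, frobNorm (X - Y) ≤ frobNorm (X - Z)}

/-- The tangent space to the Stiefel manifold at `X`. -/
def stiefelTangent {m k : Type*} [Fintype m] (X : Matrix m k ℝ) : Set (Matrix m k ℝ) :=
  {ξ | ξᵀ * X + Xᵀ * ξ = 0}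

/-! ### Clarke subdifferentials and stationarity -/

/-- The Clarke generalized directional derivative
`f°(X; V) = limsup_{Y → X, t ↓ 0} (f (Y + t V) - f Y) / t`, as an extended real. -/
def clarkeDeriv {m k : Type*} (f : Matrix m k ℝ → ℝ) (X V : Matrix m k ℝ) : EReal :=
  limsup (fun q : Matrix m k ℝ × ℝ => (((f (q.1 + q.2 • V) - f q.1) / q.2 : ℝ) : EReal))
    (𝓝 X ×ˢ 𝓝[>] (0 : ℝ))

/-- The Clarke subdifferential `∂f(X) = {ξ : ⟨ξ, V⟩ ≤ f°(X; V) for all V}`. -/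
def clarkeSubdiff {m k : Type*} [Fintype m] [Fintype k] (f : Matrix m k ℝ → ℝ)
    (X : Matrix m k ℝ) : Set (Matrix m k ℝ) :=
  {ξ | ∀ V : Matrix m k ℝ, ((frobInner ξ V : ℝ) : EReal) ≤ clarkeDeriv f X V}

/-- The Riemannian Clarke subdifferential of `f` over the Stiefel manifold: the orthogonal
projections onto the tangent space at `X` of the elements of `∂f(X)`. -/
def riemSubdiff {m k : Type*} [Fintype m] [Fintype k] (f : Matrix m k ℝ → ℝ)
    (X : Matrix m k ℝ) : Set (Matrix m k ℝ) :=
  {η | ∃ ξ ∈ clarkeSubdiff f X, η ∈ projSet (stiefelTangent X) ξ}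

/-- Stationary points of `f` over the Stiefel manifold. -/
def IsStationary {m k : Type*} [Fintype m] [Fintype k] [DecidableEq k] (f : Matrix m k ℝ → ℝ)
    (X : Matrix m k ℝ) : Prop :=
  X ∈ stiefel m k ∧ 0 ∈ riemSubdiff f X

/-! ### Column blocks -/

/-- `X_S`: the submatrix of the columns of `X` with index in `S`. -/
def cols {n p : ℕ} (S : Finset (Fin p)) (X : Matrix (Fin n) (Fin p) ℝ) :
    Matrix (Fin n) {j // j ∈ S} ℝ :=
  X.submatrix id Subtype.val

/-- `I_S`: the columns of the identity matrix with index in `S`. -/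
def idCols {p : ℕ} (S : Finset (Fin p)) : Matrix (Fin p) {j // j ∈ S} ℝ :=
  cols S 1

/-- The submanifold block at `X` with respect to `S`: Stiefel matrices with `|S|` columns that
are orthogonal to the remaining columns of `X`. -/
def block {n p : ℕ} (S : Finset (Fin p)) (X : Matrix (Fin n) (Fin p) ℝ) :
    Set (Matrix (Fin n) {j // j ∈ S} ℝ) :=
  {Y | Y ∈ stiefel (Fin n) {j // j ∈ S} ∧ (cols Sᶜ X)ᵀ * Y = 0}

/-- The tangent space at `X_S` to the submanifold block at `X` with respect to `S`. -/
def blockTangent {n p : ℕ} (S : Finset (Fin p)) (X : Matrix (Fin n) (Fin p) ℝ) :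
    Set (Matrix (Fin n) {j // j ∈ S} ℝ) :=
  {ξ | ξ ∈ stiefelTangent (cols S X) ∧ (cols Sᶜ X)ᵀ * ξ = 0}

/-- `C 0, …, C (ℓ-1)` are pairwise disjoint and cover all column indices. -/
def IsPartition {p ℓ : ℕ} (C : Fin ℓ → Finset (Fin p)) : Prop :=
  (∀ a b, a ≠ b → Disjoint (C a) (C b)) ∧ ∀ j, ∃ a, j ∈ C a

/-- Unordered pairs of distinct block labels. -/
def BlockPair (ℓ : ℕ) : Type := {s : Finset (Fin ℓ) // s.card = 2}

instance (ℓ : ℕ) : Fintype (BlockPair ℓ) :=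
  inferInstanceAs (Fintype {s : Finset (Fin ℓ) // s.card = 2})

instance (ℓ : ℕ) : MeasurableSpace (BlockPair ℓ) := ⊤

/-- `C_{ij} = C_i ∪ C_j` for the pair `s = {i, j}`. -/
def pairCols {p ℓ : ℕ} (C : Fin ℓ → Finset (Fin p)) (s : BlockPair ℓ) : Finset (Fin p) :=
  s.1.biUnion C

/-! ### The algorithm -/

/-- The probability measure on sequences of pairs under which the pairs are independent and
uniformly distributed. -/
def pairMeasure (ℓ : ℕ) : Measure (ℕ → BlockPair ℓ) :=
  Measure.infinitePi fun _ => uniformOn (Set.univ : Set (BlockPair ℓ))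

/-- One update from `X` to `X'` on the columns `S`, with stepsize `γ` and Euclidean subgradient `G`:
`g` is the partial Riemannian subgradient obtained by projecting the partial Euclidean subgradient
`G I_S = G_S`, the columns in `S` move to the projection onto the submanifold block of
`X_S - γ g`, and the other columns are kept. -/
def Step {n p : ℕ} (S : Finset (Fin p)) (γ : ℝ) (X G X' : Matrix (Fin n) (Fin p) ℝ) : Prop :=
  ∃ g ∈ projSet (blockTangent S X) (cols S G),
    cols S X' ∈ projSet (block S X) (cols S X - γ • g) ∧ cols Sᶜ X' = cols Sᶜ X

/-- `X` is the sequence of iterates of the randomized submanifold subgradient method, as a function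
of the sequence `ω` of pairs. The `k`-th step uses the pair `ω k` and a Clarke subgradient
`G k ω ∈ ∂f(X k ω)`; the choice of the subgradient may depend on the past pairs
`ω 0, …, ω (k-1)`, but not on `ω k` or later ones. -/
structure IsIterates {n p ℓ : ℕ} (f : Matrix (Fin n) (Fin p) ℝ → ℝ) (C : Fin ℓ → Finset (Fin p))
    (γ : ℕ → ℝ) (X₀ : Matrix (Fin n) (Fin p) ℝ)
    (G X : ℕ → (ℕ → BlockPair ℓ) → Matrix (Fin n) (Fin p) ℝ) : Prop where
  init : ∀ ω, X 0 ω = X₀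
  subgrad : ∀ k ω, G k ω ∈ clarkeSubdiff f (X k ω)
  nonanticipating : ∀ k ω ω', (∀ i < k, ω i = ω' i) → G k ω = G k ω'
  step : ∀ k ω, Step (pairCols C (ω k)) (γ k) (X k ω) (G k ω) (X (k + 1) ω)

/-! ### The averaging operator and the surrogate stationarity measure -/

/-- The averaging operator
`𝒜_X(ξ) = (ℓ choose 2)⁻¹ ∑_{i,j} (I - X_{-ij} X_{-ij}ᵀ) ξ_{ij} I_{ij}ᵀ`. -/
def avgOp {n p ℓ : ℕ} (C : Fin ℓ → Finset (Fin p)) (X : Matrix (Fin n) (Fin p) ℝ) :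
    Matrix (Fin n) (Fin p) ℝ →ₗ[ℝ] Matrix (Fin n) (Fin p) ℝ where
  toFun ξ := ((ℓ.choose 2 : ℕ) : ℝ)⁻¹ • ∑ s : BlockPair ℓ,
    (1 - cols (pairCols C s)ᶜ X * (cols (pairCols C s)ᶜ X)ᵀ) * cols (pairCols C s) ξ *
      (idCols (pairCols C s))ᵀ
  map_add' ξ η := by
    have h : ∀ S : Finset (Fin p), cols S (ξ + η) = cols S ξ + cols S η := fun _ => rfl
    simp only [h, Matrix.mul_add, Matrix.add_mul, Finset.sum_add_distrib, smul_add]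
  map_smul' c ξ := by
    have h : ∀ S : Finset (Fin p), cols S (c • ξ) = c • cols S ξ := fun _ => rfl
    simp only [h, Matrix.mul_smul, Matrix.smul_mul, ← Finset.smul_sum, RingHom.id_apply]
    rw [smul_comm]

/-- The squared Mahalanobis norm `‖ξ‖²_{𝒜_X⁻¹} = ⟨𝒜_X⁻¹ ξ, ξ⟩`. The operator `𝒜_X` is invertible
when `X` is a Stiefel matrix and `C` is a partition into at least two blocks. -/
def mahaSq {n p ℓ : ℕ} (C : Fin ℓ → Finset (Fin p)) (X ξ : Matrix (Fin n) (Fin p) ℝ) : ℝ :=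
  frobInner (Ring.inverse (avgOp C X : Module.End ℝ (Matrix (Fin n) (Fin p) ℝ)) ξ) ξ

/-- The adaptive proximal map as a set: all minimizers over the Stiefel manifold of
`Y ↦ f Y + (1 / (2 lam)) ‖Y - X‖²_{𝒜_X⁻¹}`. -/
def proxSet {n p ℓ : ℕ} (f : Matrix (Fin n) (Fin p) ℝ → ℝ) (C : Fin ℓ → Finset (Fin p))
    (lam : ℝ) (X : Matrix (Fin n) (Fin p) ℝ) : Set (Matrix (Fin n) (Fin p) ℝ) :=
  {Y | Y ∈ stiefel (Fin n) (Fin p) ∧ ∀ Z ∈ stiefel (Fin n) (Fin p),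
    f Y + 1 / (2 * lam) * mahaSq C X (Y - X) ≤ f Z + 1 / (2 * lam) * mahaSq C X (Z - X)}

/-- The point of the adaptive proximal map (meaningful where `proxSet` is a singleton). -/
def prox {n p ℓ : ℕ} (f : Matrix (Fin n) (Fin p) ℝ → ℝ) (C : Fin ℓ → Finset (Fin p))
    (lam : ℝ) (X : Matrix (Fin n) (Fin p) ℝ) : Matrix (Fin n) (Fin p) ℝ :=
  Classical.epsilon fun Y => Y ∈ proxSet f C lam X

/-- The surrogate stationarity measure `Θ(X) = (1 / lam) ‖prox(X) - X‖_{𝒜_X⁻¹}`. -/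
def surrogate {n p ℓ : ℕ} (f : Matrix (Fin n) (Fin p) ℝ → ℝ) (C : Fin ℓ → Finset (Fin p))
    (lam : ℝ) (X : Matrix (Fin n) (Fin p) ℝ) : ℝ :=
  1 / lam * √(mahaSq C X (prox f C lam X - X))

end RSSM

end

/-!
The method descends on the adaptive Moreau envelope
`E(X) = min_{Y ∈ St} f Y + (2 * lam)⁻¹ * ‖Y - X‖²_{𝒜_X⁻¹}`, whose metric varies with `X`.

Writing `o` for the part of a `p × p` matrix off the diagonal blocks of the partition, one has
`𝒜_X⁻¹ ξ = (ℓ / 2) * (ξ + (ℓ - 2) * X o(Xᵀ ξ))` for Stiefel matrices `X` (`inverse_avgOp`). Hence the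
squared Mahalanobis norm of `Y - X` is the polynomial
`(ℓ / 2) * (2 p - 2 ⟨X, Y⟩ + (ℓ - 2) * ‖o(Xᵀ Y)‖²)` for Stiefel matrices `X` and `Y` (`mahaSq_sub`).

*Proximal map.* Points at parameter `t` on the segment from a minimizer `Y` to another Stiefel matrix
`Z` are at distance at most `t / 2 * ‖Z - Y‖² + O(t²)` from the manifold, by polar decomposition
(`exists_polar`). Comparing with their polar factors gives quadratic growth of the prox subproblem
with modulus `μ = ℓ / (2 * lam) - τ - (2 * ℓ - 1) * L > 0` (`proxSet_growth`), so the proximal map is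
single-valued and Lipschitz (`existsUnique_proxSet`, `proxSet_lipschitz`).

*Descent.* A step moves `X` by `-γ` times an explicit partial Riemannian subgradient, up to `O(γ²)`
(`Step.expansion`). Averaged over the pairs, the first-order change of the squared Mahalanobis
distance to `Y` is at most `2 ⟨G, Y - X⟩` plus an error of order `L * ‖Y - X‖²`: the damping by `𝒜_X`
is cancelled by the variation of the metric (`averaged_first_order`). With weak convexity and `Y` the
proximal point of `X`, the envelope decreases in expectation by a multiple of `γ * ‖Y - X‖²`, up to
`O(γ²)` (`sum_envelope_le`).

*Conclusion.* Nearest points are unique for the given step sizes, so the iterates depend on the past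
pairs only, and taking expectations makes `∑ γ_k * ‖prox X_k - X_k‖²` finite almost surely. As the
distance to the proximal point is Lipschitz and the iterates move by `O(γ_k)`, it tends to zero
(`tendsto_zero_of_summable_mul_sq`). A cluster point is therefore a fixed point of the proximal map;
there `f` does not decrease to first order along the tangent space, and separating convex sets
yields a Clarke subgradient that is normal to the manifold (`isStationary_of_mem_proxSet`).
-/

namespace RSSM

/-! ### Frobenius calculus -/

section Frobenius

variable {m k l : Type*} [Fintype m] [Fintype k] [Fintype l]

lemma frobInner_eq_sum (A B : Matrix m k ℝ) : frobInner A B = ∑ i, ∑ j, A i j * B i j := by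
  simp only [frobInner, Matrix.trace, Matrix.diag, Matrix.mul_apply, Matrix.transpose_apply]
  exact Finset.sum_comm

lemma frobInner_comm (A B : Matrix m k ℝ) : frobInner A B = frobInner B A := by
  simp only [frobInner_eq_sum, mul_comm]

lemma frobInner_add_left (A B D : Matrix m k ℝ) :
    frobInner (A + B) D = frobInner A D + frobInner B D := by
  simp [frobInner, Matrix.add_mul]

lemma frobInner_add_right (A B D : Matrix m k ℝ) :
    frobInner D (A + B) = frobInner D A + frobInner D B := by
  simp [frobInner, Matrix.mul_add]

lemma frobInner_sub_left (A B D : Matrix m k ℝ) :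
    frobInner (A - B) D = frobInner A D - frobInner B D := by
  simp [frobInner, Matrix.sub_mul]

lemma frobInner_sub_right (A B D : Matrix m k ℝ) :
    frobInner D (A - B) = frobInner D A - frobInner D B := by
  simp [frobInner, Matrix.mul_sub]

lemma frobInner_smul_left (c : ℝ) (A B : Matrix m k ℝ) :
    frobInner (c • A) B = c * frobInner A B := by
  simp [frobInner]

lemma frobInner_smul_right (c : ℝ) (A B : Matrix m k ℝ) :
    frobInner A (c • B) = c * frobInner A B := by
  simp [frobInner]

lemma frobInner_neg_left (A B : Matrix m k ℝ) : frobInner (-A) B = -frobInner A B := by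
  simp [frobInner]

lemma frobInner_neg_right (A B : Matrix m k ℝ) : frobInner A (-B) = -frobInner A B := by
  simp [frobInner]

@[simp] lemma frobInner_zero_right (B : Matrix m k ℝ) : frobInner B 0 = 0 := by
  simp [frobInner]

lemma frobInner_sum_left {ι : Type*} (s : Finset ι) (A : ι → Matrix m k ℝ) (B : Matrix m k ℝ) :
    frobInner (∑ i ∈ s, A i) B = ∑ i ∈ s, frobInner (A i) B := by
  simp [frobInner, Matrix.transpose_sum, Matrix.sum_mul, Matrix.trace_sum]

lemma frobInner_mul_left (A : Matrix m l ℝ) (B : Matrix l k ℝ) (D : Matrix m k ℝ) :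
    frobInner (A * B) D = frobInner B (Aᵀ * D) := by
  simp [frobInner, Matrix.transpose_mul, Matrix.mul_assoc]

lemma frobInner_mul_right (A : Matrix m l ℝ) (B : Matrix l k ℝ) (D : Matrix m k ℝ) :
    frobInner (A * B) D = frobInner A (D * Bᵀ) := by
  rw [frobInner, frobInner, Matrix.transpose_mul, Matrix.mul_assoc, Matrix.trace_mul_comm,
    Matrix.mul_assoc]

lemma frobInner_transpose (A B : Matrix m k ℝ) : frobInner Aᵀ Bᵀ = frobInner A B := by
  rw [frobInner_eq_sum, frobInner_eq_sum, Finset.sum_comm]; rfl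

lemma frobInner_self_nonneg (A : Matrix m k ℝ) : 0 ≤ frobInner A A := by
  rw [frobInner_eq_sum]
  exact Finset.sum_nonneg fun i _ => Finset.sum_nonneg fun j _ => mul_self_nonneg _

lemma frobNorm_nonneg (A : Matrix m k ℝ) : 0 ≤ frobNorm A := Real.sqrt_nonneg _

lemma frobNorm_sq (A : Matrix m k ℝ) : frobNorm A ^ 2 = frobInner A A :=
  Real.sq_sqrt (frobInner_self_nonneg A)

section

attribute [local instance] Matrix.frobeniusNormedAddCommGroup Matrix.frobeniusNormedSpace

lemma frobNorm_eq_norm (A : Matrix m k ℝ) : frobNorm A = ‖A‖ := by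
  rw [frobNorm, frobInner_eq_sum, Matrix.frobenius_norm_def, Real.sqrt_eq_rpow]
  simp [Real.norm_eq_abs, sq]

lemma frobNorm_add_le (A B : Matrix m k ℝ) : frobNorm (A + B) ≤ frobNorm A + frobNorm B := by
  simp only [frobNorm_eq_norm]; exact norm_add_le A B

lemma frobNorm_sub_le (A B : Matrix m k ℝ) : frobNorm (A - B) ≤ frobNorm A + frobNorm B := by
  simp only [frobNorm_eq_norm]; exact norm_sub_le A B

lemma frobNorm_sub_comm (A B : Matrix m k ℝ) : frobNorm (A - B) = frobNorm (B - A) := by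
  simp only [frobNorm_eq_norm]; exact norm_sub_rev A B

lemma frobNorm_smul (c : ℝ) (A : Matrix m k ℝ) : frobNorm (c • A) = |c| * frobNorm A := by
  simp only [frobNorm_eq_norm]; exact norm_smul c A

lemma frobNorm_mul_le (A : Matrix m l ℝ) (B : Matrix l k ℝ) :
    frobNorm (A * B) ≤ frobNorm A * frobNorm B := by
  simp only [frobNorm_eq_norm]; exact Matrix.frobenius_norm_mul A B

lemma frobNorm_transpose (A : Matrix m k ℝ) : frobNorm Aᵀ = frobNorm A := by
  rw [frobNorm, frobInner_transpose, frobNorm]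

lemma frobNorm_eq_zero {A : Matrix m k ℝ} : frobNorm A = 0 ↔ A = 0 := by
  simp only [frobNorm_eq_norm]; exact norm_eq_zero

end

lemma frobNorm_neg (A : Matrix m k ℝ) : frobNorm (-A) = frobNorm A := by
  rw [frobNorm, frobInner_neg_left, frobInner_neg_right, neg_neg, frobNorm]

lemma frobNorm_add_sq (A B : Matrix m k ℝ) :
    frobNorm (A + B) ^ 2 = frobNorm A ^ 2 + 2 * frobInner A B + frobNorm B ^ 2 := by
  simp only [frobNorm_sq, frobInner_add_left, frobInner_add_right, frobInner_comm B A]; ring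

lemma frobNorm_sub_sq (A B : Matrix m k ℝ) :
    frobNorm (A - B) ^ 2 = frobNorm A ^ 2 - 2 * frobInner A B + frobNorm B ^ 2 := by
  simp only [frobNorm_sq, frobInner_sub_left, frobInner_sub_right, frobInner_comm B A]; ring

lemma abs_frobInner_le (A B : Matrix m k ℝ) : |frobInner A B| ≤ frobNorm A * frobNorm B := by
  refine abs_le_of_sq_le_sq ?_ (mul_nonneg (frobNorm_nonneg A) (frobNorm_nonneg B))
  have h : (∑ x : m × k, A x.1 x.2 * B x.1 x.2) ^ 2 ≤
      (∑ x : m × k, A x.1 x.2 ^ 2) * ∑ x : m × k, B x.1 x.2 ^ 2 :=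
    Finset.sum_mul_sq_le_sq_mul_sq _ _ _
  rw [mul_pow, frobNorm_sq, frobNorm_sq]
  simpa only [frobInner_eq_sum, Fintype.sum_prod_type, sq] using h

lemma frobInner_le (A B : Matrix m k ℝ) : frobInner A B ≤ frobNorm A * frobNorm B :=
  (le_abs_self _).trans (abs_frobInner_le A B)

lemma neg_le_frobInner (A B : Matrix m k ℝ) : -(frobNorm A * frobNorm B) ≤ frobInner A B :=
  (abs_le.1 (abs_frobInner_le A B)).1

/-- Left multiplication by a matrix with orthonormal columns is an isometry. -/
lemma frobNorm_stiefel_mul [DecidableEq l] {Q : Matrix m l ℝ} (hQ : Q ∈ stiefel m l)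
    (A : Matrix l k ℝ) : frobNorm (Q * A) = frobNorm A := by
  rw [frobNorm, frobInner_mul_left, ← Matrix.mul_assoc, show Qᵀ * Q = 1 from hQ, Matrix.one_mul,
    frobNorm]

lemma frobNorm_stiefel_transpose_mul_le [DecidableEq l] {Q : Matrix m l ℝ} (hQ : Q ∈ stiefel m l)
    (A : Matrix m k ℝ) : frobNorm (Qᵀ * A) ≤ frobNorm A := by
  have h1 : frobNorm (Qᵀ * A) ^ 2 = frobInner A (Q * (Qᵀ * A)) := by
    rw [frobNorm_sq, frobInner_mul_left, Matrix.transpose_transpose]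
  have h2 := frobInner_le A (Q * (Qᵀ * A))
  rw [frobNorm_stiefel_mul hQ] at h2
  nlinarith [frobNorm_nonneg A, frobNorm_nonneg (Qᵀ * A)]

lemma frobNorm_sq_stiefel [DecidableEq k] {Q : Matrix m k ℝ} (hQ : Q ∈ stiefel m k) :
    frobNorm Q ^ 2 = Fintype.card k := by
  rw [frobNorm_sq, frobInner, show Qᵀ * Q = 1 from hQ, Matrix.trace_one]

lemma continuous_frobInner : Continuous fun q : Matrix m k ℝ × Matrix m k ℝ =>
    frobInner q.1 q.2 := by
  unfold frobInner; fun_prop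

lemma continuous_frobNorm : Continuous (frobNorm : Matrix m k ℝ → ℝ) :=
  Real.continuous_sqrt.comp (continuous_frobInner.comp (continuous_id.prodMk continuous_id))

omit [Fintype k] in
lemma isCompact_stiefel [DecidableEq k] : IsCompact (stiefel m k) := by
  have hcl : IsClosed (stiefel m k) :=
    isClosed_eq (f := fun X : Matrix m k ℝ => Xᵀ * X) (by fun_prop) continuous_const
  have hK : IsCompact (Set.pi Set.univ fun _ : m => Set.pi Set.univ fun _ : k =>
      Set.Icc (-1 : ℝ) 1) := isCompact_univ_pi fun _ => isCompact_univ_pi fun _ => isCompact_Icc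
  refine hK.of_isClosed_subset hcl fun (X : Matrix m k ℝ) hX i _ j _ => ?_
  have h : ∑ x, X x j * X x j = 1 := by
    simpa only [Matrix.mul_apply, Matrix.one_apply_eq, Matrix.transpose_apply] using
      congrFun (congrFun (show Xᵀ * X = 1 from hX) j) j
  have h2 : X i j * X i j ≤ 1 := by
    rw [← h]
    exact Finset.single_le_sum (f := fun x => X x j * X x j)
      (fun x _ => mul_self_nonneg _) (Finset.mem_univ i)
  exact ⟨by nlinarith, by nlinarith⟩

end Frobenius

/-! ### Polar factors -/

section Polar

variable {m k : Type*} [Fintype m] [Fintype k] [DecidableEq k]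

open scoped MatrixOrder in
/-- A positive definite real matrix has a positive definite square root. -/
lemma exists_posDef_sqrt {A : Matrix k k ℝ} (hA : A.PosDef) :
    ∃ H : Matrix k k ℝ, H.PosDef ∧ H * H = A := by
  have h0 : 0 ≤ A := hA.posSemidef.nonneg
  have hmul : CFC.sqrt A * CFC.sqrt A = A := CFC.sqrt_mul_sqrt_self A h0
  have hps : (CFC.sqrt A).PosSemidef := Matrix.nonneg_iff_posSemidef.1 (CFC.sqrt_nonneg A)
  refine ⟨_, hps.posDef_iff_isUnit.2 ?_, hmul⟩
  have : IsUnit (CFC.sqrt A * CFC.sqrt A) := by rw [hmul]; exact hA.isUnit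
  exact (IsUnit.mul_iff.1 this).1

/-- Left multiplication by a positive definite matrix is a positive operator. -/
lemma frobInner_mul_nonneg {H : Matrix k k ℝ} (hH : H.PosDef) (A : Matrix k k ℝ) :
    0 ≤ frobInner A (H * A) := by
  obtain ⟨K, hK, rfl⟩ := exists_posDef_sqrt hH
  have hKt : Kᵀ = K := by simpa using hK.isHermitian.eq
  have := frobInner_self_nonneg (K * A)
  rwa [frobInner_mul_left, hKt, ← Matrix.mul_assoc] at this

/-- A symmetric matrix close to the identity is positive definite. -/
lemma posDef_of_frobNorm_lt {A : Matrix k k ℝ} (hA : A.IsHermitian) (h : frobNorm (A - 1) < 1) :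
    A.PosDef := by
  refine Matrix.PosDef.of_dotProduct_mulVec_pos hA fun x hx => ?_
  have hxx : 0 < x ⬝ᵥ x := by
    have := Matrix.dotProduct_star_self_pos_iff.2 hx
    simpa using this
  have h1 : frobInner (A - 1) (Matrix.vecMulVec x x) = x ⬝ᵥ A *ᵥ x - x ⬝ᵥ x := by
    rw [frobInner_sub_left, frobInner_eq_sum, frobInner_eq_sum]
    congr 1
    · simp only [dotProduct, Matrix.mulVec, Matrix.vecMulVec_apply, Finset.mul_sum]
      exact Finset.sum_congr rfl fun i _ => Finset.sum_congr rfl fun j _ => by ring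
    · simp [dotProduct, Matrix.vecMulVec_apply, Matrix.one_apply]
  have h2 : frobNorm (Matrix.vecMulVec x x) = x ⬝ᵥ x := by
    rw [frobNorm, frobInner_eq_sum, Real.sqrt_eq_iff_mul_self_eq_of_pos hxx]
    simp only [dotProduct, Matrix.vecMulVec_apply, Finset.sum_mul_sum]
    exact Finset.sum_congr rfl fun i _ => Finset.sum_congr rfl fun j _ => by ring
  have h3 := neg_le_frobInner (A - 1) (Matrix.vecMulVec x x)
  rw [h1, h2] at h3
  simp only [star_trivial]
  nlinarith

/-- The polar decomposition `W = Q H` of a matrix with nearly orthonormal columns, with the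
second-order sharp estimate of the distance of `W` to the Stiefel matrix `Q`. -/
lemma exists_polar {W : Matrix m k ℝ} (h : frobNorm (Wᵀ * W - 1) < 1) :
    ∃ (Q : Matrix m k ℝ) (H R : Matrix k k ℝ), Q ∈ stiefel m k ∧ H.PosDef ∧ W = Q * H ∧ Q = W * R ∧
      frobNorm (W - Q) ≤ frobNorm (Wᵀ * W - 1) ∧
      2 * frobNorm (W - Q) ≤ frobNorm (Wᵀ * W - 1) + frobNorm (Wᵀ * W - 1) ^ 2 := by
  have hherm : (Wᵀ * W).IsHermitian := by
    simpa using Matrix.isHermitian_conjTranspose_mul_self W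
  obtain ⟨H, hH, hHH⟩ := exists_posDef_sqrt (posDef_of_frobNorm_lt hherm h)
  have hdet : IsUnit H.det := (Matrix.isUnit_iff_isUnit_det H).1 hH.isUnit
  have hHt : Hᵀ = H := by simpa using hH.isHermitian.eq
  have hQ : W * H⁻¹ ∈ stiefel m k := by
    change (W * H⁻¹)ᵀ * (W * H⁻¹) = 1
    rw [Matrix.transpose_mul, Matrix.transpose_nonsing_inv, hHt, Matrix.mul_assoc,
      ← Matrix.mul_assoc Wᵀ, ← hHH, Matrix.mul_assoc H, Matrix.mul_nonsing_inv H hdet,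
      Matrix.mul_one, Matrix.nonsing_inv_mul H hdet]
  have hW : W = W * H⁻¹ * H := by
    rw [Matrix.mul_assoc, Matrix.nonsing_inv_mul H hdet, Matrix.mul_one]
  have hdist : frobNorm (W - W * H⁻¹) = frobNorm (H - 1) := by
    rw [← frobNorm_stiefel_mul hQ (H - 1), Matrix.mul_sub, ← hW, Matrix.mul_one]
  -- `H² - 1 = (H - 1) + H (H - 1)` where `⟨K, H K⟩ ≥ 0` as `H` is positive definite.
  have hcrude : frobNorm (H - 1) ≤ frobNorm (Wᵀ * W - 1) := by
    have e : Wᵀ * W - 1 = (H - 1) + H * (H - 1) := by rw [← hHH]; noncomm_ring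
    have hpos := frobInner_mul_nonneg hH (H - 1)
    have hsq := frobNorm_add_sq (H - 1) (H * (H - 1))
    rw [← e] at hsq
    refine (sq_le_sq₀ (frobNorm_nonneg _) (frobNorm_nonneg _)).1 ?_
    linarith [sq_nonneg (frobNorm (H * (H - 1)))]
  refine ⟨W * H⁻¹, H, H⁻¹, hQ, hH, hW, rfl, hdist ▸ hcrude, ?_⟩
  rw [hdist]
  -- The factor `2` on the left is what makes the estimate sharp to second order.
  have e : (2 : ℝ) • (H - 1) = (Wᵀ * W - 1) - (H - 1) * (H - 1) := by
    rw [← hHH, two_smul]; noncomm_ring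
  have h2 : 2 * frobNorm (H - 1) = frobNorm ((2 : ℝ) • (H - 1)) := by
    rw [frobNorm_smul]; norm_num
  rw [h2, e]
  refine (frobNorm_sub_le _ _).trans ?_
  have := frobNorm_mul_le (H - 1) (H - 1)
  nlinarith [frobNorm_nonneg (H - 1)]

/-- For `W = Q H` with `H` positive definite, `Q` is the only nearest Stiefel matrix:
`‖W - Z‖² = ‖W - Q‖² + tr ((Q - Z) H (Q - Z)ᵀ)` for all Stiefel matrices `Z`. -/
lemma eq_of_polar_of_frobNorm_le {Q Z : Matrix m k ℝ} {H : Matrix k k ℝ} (hQ : Q ∈ stiefel m k)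
    (hZ : Z ∈ stiefel m k) (hH : H.PosDef) (h : frobNorm (Q * H - Z) ≤ frobNorm (Q * H - Q)) :
    Z = Q := by
  obtain ⟨K, hK, hKK⟩ := exists_posDef_sqrt hH
  have hKt : Kᵀ = K := by simpa using hK.isHermitian.eq
  have hHt : Hᵀ = H := by simpa using hH.isHermitian.eq
  have h1 := pow_le_pow_left₀ (frobNorm_nonneg _) h 2
  rw [frobNorm_sub_sq, frobNorm_sub_sq, frobNorm_sq_stiefel hQ, frobNorm_sq_stiefel hZ] at h1
  have hS : ∀ U V : Matrix m k ℝ, frobInner (U * K) (V * K) = frobInner (U * H) V := by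
    intro U V
    rw [frobInner_mul_right, frobInner_mul_right, hKt, Matrix.mul_assoc, hKK, frobInner_comm,
      frobInner_mul_right, hHt, frobInner_comm, frobInner_mul_right, hHt]
  have hZZ : ∀ U : Matrix m k ℝ, U ∈ stiefel m k → frobInner (U * H) U = H.trace := by
    intro U hU
    rw [frobInner_mul_left, show Uᵀ * U = 1 from hU, frobInner, Matrix.mul_one,
      Matrix.trace_transpose]
  have h2 : frobNorm ((Q - Z) * K) ^ 2 = 2 * H.trace - 2 * frobInner (Q * H) Z := by
    rw [Matrix.sub_mul, frobNorm_sub_sq, frobNorm_sq, frobNorm_sq, hS, hS, hS, hZZ Q hQ, hZZ Z hZ]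
    ring
  rw [hZZ Q hQ] at h1
  have h3 : frobNorm ((Q - Z) * K) = 0 := by
    nlinarith [frobNorm_nonneg ((Q - Z) * K)]
  have h4 : (Q - Z) * K = 0 := frobNorm_eq_zero.1 h3
  have hdet : IsUnit K.det := (Matrix.isUnit_iff_isUnit_det K).1 hK.isUnit
  have h5 : Q - Z = 0 := by
    have := congrArg (· * K⁻¹) h4
    simpa [Matrix.mul_assoc, Matrix.mul_nonsing_inv K hdet] using this
  exact (sub_eq_zero.1 h5).symm

end Polar

/-! ### The averaging operator and its inverse -/

section Averaging

variable {n p ℓ : ℕ}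

/-- The block labels of a partition, as a function on the column indices. -/
lemma IsPartition.exists_label {C : Fin ℓ → Finset (Fin p)} (hC : IsPartition C) :
    ∃ b : Fin p → Fin ℓ, ∀ j a, j ∈ C a ↔ b j = a := by
  choose b hb using hC.2
  refine ⟨b, fun j a => ⟨fun h => ?_, fun h => h ▸ hb j⟩⟩
  by_contra hne
  exact Finset.disjoint_left.1 (hC.1 _ _ hne) (hb j) h

/-- The two block labels in a pair. -/
def BlockPair.labels (s : BlockPair ℓ) : Finset (Fin ℓ) := Subtype.val s

lemma BlockPair.card_labels (s : BlockPair ℓ) : s.labels.card = 2 := Subtype.property s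

lemma BlockPair.labels_injective : Function.Injective (BlockPair.labels : BlockPair ℓ → _) :=
  Subtype.val_injective

lemma mem_pairCols {C : Fin ℓ → Finset (Fin p)} {b : Fin p → Fin ℓ}
    (hb : ∀ j a, j ∈ C a ↔ b j = a) (s : BlockPair ℓ) (j : Fin p) :
    j ∈ pairCols C s ↔ b j ∈ s.labels := by
  change j ∈ s.labels.biUnion C ↔ _
  simp [hb]

/-- The part of a `p × p` matrix off the diagonal blocks of the partition with labels `b`. -/
def offBlock (b : Fin p → Fin ℓ) : Matrix (Fin p) (Fin p) ℝ →ₗ[ℝ] Matrix (Fin p) (Fin p) ℝ where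
  toFun M := Matrix.of fun i j => if b i = b j then 0 else M i j
  map_add' M N := by ext i j; simp only [Matrix.of_apply, Matrix.add_apply]; split_ifs <;> simp
  map_smul' c M := by ext i j; simp [Matrix.of_apply]

lemma offBlock_apply (b : Fin p → Fin ℓ) (M : Matrix (Fin p) (Fin p) ℝ) (i j : Fin p) :
    offBlock b M i j = if b i = b j then 0 else M i j := rfl

lemma offBlock_offBlock (b : Fin p → Fin ℓ) (M : Matrix (Fin p) (Fin p) ℝ) :
    offBlock b (offBlock b M) = offBlock b M := by
  ext i j; simp only [offBlock_apply]; split_ifs <;> rfl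

lemma offBlock_transpose (b : Fin p → Fin ℓ) (M : Matrix (Fin p) (Fin p) ℝ) :
    offBlock b Mᵀ = (offBlock b M)ᵀ := by
  ext i j; simp only [offBlock_apply, Matrix.transpose_apply, eq_comm]

lemma offBlock_one (b : Fin p → Fin ℓ) : offBlock b 1 = 0 := by
  ext i j
  simp only [offBlock_apply, Matrix.one_apply, Matrix.zero_apply]
  split_ifs <;> simp_all

lemma frobInner_offBlock_left (b : Fin p → Fin ℓ) (M N : Matrix (Fin p) (Fin p) ℝ) :
    frobInner (offBlock b M) N = frobInner (offBlock b M) (offBlock b N) := by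
  simp only [frobInner_eq_sum, offBlock_apply]
  refine Finset.sum_congr rfl fun i _ => Finset.sum_congr rfl fun j _ => ?_
  split_ifs <;> simp

lemma frobInner_offBlock_right (b : Fin p → Fin ℓ) (M N : Matrix (Fin p) (Fin p) ℝ) :
    frobInner M (offBlock b N) = frobInner (offBlock b M) (offBlock b N) := by
  rw [frobInner_comm, frobInner_offBlock_left, frobInner_comm]

lemma frobNorm_offBlock_le (b : Fin p → Fin ℓ) (M : Matrix (Fin p) (Fin p) ℝ) :
    frobNorm (offBlock b M) ≤ frobNorm M := by
  have h1 : frobNorm (offBlock b M) ^ 2 = frobInner M (offBlock b M) := by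
    rw [frobNorm_sq]; exact (frobInner_offBlock_right b M M).symm
  have h2 := frobInner_le M (offBlock b M)
  nlinarith [frobNorm_nonneg M, frobNorm_nonneg (offBlock b M)]

/-- The number of pairs containing both `a` and `c`. -/
lemma sum_blockPair_mem_mem (a c : Fin ℓ) :
    ∑ s : BlockPair ℓ, (if a ∈ s.labels ∧ c ∈ s.labels then (1 : ℝ) else 0) =
      if a = c then (ℓ : ℝ) - 1 else 1 := by
  have hne : ∀ a c : Fin ℓ, a ≠ c →
      ∑ s : BlockPair ℓ, (if a ∈ s.labels ∧ c ∈ s.labels then (1 : ℝ) else 0) = 1 := by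
    intro a c hac
    let t : BlockPair ℓ := ⟨{a, c}, Finset.card_pair hac⟩
    have ht : t.labels = {a, c} := rfl
    rw [Finset.sum_eq_single t]
    · simp [ht]
    · intro s _ hs
      rw [if_neg]
      rintro ⟨h1, h2⟩
      refine hs (BlockPair.labels_injective (Finset.eq_of_subset_of_card_le ?_ ?_).symm)
      · intro x hx
        rw [ht] at hx
        rcases Finset.mem_insert.1 hx with rfl | hx
        · exact h1
        · rwa [Finset.mem_singleton.1 hx]
      · rw [s.card_labels, t.card_labels]
    · intro h; exact absurd (Finset.mem_univ _) h
  split_ifs with hac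
  · subst hac
    -- Double counting: each pair containing `a` has two elements.
    have h1 : ∑ c : Fin ℓ, ∑ s : BlockPair ℓ, (if a ∈ s.labels ∧ c ∈ s.labels then (1 : ℝ) else 0) =
        2 * ∑ s : BlockPair ℓ, (if a ∈ s.labels ∧ a ∈ s.labels then (1 : ℝ) else 0) := by
      rw [Finset.sum_comm, Finset.mul_sum]
      refine Finset.sum_congr rfl fun s _ => ?_
      by_cases h : a ∈ s.labels
      · simp [h, s.card_labels]
      · simp [h]
    rw [Fintype.sum_eq_add_sum_compl a] at h1
    have h2 : ∑ c ∈ ({a} : Finset (Fin ℓ))ᶜ, ∑ s : BlockPair ℓ,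
        (if a ∈ s.labels ∧ c ∈ s.labels then (1 : ℝ) else 0) = (ℓ : ℝ) - 1 := by
      rw [Finset.sum_congr rfl fun c hc => hne a c (by
        rw [Finset.mem_compl, Finset.mem_singleton] at hc; exact fun h => hc h.symm)]
      have : 1 ≤ ℓ := a.pos
      simp [Finset.card_compl, Nat.cast_sub this]
    linarith
  · exact hne a c hac

lemma sum_blockPair_mem (a : Fin ℓ) :
    ∑ s : BlockPair ℓ, (if a ∈ s.labels then (1 : ℝ) else 0) = (ℓ : ℝ) - 1 := by
  simpa using sum_blockPair_mem_mem a a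

/-- The diagonal matrix that keeps the columns with index in `S` and annihilates the others. -/
def colProj (S : Finset (Fin p)) : Matrix (Fin p) (Fin p) ℝ :=
  Matrix.diagonal fun j => if j ∈ S then 1 else 0

lemma mul_colProj_apply (S : Finset (Fin p)) (A : Matrix (Fin n) (Fin p) ℝ) (i : Fin n)
    (j : Fin p) : (A * colProj S) i j = if j ∈ S then A i j else 0 := by
  simp [colProj, Matrix.mul_diagonal]

lemma colProj_compl (S : Finset (Fin p)) : colProj Sᶜ = 1 - colProj S := by
  ext i j
  simp only [colProj, Matrix.sub_apply, Matrix.diagonal_apply, Matrix.one_apply,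
    Finset.mem_compl]
  split_ifs <;> simp_all

lemma cols_mul_transpose_idCols (S : Finset (Fin p)) (A : Matrix (Fin n) (Fin p) ℝ) :
    cols S A * (idCols S)ᵀ = A * colProj S := by
  ext i j
  rw [mul_colProj_apply, Matrix.mul_apply]
  refine (Finset.sum_coe_sort S fun x => A i x * (1 : Matrix (Fin p) (Fin p) ℝ) j x).trans ?_
  simp [Matrix.one_apply]

lemma mul_cols (S : Finset (Fin p))
    {m : Type*} [Fintype m] (D : Matrix m (Fin n) ℝ) (A : Matrix (Fin n) (Fin p) ℝ) :
    D * cols S A * (idCols S)ᵀ = D * A * colProj S := by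
  rw [Matrix.mul_assoc, cols_mul_transpose_idCols, Matrix.mul_assoc]

lemma cols_mul_transpose_cols (S : Finset (Fin p)) (A : Matrix (Fin n) (Fin p) ℝ) :
    cols S A * (cols S A)ᵀ = A * colProj S * Aᵀ := by
  ext i j
  rw [Matrix.mul_apply, Matrix.mul_apply]
  refine (Finset.sum_coe_sort S fun x => A i x * A j x).trans ?_
  simp [mul_colProj_apply]

lemma frobNorm_mul_colProj_le (S : Finset (Fin p)) (A : Matrix (Fin n) (Fin p) ℝ) :
    frobNorm (A * colProj S) ≤ frobNorm A := by
  refine (sq_le_sq₀ (frobNorm_nonneg _) (frobNorm_nonneg _)).1 ?_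
  rw [frobNorm_sq, frobNorm_sq, frobInner_eq_sum, frobInner_eq_sum]
  refine Finset.sum_le_sum fun i _ => Finset.sum_le_sum fun j _ => ?_
  rw [mul_colProj_apply]
  split_ifs
  · rfl
  · simpa using mul_self_nonneg (A i j)

variable {C : Fin ℓ → Finset (Fin p)} {b : Fin p → Fin ℓ}

lemma sum_colProj (hb : ∀ j a, j ∈ C a ↔ b j = a) :
    ∑ s : BlockPair ℓ, colProj (pairCols C s) = ((ℓ : ℝ) - 1) • 1 := by
  ext i j
  rw [Matrix.sum_apply, Matrix.smul_apply, Matrix.one_apply]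
  by_cases hij : i = j
  · subst hij
    simp only [colProj, Matrix.diagonal_apply_eq, mem_pairCols hb, sum_blockPair_mem]
    simp
  · simp [colProj, hij]

lemma sum_colProj_mul_mul (hb : ∀ j a, j ∈ C a ↔ b j = a) (M : Matrix (Fin p) (Fin p) ℝ) :
    ∑ s : BlockPair ℓ, colProj (pairCols C s) * M * colProj (pairCols C s) =
      ((ℓ : ℝ) - 1) • M - ((ℓ : ℝ) - 2) • offBlock b M := by
  ext i j
  have h : ∀ s : BlockPair ℓ, (colProj (pairCols C s) * M * colProj (pairCols C s)) i j =
      (if b i ∈ s.labels ∧ b j ∈ s.labels then (1 : ℝ) else 0) * M i j := by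
    intro s
    rw [mul_colProj_apply, colProj, Matrix.diagonal_mul]
    simp only [mem_pairCols hb]
    by_cases h1 : b i ∈ s.labels <;> by_cases h2 : b j ∈ s.labels <;> simp [h1, h2]
  rw [Matrix.sum_apply, Finset.sum_congr rfl fun s _ => h s, ← Finset.sum_mul,
    sum_blockPair_mem_mem, Matrix.sub_apply, Matrix.smul_apply, Matrix.smul_apply, offBlock_apply]
  split_ifs <;> simp only [smul_eq_mul] <;> ring

/-- The averaging operator only damps the components of `Xᵀ ξ` off the diagonal blocks. -/
lemma avgOp_apply (hℓ : 2 ≤ ℓ) (hb : ∀ j a, j ∈ C a ↔ b j = a)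
    (X ξ : Matrix (Fin n) (Fin p) ℝ) :
    avgOp C X ξ = (2 / (ℓ : ℝ)) • (ξ - (((ℓ : ℝ) - 2) / (ℓ - 1)) • (X * offBlock b (Xᵀ * ξ))) := by
  have h : ∀ s : BlockPair ℓ,
      (1 - cols (pairCols C s)ᶜ X * (cols (pairCols C s)ᶜ X)ᵀ) * cols (pairCols C s) ξ *
      (idCols (pairCols C s))ᵀ = ξ * colProj (pairCols C s) - X * ((Xᵀ * ξ) * colProj (pairCols C s))
        + X * (colProj (pairCols C s) * (Xᵀ * ξ) * colProj (pairCols C s)) := by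
    intro s
    rw [mul_cols, cols_mul_transpose_cols, colProj_compl]
    simp only [Matrix.sub_mul, Matrix.mul_sub, Matrix.one_mul, Matrix.mul_one, Matrix.mul_assoc]
    abel
  change ((ℓ.choose 2 : ℕ) : ℝ)⁻¹ • ∑ s : BlockPair ℓ,
    (1 - cols (pairCols C s)ᶜ X * (cols (pairCols C s)ᶜ X)ᵀ) * cols (pairCols C s) ξ *
      (idCols (pairCols C s))ᵀ = _
  rw [Finset.sum_congr rfl fun s _ => h s, Finset.sum_add_distrib, Finset.sum_sub_distrib,
    ← Matrix.mul_sum, ← Matrix.mul_sum, ← Matrix.mul_sum, ← Matrix.mul_sum, sum_colProj hb,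
    sum_colProj_mul_mul hb, Nat.cast_choose_two]
  have hℓ' : (2 : ℝ) ≤ ℓ := by exact_mod_cast hℓ
  have h1 : (ℓ : ℝ) - 1 ≠ 0 := by linarith
  have h2 : (ℓ : ℝ) ≠ 0 := by linarith
  simp only [Matrix.mul_sub, Matrix.mul_smul, Matrix.mul_one]
  ext i j
  simp only [Matrix.smul_apply, Matrix.sub_apply, Matrix.add_apply, smul_eq_mul]
  field_simp
  ring

/-- The explicit form of the inverse of the averaging operator at a Stiefel matrix, see
`inverse_avgOp`. -/
noncomputable def invAvg (b : Fin p → Fin ℓ) (X : Matrix (Fin n) (Fin p) ℝ) :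
    Matrix (Fin n) (Fin p) ℝ →ₗ[ℝ] Matrix (Fin n) (Fin p) ℝ where
  toFun ξ := ((ℓ : ℝ) / 2) • (ξ + ((ℓ : ℝ) - 2) • (X * offBlock b (Xᵀ * ξ)))
  map_add' ξ η := by
    simp only [Matrix.mul_add, map_add, smul_add]; abel
  map_smul' c ξ := by
    simp only [Matrix.mul_smul, map_smul, smul_add, RingHom.id_apply, smul_comm _ c]

lemma invAvg_apply (b : Fin p → Fin ℓ) (X ξ : Matrix (Fin n) (Fin p) ℝ) :
    invAvg b X ξ = ((ℓ : ℝ) / 2) • (ξ + ((ℓ : ℝ) - 2) • (X * offBlock b (Xᵀ * ξ))) := rfl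

lemma inverse_avgOp (hℓ : 2 ≤ ℓ) (hb : ∀ j a, j ∈ C a ↔ b j = a)
    {X : Matrix (Fin n) (Fin p) ℝ} (hX : X ∈ stiefel (Fin n) (Fin p)) :
    Ring.inverse (avgOp C X : Module.End ℝ (Matrix (Fin n) (Fin p) ℝ)) = invAvg b X := by
  have hℓ' : (2 : ℝ) ≤ ℓ := by exact_mod_cast hℓ
  have h1 : (ℓ : ℝ) - 1 ≠ 0 := by linarith
  have h2 : (ℓ : ℝ) ≠ 0 := by linarith
  have hXX : ∀ M : Matrix (Fin p) (Fin p) ℝ, Xᵀ * (X * M) = M := fun M => by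
    rw [← Matrix.mul_assoc, show Xᵀ * X = 1 from hX, Matrix.one_mul]
  have hAB : (avgOp C X : Module.End ℝ _) * invAvg b X = 1 := by
    refine LinearMap.ext fun ξ => ?_
    rw [Module.End.mul_apply, avgOp_apply hℓ hb, invAvg_apply, Module.End.one_apply]
    simp only [Matrix.mul_smul, Matrix.mul_add, hXX, map_smul, map_add, offBlock_offBlock]
    ext i j
    simp only [Matrix.smul_apply, Matrix.sub_apply, Matrix.add_apply, smul_eq_mul]
    field_simp
    ring
  have hBA : (invAvg b X : Module.End ℝ _) * avgOp C X = 1 := by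
    refine LinearMap.ext fun ξ => ?_
    rw [Module.End.mul_apply, avgOp_apply hℓ hb, invAvg_apply, Module.End.one_apply]
    simp only [Matrix.mul_smul, Matrix.mul_sub, hXX, map_smul, map_sub, offBlock_offBlock]
    ext i j
    simp only [Matrix.smul_apply, Matrix.sub_apply, Matrix.add_apply, smul_eq_mul]
    field_simp
    ring
  exact Ring.inverse_unit (⟨avgOp C X, invAvg b X, hAB, hBA⟩ :
    (Module.End ℝ (Matrix (Fin n) (Fin p) ℝ))ˣ)

lemma mahaSq_eq_frobInner (hℓ : 2 ≤ ℓ) (hb : ∀ j a, j ∈ C a ↔ b j = a)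
    {X : Matrix (Fin n) (Fin p) ℝ} (hX : X ∈ stiefel (Fin n) (Fin p))
    (ξ : Matrix (Fin n) (Fin p) ℝ) : mahaSq C X ξ = frobInner (invAvg b X ξ) ξ := by
  rw [mahaSq, inverse_avgOp hℓ hb hX]

lemma frobInner_invAvg (b : Fin p → Fin ℓ) (X ξ η : Matrix (Fin n) (Fin p) ℝ) :
    frobInner (invAvg b X ξ) η = (ℓ : ℝ) / 2 * (frobInner ξ η +
      (ℓ - 2) * frobInner (offBlock b (Xᵀ * ξ)) (offBlock b (Xᵀ * η))) := by
  rw [invAvg_apply, frobInner_smul_left, frobInner_add_left, frobInner_smul_left,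
    frobInner_mul_left, frobInner_offBlock_left]

lemma mahaSq_eq (hℓ : 2 ≤ ℓ) (hb : ∀ j a, j ∈ C a ↔ b j = a)
    {X : Matrix (Fin n) (Fin p) ℝ} (hX : X ∈ stiefel (Fin n) (Fin p))
    (ξ : Matrix (Fin n) (Fin p) ℝ) :
    mahaSq C X ξ = (ℓ : ℝ) / 2 * (frobNorm ξ ^ 2 +
      (ℓ - 2) * frobNorm (offBlock b (Xᵀ * ξ)) ^ 2) := by
  rw [mahaSq_eq_frobInner hℓ hb hX, frobInner_invAvg, frobNorm_sq, frobNorm_sq]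

lemma le_mahaSq (hℓ : 2 ≤ ℓ) (hb : ∀ j a, j ∈ C a ↔ b j = a)
    {X : Matrix (Fin n) (Fin p) ℝ} (hX : X ∈ stiefel (Fin n) (Fin p))
    (ξ : Matrix (Fin n) (Fin p) ℝ) : (ℓ : ℝ) / 2 * frobNorm ξ ^ 2 ≤ mahaSq C X ξ := by
  have hℓ' : (2 : ℝ) ≤ ℓ := by exact_mod_cast hℓ
  rw [mahaSq_eq hℓ hb hX]
  have : 0 ≤ ((ℓ : ℝ) - 2) * frobNorm (offBlock b (Xᵀ * ξ)) ^ 2 :=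
    mul_nonneg (by linarith) (sq_nonneg _)
  exact mul_le_mul_of_nonneg_left (by linarith) (by linarith)

lemma frobNorm_offBlock_transpose_mul_le (b : Fin p → Fin ℓ) {X : Matrix (Fin n) (Fin p) ℝ}
    (hX : X ∈ stiefel (Fin n) (Fin p)) (ξ : Matrix (Fin n) (Fin p) ℝ) :
    frobNorm (offBlock b (Xᵀ * ξ)) ≤ frobNorm ξ :=
  (frobNorm_offBlock_le _ _).trans (frobNorm_stiefel_transpose_mul_le hX _)

lemma mahaSq_le (hℓ : 2 ≤ ℓ) (hb : ∀ j a, j ∈ C a ↔ b j = a)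
    {X : Matrix (Fin n) (Fin p) ℝ} (hX : X ∈ stiefel (Fin n) (Fin p))
    (ξ : Matrix (Fin n) (Fin p) ℝ) :
    mahaSq C X ξ ≤ (ℓ : ℝ) / 2 * (ℓ - 1) * frobNorm ξ ^ 2 := by
  have hℓ' : (2 : ℝ) ≤ ℓ := by exact_mod_cast hℓ
  rw [mahaSq_eq hℓ hb hX, mul_assoc]
  refine mul_le_mul_of_nonneg_left ?_ (by linarith)
  have h1 := pow_le_pow_left₀ (frobNorm_nonneg _) (frobNorm_offBlock_transpose_mul_le b hX ξ) 2
  nlinarith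

lemma frobNorm_invAvg_le (hℓ : 2 ≤ ℓ) (b : Fin p → Fin ℓ) {X : Matrix (Fin n) (Fin p) ℝ}
    (hX : X ∈ stiefel (Fin n) (Fin p)) (ξ : Matrix (Fin n) (Fin p) ℝ) :
    frobNorm (invAvg b X ξ) ≤ (ℓ : ℝ) / 2 * (ℓ - 1) * frobNorm ξ := by
  have hℓ' : (2 : ℝ) ≤ ℓ := by exact_mod_cast hℓ
  rw [invAvg_apply, frobNorm_smul, abs_of_nonneg (by linarith), mul_assoc]
  refine mul_le_mul_of_nonneg_left ?_ (by linarith)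
  refine (frobNorm_add_le _ _).trans ?_
  rw [frobNorm_smul, abs_of_nonneg (by linarith), frobNorm_stiefel_mul hX]
  nlinarith [frobNorm_offBlock_transpose_mul_le b hX ξ]

/-- The squared Mahalanobis distance between Stiefel matrices. -/
lemma mahaSq_sub (hℓ : 2 ≤ ℓ) (hb : ∀ j a, j ∈ C a ↔ b j = a)
    {X Y : Matrix (Fin n) (Fin p) ℝ} (hX : X ∈ stiefel (Fin n) (Fin p))
    (hY : Y ∈ stiefel (Fin n) (Fin p)) :
    mahaSq C X (Y - X) = (ℓ : ℝ) / 2 * (2 * p - 2 * frobInner X Y +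
      (ℓ - 2) * frobNorm (offBlock b (Xᵀ * Y)) ^ 2) := by
  rw [mahaSq_eq hℓ hb hX, Matrix.mul_sub, show Xᵀ * X = 1 from hX, map_sub, offBlock_one, sub_zero,
    frobNorm_sub_sq, frobNorm_sq_stiefel hX, frobNorm_sq_stiefel hY, frobInner_comm, Fintype.card_fin]
  ring

end Averaging

/-! ### The adaptive proximal map -/

section Proximal

variable {n p ℓ : ℕ}

/-- The standing assumptions on the objective: `Ω` is a neighborhood of the Stiefel manifold on
which `f` is `τ`-weakly convex and `L`-Lipschitz in the Frobenius norm. -/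
structure WeaklyConvexNearStiefel (f : Matrix (Fin n) (Fin p) ℝ → ℝ)
    (Ω : Set (Matrix (Fin n) (Fin p) ℝ)) (τ L : ℝ) : Prop where
  nhds : ∀ X ∈ stiefel (Fin n) (Fin p), Ω ∈ 𝓝 X
  convex : ConvexOn ℝ Ω fun X => f X + τ / 2 * frobNorm X ^ 2
  lip : ∀ X ∈ Ω, ∀ Y ∈ Ω, |f X - f Y| ≤ L * frobNorm (X - Y)
  tau_nonneg : 0 ≤ τ
  lip_pos : 0 < L

namespace WeaklyConvexNearStiefel

variable {f : Matrix (Fin n) (Fin p) ℝ → ℝ} {Ω : Set (Matrix (Fin n) (Fin p) ℝ)} {τ L : ℝ}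

lemma mem (hf : WeaklyConvexNearStiefel f Ω τ L) {X : Matrix (Fin n) (Fin p) ℝ}
    (hX : X ∈ stiefel (Fin n) (Fin p)) : X ∈ Ω := mem_of_mem_nhds (hf.nhds X hX)

lemma le_add (hf : WeaklyConvexNearStiefel f Ω τ L) {X Y : Matrix (Fin n) (Fin p) ℝ}
    (hX : X ∈ Ω) (hY : Y ∈ Ω) : f X ≤ f Y + L * frobNorm (X - Y) := by
  linarith [(abs_le.1 (hf.lip X hX Y hY)).2]

lemma continuousAt (hf : WeaklyConvexNearStiefel f Ω τ L) {X : Matrix (Fin n) (Fin p) ℝ}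
    (hX : Ω ∈ 𝓝 X) : ContinuousAt f X := by
  rw [ContinuousAt, tendsto_iff_dist_tendsto_zero]
  have h0 : Tendsto (fun Y => L * frobNorm (Y - X)) (𝓝 X) (𝓝 0) := by
    have : Continuous fun Y => L * frobNorm (Y - X) :=
      continuous_const.mul (continuous_frobNorm.comp (continuous_id.sub continuous_const))
    have h := this.tendsto X
    simpa [frobNorm] using h
  refine squeeze_zero' (Eventually.of_forall fun _ => dist_nonneg) ?_ h0
  filter_upwards [hX] with Y hY
  rw [Real.dist_eq]
  exact hf.lip Y hY X (mem_of_mem_nhds hX)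

lemma segment_mem (hf : WeaklyConvexNearStiefel f Ω τ L) {X Y : Matrix (Fin n) (Fin p) ℝ}
    (hX : X ∈ Ω) (hY : Y ∈ Ω) {t : ℝ} (ht0 : 0 ≤ t) (ht1 : t ≤ 1) : X + t • (Y - X) ∈ Ω := by
  have h := hf.convex.1 hX hY (sub_nonneg.2 ht1) ht0 (by ring)
  convert h using 1
  module

/-- Weak convexity along a segment. -/
lemma segment_le (hf : WeaklyConvexNearStiefel f Ω τ L) {X Y : Matrix (Fin n) (Fin p) ℝ}
    (hX : X ∈ Ω) (hY : Y ∈ Ω) {t : ℝ} (ht0 : 0 ≤ t) (ht1 : t ≤ 1) :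
    f (X + t • (Y - X)) ≤
      (1 - t) * f X + t * f Y + τ / 2 * (t * (1 - t)) * frobNorm (Y - X) ^ 2 := by
  have h := hf.convex.2 hX hY (sub_nonneg.2 ht1) ht0 (by ring)
  have e : (1 - t) • X + t • Y = X + t • (Y - X) := by module
  simp only [e, smul_eq_mul] at h
  have h1 : frobNorm (X + t • (Y - X)) ^ 2 = (1 - t) * frobNorm X ^ 2 + t * frobNorm Y ^ 2
      - t * (1 - t) * frobNorm (Y - X) ^ 2 := by
    simp only [frobNorm_sq, frobInner_add_left, frobInner_add_right, frobInner_smul_left,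
      frobInner_smul_right, frobInner_sub_left, frobInner_sub_right, frobInner_comm Y X]
    ring
  rw [h1] at h
  linarith

end WeaklyConvexNearStiefel

lemma nonpos_of_eventually_le_mul {c K : ℝ} (h : ∀ᶠ t in 𝓝[>] (0 : ℝ), c ≤ K * t) : c ≤ 0 := by
  have h1 : Tendsto (fun t : ℝ => K * t) (𝓝[>] 0) (𝓝 0) := by
    have : Tendsto (fun t : ℝ => K * t) (𝓝 0) (𝓝 (K * 0)) := (continuous_const.mul
      continuous_id).tendsto 0
    rw [mul_zero] at this
    exact this.mono_left nhdsWithin_le_nhds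
  exact ge_of_tendsto h1 h

lemma transpose_mul_self_segment {Y Z : Matrix (Fin n) (Fin p) ℝ}
    (hY : Y ∈ stiefel (Fin n) (Fin p)) (hZ : Z ∈ stiefel (Fin n) (Fin p)) (t : ℝ) :
    (Y + t • (Z - Y))ᵀ * (Y + t • (Z - Y)) - 1 = (-(t * (1 - t))) • ((Z - Y)ᵀ * (Z - Y)) := by
  have h1 : Yᵀ * Y = 1 := hY
  have h2 : Zᵀ * Z = 1 := hZ
  simp only [Matrix.transpose_add, Matrix.transpose_smul, Matrix.transpose_sub, Matrix.add_mul,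
    Matrix.mul_add, Matrix.smul_mul, Matrix.mul_smul, Matrix.sub_mul, Matrix.mul_sub, h1, h2]
  module

lemma frobNorm_transpose_mul_self_le (A : Matrix (Fin n) (Fin p) ℝ) :
    frobNorm (Aᵀ * A) ≤ frobNorm A ^ 2 := by
  have := frobNorm_mul_le Aᵀ A
  rwa [frobNorm_transpose, ← sq] at this

variable {C : Fin ℓ → Finset (Fin p)} {b : Fin p → Fin ℓ}
  {f : Matrix (Fin n) (Fin p) ℝ → ℝ} {Ω : Set (Matrix (Fin n) (Fin p) ℝ)} {τ L lam : ℝ}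

lemma frobInner_invAvg_comm (X ξ η : Matrix (Fin n) (Fin p) ℝ) :
    frobInner (invAvg b X ξ) η = frobInner (invAvg b X η) ξ := by
  rw [frobInner_invAvg, frobInner_invAvg, frobInner_comm ξ, frobInner_comm (offBlock b _)]

lemma mahaSq_add (hℓ : 2 ≤ ℓ) (hb : ∀ j a, j ∈ C a ↔ b j = a)
    {X : Matrix (Fin n) (Fin p) ℝ} (hX : X ∈ stiefel (Fin n) (Fin p))
    (ξ η : Matrix (Fin n) (Fin p) ℝ) :
    mahaSq C X (ξ + η) = mahaSq C X ξ + 2 * frobInner (invAvg b X ξ) η + mahaSq C X η := by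
  simp only [mahaSq_eq_frobInner hℓ hb hX, map_add, frobInner_add_left, frobInner_add_right,
    frobInner_invAvg_comm X η ξ]
  ring

lemma mahaSq_smul (X ξ : Matrix (Fin n) (Fin p) ℝ) (t : ℝ) :
    mahaSq C X (t • ξ) = t ^ 2 * mahaSq C X ξ := by
  simp only [mahaSq, map_smul, frobInner_smul_left, frobInner_smul_right]
  ring

lemma mahaSq_zero (X : Matrix (Fin n) (Fin p) ℝ) : mahaSq C X 0 = 0 := by
  simp [mahaSq]

/-- The prox subproblem compared at its center. -/
lemma mahaSq_le_of_mem_proxSet {X Y : Matrix (Fin n) (Fin p) ℝ}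
    (hX : X ∈ stiefel (Fin n) (Fin p)) (hY : Y ∈ proxSet f C lam X) :
    f Y + 1 / (2 * lam) * mahaSq C X (Y - X) ≤ f X := by
  have := hY.2 X hX
  rwa [sub_self, mahaSq_zero, mul_zero, add_zero] at this

/-- The gradient of the quadratic term is bounded at the proximal point. -/
lemma frobNorm_invAvg_prox_le (hf : WeaklyConvexNearStiefel f Ω τ L) (hℓ : 2 ≤ ℓ)
    (hb : ∀ j a, j ∈ C a ↔ b j = a) (hlam : 0 < lam) {X Y : Matrix (Fin n) (Fin p) ℝ}
    (hX : X ∈ stiefel (Fin n) (Fin p)) (hY : Y ∈ proxSet f C lam X) :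
    1 / lam * frobNorm (invAvg b X (Y - X)) ≤ 2 * (ℓ - 1) * L := by
  have hℓ' : (2 : ℝ) ≤ ℓ := by exact_mod_cast hℓ
  have h1 := mahaSq_le_of_mem_proxSet hX hY
  have h2 := le_mahaSq hℓ hb hX (Y - X)
  have h3 := hf.le_add (hf.mem hX) (hf.mem hY.1)
  rw [frobNorm_sub_comm] at h3
  have h4 := frobNorm_invAvg_le hℓ b hX (Y - X)
  set d := frobNorm (Y - X) with hd
  have hd0 : 0 ≤ d := frobNorm_nonneg _
  -- Optimality against `X` and the Lipschitz bound on `f` control the distance `d`.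
  have h5 : 1 / (2 * lam) * ((ℓ : ℝ) / 2 * d ^ 2) ≤ L * d := by
    have := mul_le_mul_of_nonneg_left h2 (by positivity : (0 : ℝ) ≤ 1 / (2 * lam))
    linarith
  have h6 : 1 / lam * (ℓ / 2 * d) ≤ 2 * L := by
    rcases hd0.eq_or_lt with h0 | h0
    · rw [← h0]; linarith [hf.lip_pos]
    · have e : 1 / (2 * lam) * ((ℓ : ℝ) / 2 * d ^ 2) = (1 / lam * (ℓ / 2 * d)) / 2 * d := by
        field_simp
      rw [e] at h5
      linarith [le_of_mul_le_mul_right h5 h0]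
  calc 1 / lam * frobNorm (invAvg b X (Y - X)) ≤ 1 / lam * ((ℓ : ℝ) / 2 * (ℓ - 1) * d) :=
        mul_le_mul_of_nonneg_left h4 (by positivity)
    _ = (1 / lam * (ℓ / 2 * d)) * (ℓ - 1) := by ring
    _ ≤ 2 * L * (ℓ - 1) := mul_le_mul_of_nonneg_right h6 (by linarith)
    _ = _ := by ring

/-- Quadratic growth of the prox subproblem over the Stiefel manifold. The segment from the
minimizer `Y` to `Z` leaves the manifold only to second order, and the polar factors of its points
are feasible competitors. -/
lemma proxSet_growth (hf : WeaklyConvexNearStiefel f Ω τ L) (hℓ : 2 ≤ ℓ)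
    (hb : ∀ j a, j ∈ C a ↔ b j = a) (hlam : 0 < lam) {X Y Z : Matrix (Fin n) (Fin p) ℝ}
    (hX : X ∈ stiefel (Fin n) (Fin p)) (hY : Y ∈ proxSet f C lam X)
    (hZ : Z ∈ stiefel (Fin n) (Fin p)) :
    f Y + 1 / (2 * lam) * mahaSq C X (Y - X) +
      (ℓ / (2 * lam) - τ - (2 * ℓ - 1) * L) / 2 * frobNorm (Z - Y) ^ 2 ≤
      f Z + 1 / (2 * lam) * mahaSq C X (Z - X) := by
  have hℓ' : (2 : ℝ) ≤ ℓ := by exact_mod_cast hℓ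
  have hL := hf.lip_pos
  have hβ := frobNorm_invAvg_prox_le hf hℓ hb hlam hX hY
  set s : ℝ := 1 / (2 * lam) with hs
  have hs0 : 0 < s := by positivity
  have hls : 1 / lam = 2 * s := by rw [hs]; field_simp
  have hls' : (ℓ : ℝ) / (2 * lam) = ℓ * s := by rw [hs]; ring
  rw [hls] at hβ
  rw [hls']
  set E := Z - Y with hE
  set e := frobNorm E with he
  set β := frobNorm (invAvg b X (Y - X)) with hβdef
  set β' : ℝ := (ℓ : ℝ) / 2 * (ℓ - 1) with hβ'
  have hβ'0 : 0 ≤ β' := mul_nonneg (by linarith) (by linarith)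
  have he0 : 0 ≤ e := frobNorm_nonneg _
  have hZD : mahaSq C X (Z - X) =
      mahaSq C X (Y - X) + 2 * frobInner (invAvg b X (Y - X)) E + mahaSq C X E := by
    rw [← mahaSq_add hℓ hb hX]; congr 1; rw [hE]; abel
  have hbE : (ℓ : ℝ) / 2 * e ^ 2 ≤ mahaSq C X E := le_mahaSq hℓ hb hX E
  suffices h : f Y + s * mahaSq C X (Y - X) +
      (ℓ * s - τ - (2 * ℓ - 1) * L) / 2 * e ^ 2 -
      (f Z + s * mahaSq C X (Z - X)) ≤ 0 by linarith
  -- Comparing `Y` with the polar factor at parameter `t` proves the claim up to `t` times the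
  -- constant below, which collects the second-order terms.
  refine nonpos_of_eventually_le_mul (K := (2 * ℓ - 1) * L / 2 * e ^ 4 + s * β' * (2 * e ^ 3 + e ^ 4)
    + ℓ * s / 2 * e ^ 2) ?_
  have hsmall : ∀ᶠ t in 𝓝[>] (0 : ℝ), t * e ^ 2 < 1 := by
    have : Tendsto (fun t : ℝ => t * e ^ 2) (𝓝[>] 0) (𝓝 0) := by
      have : Tendsto (fun t : ℝ => t * e ^ 2) (𝓝 0) (𝓝 (0 * e ^ 2)) :=
        (continuous_id.mul continuous_const).tendsto 0
      rw [zero_mul] at this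
      exact this.mono_left nhdsWithin_le_nhds
    exact this.eventually_lt_const one_pos
  filter_upwards [hsmall, Ioo_mem_nhdsGT (zero_lt_one (α := ℝ))] with t hte ht
  obtain ⟨ht0, ht1⟩ := ht
  set W := Y + t • E with hW
  have hWT : frobNorm (Wᵀ * W - 1) ≤ t * e ^ 2 := by
    rw [hW, hE, transpose_mul_self_segment hY.1 hZ, frobNorm_smul, abs_neg,
      abs_of_nonneg (mul_nonneg ht0.le (by linarith))]
    have := frobNorm_transpose_mul_self_le E
    calc t * (1 - t) * frobNorm ((Z - Y)ᵀ * (Z - Y)) ≤ t * 1 * e ^ 2 :=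
          mul_le_mul (mul_le_mul_of_nonneg_left (by linarith) ht0.le) this (frobNorm_nonneg _)
            (by linarith)
      _ = t * e ^ 2 := by ring
  obtain ⟨Q, H, R, hQ, -, -, -, hr1, hr2⟩ := exists_polar (hWT.trans_lt hte)
  set r := frobNorm (W - Q) with hr
  have hr0 : 0 ≤ r := frobNorm_nonneg _
  have hr1' : r ≤ t * e ^ 2 := hr1.trans hWT
  have hr2' : 2 * r ≤ t * e ^ 2 + (t * e ^ 2) ^ 2 := by
    have := pow_le_pow_left₀ (frobNorm_nonneg _) hWT 2
    linarith
  have hWΩ : W ∈ Ω := hf.segment_mem (hf.mem hY.1) (hf.mem hZ) ht0.le ht1.le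
  have k1 := hY.2 Q hQ
  have k2 : f Q ≤ f W + L * r := by
    rw [hr, frobNorm_sub_comm]; exact hf.le_add (hf.mem hQ) hWΩ
  have k3 : f W ≤ _ := hf.segment_le (hf.mem hY.1) (hf.mem hZ) ht0.le ht1.le
  have k4 : mahaSq C X (W - X) = (1 - t) * mahaSq C X (Y - X) + t * mahaSq C X (Z - X)
      - t * (1 - t) * mahaSq C X E := by
    have e1 : W - X = (Y - X) + t • E := by rw [hW]; abel
    rw [e1, mahaSq_add hℓ hb hX, mahaSq_smul, frobInner_smul_right, hZD]
    ring
  have hBW : frobInner (invAvg b X (W - X)) (Q - W) ≤ (β + t * (β' * e)) * r := by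
    have e1 : W - X = (Y - X) + t • E := by rw [hW]; abel
    have h1 := frobInner_le (invAvg b X (W - X)) (Q - W)
    rw [frobNorm_sub_comm Q W, ← hr] at h1
    refine h1.trans (mul_le_mul_of_nonneg_right ?_ hr0)
    rw [e1, map_add, map_smul]
    refine (frobNorm_add_le _ _).trans ?_
    rw [frobNorm_smul, abs_of_pos ht0]
    exact add_le_add le_rfl (mul_le_mul_of_nonneg_left (frobNorm_invAvg_le hℓ b hX E) ht0.le)
  have k5 : mahaSq C X (Q - X) ≤ mahaSq C X (W - X) + 2 * ((β + t * (β' * e)) * r) + β' * r ^ 2 := by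
    have e1 : Q - X = (W - X) + (Q - W) := by abel
    rw [e1, mahaSq_add hℓ hb hX]
    have := mahaSq_le hℓ hb hX (Q - W)
    rw [frobNorm_sub_comm Q W, ← hr, ← hβ'] at this
    linarith
  have k6 : s * (2 * (t * (β' * e) * r) + β' * r ^ 2) ≤ t ^ 2 * (s * β' * (2 * e ^ 3 + e ^ 4)) := by
    have h1 : t * (β' * e) * r ≤ t * (β' * e) * (t * e ^ 2) :=
      mul_le_mul_of_nonneg_left hr1' (by positivity)
    have h2 : β' * r ^ 2 ≤ β' * (t * e ^ 2) ^ 2 :=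
      mul_le_mul_of_nonneg_left (pow_le_pow_left₀ hr0 hr1' 2) hβ'0
    have h3 := mul_le_mul_of_nonneg_left (add_le_add (mul_le_mul_of_nonneg_left h1 zero_le_two) h2)
      hs0.le
    refine h3.trans (le_of_eq ?_)
    ring
  have k7 : (L + 2 * s * β) * r ≤ (2 * ℓ - 1) * L * ((t * e ^ 2 + (t * e ^ 2) ^ 2) / 2) :=
    mul_le_mul (by linarith) (by linarith) hr0 (mul_nonneg (by linarith) hL.le)
  have k8 : t * (1 - t) * (s * ((ℓ : ℝ) / 2 * e ^ 2)) ≤ t * (1 - t) * (s * mahaSq C X E) :=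
    mul_le_mul_of_nonneg_left (mul_le_mul_of_nonneg_left hbE hs0.le)
      (mul_nonneg ht0.le (by linarith))
  have k9 : 0 ≤ τ * (t ^ 2 * e ^ 2) := mul_nonneg hf.tau_nonneg (by positivity)
  have k10 := mul_le_mul_of_nonneg_left k5 hs0.le
  rw [k4] at k10
  refine le_of_mul_le_mul_left ?_ ht0
  nlinarith only [k1, k2, k3, k6, k7, k8, k9, k10]

/-- The mixed second difference of `(X, Y) ↦ ‖offBlock (Xᵀ Y)‖²` on the Stiefel manifold. -/
lemma offBlock_diff_le (b : Fin p → Fin ℓ) {X X' Y Y' : Matrix (Fin n) (Fin p) ℝ}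
    (hX : X ∈ stiefel (Fin n) (Fin p)) (hX' : X' ∈ stiefel (Fin n) (Fin p))
    (hY : Y ∈ stiefel (Fin n) (Fin p)) (hY' : Y' ∈ stiefel (Fin n) (Fin p)) :
    frobNorm (offBlock b (Xᵀ * Y')) ^ 2 - frobNorm (offBlock b (Xᵀ * Y)) ^ 2 -
      frobNorm (offBlock b (X'ᵀ * Y')) ^ 2 + frobNorm (offBlock b (X'ᵀ * Y)) ^ 2 ≤
      4 * √p * (frobNorm (X' - X) * frobNorm (Y' - Y)) := by
  have hn : ∀ {U : Matrix (Fin n) (Fin p) ℝ}, U ∈ stiefel (Fin n) (Fin p) → frobNorm U = √p := by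
    intro U hU
    rw [← Real.sqrt_sq (frobNorm_nonneg U), frobNorm_sq_stiefel hU, Fintype.card_fin]
  have hV : frobNorm (Y' + Y) ≤ 2 * √p := by
    have := frobNorm_add_le Y' Y
    rw [hn hY, hn hY'] at this
    linarith
  have e : frobNorm (offBlock b (Xᵀ * Y')) ^ 2 - frobNorm (offBlock b (Xᵀ * Y)) ^ 2 -
      frobNorm (offBlock b (X'ᵀ * Y')) ^ 2 + frobNorm (offBlock b (X'ᵀ * Y)) ^ 2 =
      -frobInner (offBlock b ((X' - X)ᵀ * (Y' - Y))) (offBlock b (Xᵀ * (Y' + Y))) -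
      frobInner (offBlock b (X'ᵀ * (Y' - Y))) (offBlock b ((X' - X)ᵀ * (Y' + Y))) := by
    simp only [Matrix.mul_add, Matrix.mul_sub, Matrix.transpose_sub, Matrix.sub_mul, map_add,
      map_sub, frobNorm_sq, frobInner_add_right, frobInner_sub_left, frobInner_sub_right]
    rw [frobInner_comm (offBlock b (Xᵀ * Y')) (offBlock b (Xᵀ * Y)),
      frobInner_comm (offBlock b (X'ᵀ * Y')) (offBlock b (X'ᵀ * Y)),
      frobInner_comm (offBlock b (X'ᵀ * Y')) (offBlock b (Xᵀ * Y')),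
      frobInner_comm (offBlock b (X'ᵀ * Y')) (offBlock b (Xᵀ * Y)),
      frobInner_comm (offBlock b (X'ᵀ * Y)) (offBlock b (Xᵀ * Y)),
      frobInner_comm (offBlock b (X'ᵀ * Y)) (offBlock b (Xᵀ * Y'))]
    ring
  rw [e]
  have h1 := neg_le_frobInner (offBlock b ((X' - X)ᵀ * (Y' - Y))) (offBlock b (Xᵀ * (Y' + Y)))
  have h2 := neg_le_frobInner (offBlock b (X'ᵀ * (Y' - Y))) (offBlock b ((X' - X)ᵀ * (Y' + Y)))
  have h3 : ∀ D : Matrix (Fin n) (Fin p) ℝ, frobNorm (offBlock b ((X' - X)ᵀ * D)) ≤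
      frobNorm (X' - X) * frobNorm D := fun D => (frobNorm_offBlock_le b _).trans <| by
    have := frobNorm_mul_le (X' - X)ᵀ D
    rwa [frobNorm_transpose] at this
  have h4 : frobNorm (offBlock b ((X' - X)ᵀ * (Y' - Y))) * frobNorm (offBlock b (Xᵀ * (Y' + Y))) ≤
      frobNorm (X' - X) * frobNorm (Y' - Y) * (2 * √p) :=
    mul_le_mul (h3 _) ((frobNorm_offBlock_transpose_mul_le b hX _).trans hV) (frobNorm_nonneg _)
      (mul_nonneg (frobNorm_nonneg _) (frobNorm_nonneg _))
  have h5 : frobNorm (offBlock b (X'ᵀ * (Y' - Y))) * frobNorm (offBlock b ((X' - X)ᵀ * (Y' + Y))) ≤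
      frobNorm (Y' - Y) * (frobNorm (X' - X) * (2 * √p)) :=
    mul_le_mul (frobNorm_offBlock_transpose_mul_le b hX' _) ((h3 _).trans
      (mul_le_mul_of_nonneg_left hV (frobNorm_nonneg _))) (frobNorm_nonneg _) (frobNorm_nonneg _)
  linarith

/-- The adaptive proximal map is Lipschitz on the Stiefel manifold: add the growth inequalities of
the subproblems at `X` and `X'`. -/
lemma proxSet_lipschitz (hf : WeaklyConvexNearStiefel f Ω τ L) (hℓ : 2 ≤ ℓ)
    (hb : ∀ j a, j ∈ C a ↔ b j = a) (hlam : 0 < lam)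
    (hμ : 0 < (ℓ : ℝ) / (2 * lam) - τ - (2 * ℓ - 1) * L) :
    ∃ K : ℝ, 0 ≤ K ∧ ∀ X ∈ stiefel (Fin n) (Fin p), ∀ X' ∈ stiefel (Fin n) (Fin p),
      ∀ Y ∈ proxSet f C lam X, ∀ Y' ∈ proxSet f C lam X',
      frobNorm (Y' - Y) ≤ K * frobNorm (X' - X) := by
  have hℓ' : (2 : ℝ) ≤ ℓ := by exact_mod_cast hℓ
  set μ := (ℓ : ℝ) / (2 * lam) - τ - (2 * ℓ - 1) * L with hμdef
  set A : ℝ := 1 / (2 * lam) * (ℓ / 2 * (2 + (ℓ - 2) * (4 * √p))) with hA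
  have hA0 : 0 ≤ A := by
    have : 0 ≤ ((ℓ : ℝ) - 2) * (4 * √p) := mul_nonneg (by linarith) (by positivity)
    have h2 : (0 : ℝ) ≤ ℓ / 2 * (2 + (ℓ - 2) * (4 * √p)) := mul_nonneg (by linarith) (by linarith)
    exact mul_nonneg (by positivity) h2
  refine ⟨A / μ, div_nonneg hA0 hμ.le, fun X hX X' hX' Y hY Y' hY' => ?_⟩
  have g1 := proxSet_growth hf hℓ hb hlam hX hY hY'.1
  have g2 := proxSet_growth hf hℓ hb hlam hX' hY' hY.1
  rw [← hμdef] at g1 g2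
  rw [frobNorm_sub_comm Y Y'] at g2
  rw [mahaSq_sub hℓ hb hX hY.1, mahaSq_sub hℓ hb hX hY'.1] at g1
  rw [mahaSq_sub hℓ hb hX' hY.1, mahaSq_sub hℓ hb hX' hY'.1] at g2
  have g3 := offBlock_diff_le b hX hX' hY.1 hY'.1
  have g4 := frobInner_le (X' - X) (Y' - Y)
  simp only [frobInner_sub_left, frobInner_sub_right] at g4
  set x := frobNorm (X' - X)
  set y := frobNorm (Y' - Y)
  have hy0 : 0 ≤ y := frobNorm_nonneg _
  have hx0 : 0 ≤ x := frobNorm_nonneg _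
  have g5 : (ℓ : ℝ) / 2 * (2 * (x * y) + (ℓ - 2) * (4 * √p * (x * y))) ≥ (ℓ : ℝ) / 2 *
      (2 * (frobInner X' Y' - frobInner X Y' - (frobInner X' Y - frobInner X Y)) + (ℓ - 2) *
      (frobNorm (offBlock b (Xᵀ * Y')) ^ 2 - frobNorm (offBlock b (Xᵀ * Y)) ^ 2 -
      frobNorm (offBlock b (X'ᵀ * Y')) ^ 2 + frobNorm (offBlock b (X'ᵀ * Y)) ^ 2)) :=
    mul_le_mul_of_nonneg_left (add_le_add (by linarith)
      (mul_le_mul_of_nonneg_left g3 (by linarith))) (by linarith)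
  have g6 := mul_le_mul_of_nonneg_left g5 (by positivity : (0 : ℝ) ≤ 1 / (2 * lam))
  have g7 : μ * y ^ 2 ≤ A * x * y := by
    rw [hA]; linarith
  rcases hy0.eq_or_lt with h0 | h0
  · rw [← h0]; positivity
  · rw [div_mul_eq_mul_div, le_div_iff₀ hμ]
    refine le_of_mul_le_mul_right ?_ h0
    linarith

lemma proxSet_nonempty (hf : WeaklyConvexNearStiefel f Ω τ L) (hℓ : 2 ≤ ℓ)
    (hb : ∀ j a, j ∈ C a ↔ b j = a) {X : Matrix (Fin n) (Fin p) ℝ}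
    (hX : X ∈ stiefel (Fin n) (Fin p)) : (proxSet f C lam X).Nonempty := by
  have hcont : ContinuousOn (fun Y => f Y + 1 / (2 * lam) * mahaSq C X (Y - X))
      (stiefel (Fin n) (Fin p)) := by
    intro Y hY
    refine ((hf.continuousAt (hf.nhds Y hY)).add (ContinuousAt.mul continuousAt_const
      (Continuous.continuousAt ?_))).continuousWithinAt
    simp only [mahaSq_eq hℓ hb hX]
    have ho : Continuous (offBlock b) := LinearMap.continuous_of_finiteDimensional _
    have hs : Continuous fun Z : Matrix (Fin n) (Fin p) ℝ => Z - X :=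
      continuous_id.sub continuous_const
    exact continuous_const.mul (((continuous_frobNorm.comp hs).pow 2).add (continuous_const.mul
      ((continuous_frobNorm.comp (ho.comp (continuous_const.matrix_mul hs))).pow 2)))
  obtain ⟨Y, hY, hmin⟩ := isCompact_stiefel.exists_isMinOn ⟨X, hX⟩ hcont
  exact ⟨Y, hY, fun Z hZ => hmin hZ⟩

lemma existsUnique_proxSet (hf : WeaklyConvexNearStiefel f Ω τ L) (hℓ : 2 ≤ ℓ)
    (hb : ∀ j a, j ∈ C a ↔ b j = a) (hlam : 0 < lam)
    (hμ : 0 < (ℓ : ℝ) / (2 * lam) - τ - (2 * ℓ - 1) * L) {X : Matrix (Fin n) (Fin p) ℝ}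
    (hX : X ∈ stiefel (Fin n) (Fin p)) : ∃! Y, Y ∈ proxSet f C lam X := by
  obtain ⟨Y, hY⟩ := proxSet_nonempty (lam := lam) hf hℓ hb hX
  refine ⟨Y, hY, fun Y' hY' => ?_⟩
  obtain ⟨K, -, hK⟩ := proxSet_lipschitz hf hℓ hb hlam hμ
  have h := hK X hX X hX Y hY Y' hY'
  rw [sub_self X, frobNorm_eq_zero.2 (rfl : (0 : Matrix (Fin n) (Fin p) ℝ) = 0), mul_zero] at h
  exact sub_eq_zero.1 (frobNorm_eq_zero.1 (le_antisymm h (frobNorm_nonneg _)))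

lemma prox_mem_proxSet (hf : WeaklyConvexNearStiefel f Ω τ L) (hℓ : 2 ≤ ℓ)
    (hb : ∀ j a, j ∈ C a ↔ b j = a) {X : Matrix (Fin n) (Fin p) ℝ}
    (hX : X ∈ stiefel (Fin n) (Fin p)) : prox f C lam X ∈ proxSet f C lam X :=
  Classical.epsilon_spec (proxSet_nonempty hf hℓ hb hX)

end Proximal

/-! ### Clarke subgradients and stationarity -/

section Clarke

variable {n p ℓ : ℕ} {f : Matrix (Fin n) (Fin p) ℝ → ℝ} {Ω : Set (Matrix (Fin n) (Fin p) ℝ)}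
  {τ L : ℝ}

/-- Clarke subgradients of a weakly convex function satisfy the subgradient inequality with a
quadratic error. -/
lemma WeaklyConvexNearStiefel.subgradient_inequality (hf : WeaklyConvexNearStiefel f Ω τ L)
    {X Y G : Matrix (Fin n) (Fin p) ℝ} (hX : X ∈ stiefel (Fin n) (Fin p))
    (hY : Y ∈ stiefel (Fin n) (Fin p)) (hG : G ∈ clarkeSubdiff f X) :
    f X + frobInner G (Y - X) - τ / 2 * frobNorm (Y - X) ^ 2 ≤ f Y := by
  set V := Y - X with hV
  let v : Matrix (Fin n) (Fin p) ℝ × ℝ → ℝ := fun q =>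
    f (q.1 + V) - f q.1 + τ / 2 * (1 - q.2) * frobNorm V ^ 2
  have hXV : X + V = Y := by rw [hV]; abel
  have hshift : Tendsto (fun Z : Matrix (Fin n) (Fin p) ℝ => Z + V) (𝓝 X) (𝓝 Y) := by
    have : Continuous fun Z : Matrix (Fin n) (Fin p) ℝ => Z + V :=
      continuous_id.add continuous_const
    have h := this.tendsto X
    rwa [hXV] at h
  have hv : Tendsto v (𝓝 X ×ˢ 𝓝[>] (0 : ℝ)) (𝓝 (f Y - f X + τ / 2 * frobNorm V ^ 2)) := by
    have h1 : Tendsto (fun q : Matrix (Fin n) (Fin p) ℝ × ℝ => q.1) (𝓝 X ×ˢ 𝓝[>] (0 : ℝ)) (𝓝 X) :=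
      tendsto_fst
    have h2 : Tendsto (fun q : Matrix (Fin n) (Fin p) ℝ × ℝ => q.2) (𝓝 X ×ˢ 𝓝[>] (0 : ℝ)) (𝓝 0) :=
      tendsto_snd.mono_right nhdsWithin_le_nhds
    have h3 := ((hf.continuousAt (hf.nhds Y hY)).tendsto.comp (hshift.comp h1)).sub
      ((hf.continuousAt (hf.nhds X hX)).tendsto.comp h1)
    have h4 := ((tendsto_const_nhds (x := τ / 2)).mul
      ((tendsto_const_nhds (x := (1 : ℝ))).sub h2)).mul_const (frobNorm V ^ 2)
    have h5 := h3.add h4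
    rw [sub_zero, mul_one] at h5
    exact h5
  have hle : ∀ᶠ q : Matrix (Fin n) (Fin p) ℝ × ℝ in 𝓝 X ×ˢ 𝓝[>] (0 : ℝ),
      (((f (q.1 + q.2 • V) - f q.1) / q.2 : ℝ) : EReal) ≤ ((v q : ℝ) : EReal) := by
    have e1 : ∀ᶠ Z in 𝓝 X, Z ∈ Ω ∧ Z + V ∈ Ω :=
      (eventually_mem_set.2 (hf.nhds X hX)).and
        (hshift.eventually (eventually_mem_set.2 (hf.nhds Y hY)))
    filter_upwards [e1.prod_mk (eventually_mem_set.2 (Ioo_mem_nhdsGT (zero_lt_one (α := ℝ))))]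
      with q hq
    obtain ⟨⟨h1, h2⟩, h3, h4⟩ := hq
    have h5 := hf.segment_le h1 h2 h3.le h4.le
    rw [add_sub_cancel_left] at h5
    rw [EReal.coe_le_coe_iff, div_le_iff₀ h3]
    simp only [v]
    linarith
  have h1 : clarkeDeriv f X V ≤ ((f Y - f X + τ / 2 * frobNorm V ^ 2 : ℝ) : EReal) := by
    refine (limsup_le_limsup hle).trans (le_of_eq ?_)
    exact ((continuous_coe_real_ereal.tendsto _).comp hv).limsup_eq
  have h2 := (hG V).trans h1
  rw [EReal.coe_le_coe_iff] at h2
  linarith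

lemma WeaklyConvexNearStiefel.frobNorm_subgradient_le (hf : WeaklyConvexNearStiefel f Ω τ L)
    {X G : Matrix (Fin n) (Fin p) ℝ} (hX : X ∈ stiefel (Fin n) (Fin p))
    (hG : G ∈ clarkeSubdiff f X) : frobNorm G ≤ L := by
  have hle : ∀ᶠ q : Matrix (Fin n) (Fin p) ℝ × ℝ in 𝓝 X ×ˢ 𝓝[>] (0 : ℝ),
      (((f (q.1 + q.2 • G) - f q.1) / q.2 : ℝ) : EReal) ≤ ((L * frobNorm G : ℝ) : EReal) := by
    have h1 : Tendsto (fun q : Matrix (Fin n) (Fin p) ℝ × ℝ => q.1) (𝓝 X ×ˢ 𝓝[>] (0 : ℝ)) (𝓝 X) :=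
      tendsto_fst
    have h2 : Tendsto (fun q : Matrix (Fin n) (Fin p) ℝ × ℝ => q.2) (𝓝 X ×ˢ 𝓝[>] (0 : ℝ)) (𝓝 0) :=
      tendsto_snd.mono_right nhdsWithin_le_nhds
    have h3 := h1.add (h2.smul (tendsto_const_nhds (x := G)))
    rw [zero_smul, add_zero] at h3
    filter_upwards [h1.eventually (eventually_mem_set.2 (hf.nhds X hX)),
      h3.eventually (eventually_mem_set.2 (hf.nhds X hX)),
      tendsto_snd.eventually (eventually_mem_set.2 (self_mem_nhdsWithin))] with q hq1 hq2 hq3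
    have hq3' : 0 < q.2 := hq3
    have h4 := hf.le_add hq2 hq1
    rw [add_sub_cancel_left, frobNorm_smul, abs_of_pos hq3'] at h4
    rw [EReal.coe_le_coe_iff, div_le_iff₀ hq3']
    linarith
  have h1 : clarkeDeriv f X G ≤ ((L * frobNorm G : ℝ) : EReal) :=
    limsup_le_of_le (by isBoundedDefault) hle
  have h2 := (hG G).trans h1
  rw [EReal.coe_le_coe_iff, ← frobNorm_sq, sq] at h2
  rcases (frobNorm_nonneg G).eq_or_lt with h0 | h0
  · rw [← h0]; exact hf.lip_pos.le
  · exact le_of_mul_le_mul_right h2 h0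

/-- A matrix that minorizes the one-sided difference quotients to second order is a Clarke
subgradient. -/
lemma mem_clarkeSubdiff_of_eventually_le {X ξ : Matrix (Fin n) (Fin p) ℝ}
    (h : ∀ V, ∃ K : ℝ, ∀ᶠ t in 𝓝[>] (0 : ℝ),
      f X + t * frobInner ξ V - K * t ^ 2 ≤ f (X + t • V)) : ξ ∈ clarkeSubdiff f X := by
  intro V
  obtain ⟨K, hK⟩ := h V
  have h1 : Tendsto (fun t : ℝ => (X, t)) (𝓝[>] 0) (𝓝 X ×ˢ 𝓝[>] 0) :=
    tendsto_const_nhds.prodMk tendsto_id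
  have h2 : Tendsto (fun t : ℝ => frobInner ξ V - K * t) (𝓝[>] 0) (𝓝 (frobInner ξ V)) := by
    have : Tendsto (fun t : ℝ => frobInner ξ V - K * t) (𝓝 0) (𝓝 (frobInner ξ V - K * 0)) :=
      (continuous_const.sub (continuous_const.mul continuous_id)).tendsto 0
    rw [mul_zero, sub_zero] at this
    exact this.mono_left nhdsWithin_le_nhds
  rw [← ((continuous_coe_real_ereal.tendsto _).comp h2).limsup_eq]
  refine le_trans (limsup_le_limsup ?_) (limsup_le_limsup_of_le h1 (u := fun q :
    Matrix (Fin n) (Fin p) ℝ × ℝ => (((f (q.1 + q.2 • V) - f q.1) / q.2 : ℝ) : EReal)))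
  filter_upwards [hK, self_mem_nhdsWithin] with t ht ht0
  have ht0' : 0 < t := ht0
  simp only [Function.comp_apply]
  rw [EReal.coe_le_coe_iff, le_div_iff₀ ht0']
  linarith

/-- Linear functionals are represented by the Frobenius inner product. -/
lemma exists_frobInner_eq (g : Matrix (Fin n) (Fin p) ℝ →ₗ[ℝ] ℝ) :
    ∃ ξ : Matrix (Fin n) (Fin p) ℝ, ∀ V, frobInner ξ V = g V := by
  refine ⟨Matrix.of fun i j => g (Matrix.single i j 1), fun V => ?_⟩
  conv_rhs => rw [Matrix.matrix_eq_sum_single V]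
  rw [frobInner_eq_sum, map_sum]
  refine Finset.sum_congr rfl fun i _ => ?_
  rw [map_sum]
  refine Finset.sum_congr rfl fun j _ => ?_
  rw [Matrix.of_apply, show Matrix.single i j (V i j) = V i j • Matrix.single i j (1 : ℝ) by simp,
    map_smul, smul_eq_mul, mul_comm]

/-- If `f` does not decrease to first order along a linear subspace `T`, then it has a Clarke
subgradient orthogonal to `T`: separate the strict epigraph of the convex function
`f + τ / 2 * ‖· - X‖²` from the affine subspace through `X` in direction `T`. -/
lemma WeaklyConvexNearStiefel.exists_subgradient_orthogonal
    (hf : WeaklyConvexNearStiefel f Ω τ L) {X : Matrix (Fin n) (Fin p) ℝ} (hX : Ω ∈ 𝓝 X)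
    (T : Submodule ℝ (Matrix (Fin n) (Fin p) ℝ))
    (hT : ∀ V ∈ T, ∃ K : ℝ, ∀ᶠ t in 𝓝[>] (0 : ℝ), f X - K * t ^ 2 ≤ f (X + t • V)) :
    ∃ ξ ∈ clarkeSubdiff f X, ∀ V ∈ T, frobInner ξ V = 0 := by
  set ψ : Matrix (Fin n) (Fin p) ℝ → ℝ := fun Z => f Z + τ / 2 * frobNorm (Z - X) ^ 2 with hψ
  have hψX : ψ X = f X := by simp [hψ, frobNorm]
  have hψconv : ConvexOn ℝ (interior Ω) ψ := by
    refine ⟨hf.convex.1.interior, fun Y hY Z hZ a c ha hc hac => ?_⟩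
    have h := hf.convex.2 (interior_subset hY) (interior_subset hZ) ha hc hac
    simp only [smul_eq_mul] at h
    have e : ∀ W, ψ W = (f W + τ / 2 * frobNorm W ^ 2) +
        (-τ * frobInner W X + τ / 2 * frobNorm X ^ 2) := by
      intro W
      simp only [hψ, frobNorm_sub_sq]
      ring
    simp only [e, smul_eq_mul, frobInner_add_left, frobInner_smul_left]
    have hc' : c = 1 - a := by linarith
    subst hc'
    linarith
  have hψcont : ContinuousOn ψ (interior Ω) := by
    intro Z hZ
    have h1 : Continuous fun W : Matrix (Fin n) (Fin p) ℝ => τ / 2 * frobNorm (W - X) ^ 2 :=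
      continuous_const.mul ((continuous_frobNorm.comp (continuous_id.sub continuous_const)).pow 2)
    exact ((hf.continuousAt (mem_interior_iff_mem_nhds.1 hZ)).add
      h1.continuousAt).continuousWithinAt
  have hXint : X ∈ interior Ω := mem_interior_iff_mem_nhds.2 hX
  have hmin : ∀ V ∈ T, X + V ∈ interior Ω → ψ X ≤ ψ (X + V) := by
    intro V hV hXV
    obtain ⟨K, hK⟩ := hT V hV
    suffices h : ψ X - ψ (X + V) ≤ 0 by linarith
    refine nonpos_of_eventually_le_mul (K := K) ?_
    filter_upwards [hK, Ioo_mem_nhdsGT (zero_lt_one (α := ℝ))] with t ht htt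
    have h1 := hψconv.2 hXint hXV (sub_nonneg.2 htt.2.le) htt.1.le (by ring)
    have e : (1 - t) • X + t • (X + V) = X + t • V := by module
    rw [e] at h1
    have h2 : f (X + t • V) ≤ ψ (X + t • V) := by
      simp only [hψ]
      linarith [mul_nonneg hf.tau_nonneg (sq_nonneg (frobNorm (X + t • V - X)))]
    simp only [smul_eq_mul] at h1
    refine le_of_mul_le_mul_left ?_ htt.1
    linarith
  set A : Set (Matrix (Fin n) (Fin p) ℝ × ℝ) := {q | q.1 ∈ interior Ω ∧ ψ q.1 < q.2} with hA
  have hAconv : Convex ℝ A := hψconv.convex_strict_epigraph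
  have hAopen : IsOpen A := by
    rw [isOpen_iff_mem_nhds]
    rintro ⟨Z, r⟩ ⟨hZ, hr⟩
    have h1 : ContinuousAt ψ Z := (hψcont Z hZ).continuousAt (isOpen_interior.mem_nhds hZ)
    have h2 : ContinuousAt (fun q : Matrix (Fin n) (Fin p) ℝ × ℝ => ψ q.1) (Z, r) :=
      ContinuousAt.comp (g := ψ) (f := Prod.fst) (x := (Z, r)) h1 continuousAt_fst
    have h3 : ContinuousAt (fun q : Matrix (Fin n) (Fin p) ℝ × ℝ => q.2) (Z, r) := continuousAt_snd
    exact (continuousAt_fst.eventually (isOpen_interior.mem_nhds hZ)).and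
      (h2.eventually_lt h3 hr)
  set B : Set (Matrix (Fin n) (Fin p) ℝ × ℝ) := {q | q.1 - X ∈ T ∧ q.2 = ψ X} with hB
  have hBconv : Convex ℝ B := by
    rintro ⟨Y, r⟩ ⟨hY, hr⟩ ⟨Z, r'⟩ ⟨hZ, hr'⟩ a c ha hc hac
    refine ⟨?_, ?_⟩
    · have e : (a • (Y, r) + c • (Z, r')).1 - X = a • (Y - X) + c • (Z - X) := by
        have hc' : c = 1 - a := by linarith
        subst hc'
        simp only [Prod.fst_add, Prod.smul_fst]
        module
      rw [e]
      exact T.add_mem (T.smul_mem a hY) (T.smul_mem c hZ)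
    · simp only [] at hr hr'
      simp only [Prod.snd_add, Prod.smul_snd, hr, hr', smul_eq_mul, ← add_mul, hac, one_mul]
  have hdisj : Disjoint A B := by
    rw [Set.disjoint_left]
    rintro ⟨Z, r⟩ ⟨hZ, hr⟩ ⟨hZT, hrX⟩
    have h := hmin (Z - X) hZT (by rwa [add_sub_cancel])
    rw [add_sub_cancel] at h
    simp only [] at hr hrX
    linarith
  obtain ⟨F, u, hFA, hFB⟩ := geometric_hahn_banach_open hAconv hAopen hBconv hdisj
  set c := F (0, 1) with hc
  have hF : ∀ (Z : Matrix (Fin n) (Fin p) ℝ) (r : ℝ), F (Z, r) = F (Z, 0) + r * c := by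
    intro Z r
    have : (Z, r) = (Z, (0 : ℝ)) + r • ((0 : Matrix (Fin n) (Fin p) ℝ), (1 : ℝ)) := by simp
    rw [this, map_add, map_smul, smul_eq_mul]
  let g : Matrix (Fin n) (Fin p) ℝ →ₗ[ℝ] ℝ :=
    F.toLinearMap.comp (LinearMap.inl ℝ (Matrix (Fin n) (Fin p) ℝ) ℝ)
  have hg : ∀ Z, F (Z, 0) = g Z := fun Z => rfl
  have hBX := hFB (X, ψ X) ⟨by simp, rfl⟩
  rw [hF, hg] at hBX
  have hcneg : c < 0 := by
    have h1 := hFA (X, ψ X + 1) ⟨hXint, by simp⟩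
    rw [hF, hg] at h1
    linarith
  have hgT : ∀ V ∈ T, g V = 0 := by
    intro V hV
    have h1 : ∀ r : ℝ, u - ψ X * c - g X ≤ r * g V := by
      intro r
      have h2 := hFB (X + r • V, ψ X) ⟨by simpa using T.smul_mem r hV, rfl⟩
      rw [hF, hg, map_add, map_smul, smul_eq_mul] at h2
      linarith
    by_contra hne
    have h3 := h1 ((u - ψ X * c - g X - 1) / g V)
    rw [div_mul_cancel₀ _ hne] at h3
    linarith
  have hsub : ∀ Z ∈ interior Ω, ψ X + (-(1 / c)) * g (Z - X) ≤ ψ Z := by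
    intro Z hZ
    have h1 : g Z + ψ Z * c ≤ u := by
      have h2 : Tendsto (fun ε : ℝ => g Z + (ψ Z + ε) * c) (𝓝[>] 0) (𝓝 (g Z + ψ Z * c)) := by
        have : Tendsto (fun ε : ℝ => g Z + (ψ Z + ε) * c) (𝓝 0) (𝓝 (g Z + (ψ Z + 0) * c)) :=
          (continuous_const.add ((continuous_const.add continuous_id).mul
            continuous_const)).tendsto 0
        rw [add_zero] at this
        exact this.mono_left nhdsWithin_le_nhds
      refine le_of_tendsto h2 ?_
      filter_upwards [self_mem_nhdsWithin] with ε hε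
      have h3 := hFA (Z, ψ Z + ε) ⟨hZ, by simpa using hε⟩
      rw [hF, hg] at h3
      exact h3.le
    have h4 : (-(1 / c)) * g (Z - X) = (g Z - g X) / (-c) := by
      rw [map_sub]; field_simp
    have h5 : (g Z - g X) / (-c) ≤ ψ Z - ψ X := by
      rw [div_le_iff₀ (by linarith)]
      linarith
    linarith
  obtain ⟨ξ, hξ⟩ := exists_frobInner_eq ((-(1 / c)) • g)
  refine ⟨ξ, mem_clarkeSubdiff_of_eventually_le fun V => ⟨τ / 2 * frobNorm V ^ 2, ?_⟩,
    fun V hV => by rw [hξ]; simp [hgT V hV]⟩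
  have hline : Tendsto (fun t : ℝ => X + t • V) (𝓝[>] 0) (𝓝 X) := by
    have : Tendsto (fun t : ℝ => X + t • V) (𝓝 0) (𝓝 (X + (0 : ℝ) • V)) :=
      (continuous_const.add (continuous_id.smul continuous_const)).tendsto 0
    rw [zero_smul, add_zero] at this
    exact this.mono_left nhdsWithin_le_nhds
  filter_upwards [hline.eventually (isOpen_interior.mem_nhds hXint)] with t ht
  have h := hsub _ ht
  rw [add_sub_cancel_left, map_smul, smul_eq_mul, hψX] at h
  simp only [hψ, add_sub_cancel_left, frobNorm_smul, mul_pow, sq_abs] at h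
  rw [hξ, LinearMap.smul_apply, smul_eq_mul]
  linarith

/-- The tangent space to the Stiefel manifold as a linear subspace. -/
def tangentSubmodule (X : Matrix (Fin n) (Fin p) ℝ) : Submodule ℝ (Matrix (Fin n) (Fin p) ℝ) where
  carrier := stiefelTangent X
  add_mem' {V W} hV hW := by
    have hV' : Vᵀ * X + Xᵀ * V = 0 := hV
    have hW' : Wᵀ * X + Xᵀ * W = 0 := hW
    change (V + W)ᵀ * X + Xᵀ * (V + W) = 0
    rw [Matrix.transpose_add, Matrix.add_mul, Matrix.mul_add, add_add_add_comm, hV', hW', add_zero]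
  zero_mem' := by simp [stiefelTangent]
  smul_mem' c V hV := by
    have hV' : Vᵀ * X + Xᵀ * V = 0 := hV
    change (c • V)ᵀ * X + Xᵀ * (c • V) = 0
    rw [Matrix.transpose_smul, Matrix.smul_mul, Matrix.mul_smul, ← smul_add, hV', smul_zero]

variable {C : Fin ℓ → Finset (Fin p)} {b : Fin p → Fin ℓ} {lam : ℝ}

/-- Fixed points of the adaptive proximal map are stationary. -/
lemma isStationary_of_mem_proxSet (hf : WeaklyConvexNearStiefel f Ω τ L) (hℓ : 2 ≤ ℓ)
    (hb : ∀ j a, j ∈ C a ↔ b j = a) (hlam : 0 < lam) {X : Matrix (Fin n) (Fin p) ℝ}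
    (hX : X ∈ proxSet f C lam X) : IsStationary f X := by
  have hℓ' : (2 : ℝ) ≤ ℓ := by exact_mod_cast hℓ
  have hXX : Xᵀ * X = 1 := hX.1
  have hT : ∀ V ∈ tangentSubmodule X, ∃ K : ℝ, ∀ᶠ t in 𝓝[>] (0 : ℝ),
      f X - K * t ^ 2 ≤ f (X + t • V) := by
    intro V hV
    have hV' : Vᵀ * X + Xᵀ * V = 0 := hV
    set v := frobNorm V with hv
    have hv0 : 0 ≤ v := frobNorm_nonneg _
    refine ⟨L * v ^ 2 + 1 / (2 * lam) * (ℓ / 2 * (ℓ - 1)) * (2 * v) ^ 2, ?_⟩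
    have hline : Tendsto (fun t : ℝ => X + t • V) (𝓝[>] 0) (𝓝 X) := by
      have : Tendsto (fun t : ℝ => X + t • V) (𝓝 0) (𝓝 (X + (0 : ℝ) • V)) :=
        (continuous_const.add (continuous_id.smul continuous_const)).tendsto 0
      rw [zero_smul, add_zero] at this
      exact this.mono_left nhdsWithin_le_nhds
    have hsmall : ∀ᶠ t in 𝓝[>] (0 : ℝ), t * v < 1 := by
      have : Tendsto (fun t : ℝ => t * v) (𝓝[>] 0) (𝓝 0) := by
        have : Tendsto (fun t : ℝ => t * v) (𝓝 0) (𝓝 (0 * v)) :=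
          (continuous_id.mul continuous_const).tendsto 0
        rw [zero_mul] at this
        exact this.mono_left nhdsWithin_le_nhds
      exact this.eventually_lt_const one_pos
    filter_upwards [hline.eventually (eventually_mem_set.2 (hf.nhds X hX.1)), hsmall,
      self_mem_nhdsWithin] with t hWΩ htv ht0
    have ht0' : 0 < t := ht0
    set W := X + t • V with hW
    have hWW : Wᵀ * W - 1 = t ^ 2 • (Vᵀ * V) := by
      have : Wᵀ * W = Xᵀ * X + t • (Vᵀ * X + Xᵀ * V) + t ^ 2 • (Vᵀ * V) := by
        simp only [hW, Matrix.transpose_add, Matrix.transpose_smul, Matrix.add_mul, Matrix.mul_add,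
          Matrix.smul_mul, Matrix.mul_smul]
        module
      rw [this, hV', hXX]
      simp
    have hWn : frobNorm (Wᵀ * W - 1) ≤ (t * v) ^ 2 := by
      rw [hWW, frobNorm_smul, abs_of_nonneg (sq_nonneg t), mul_pow]
      exact mul_le_mul_of_nonneg_left (frobNorm_transpose_mul_self_le V) (sq_nonneg t)
    have htv0 : 0 ≤ t * v := mul_nonneg ht0'.le hv0
    obtain ⟨Q, H, R, hQ, -, -, -, hr1, -⟩ := exists_polar (W := W) (hWn.trans_lt (by nlinarith))
    have h1 := hX.2 Q hQ
    rw [sub_self, mahaSq_zero, mul_zero, add_zero] at h1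
    have h2 := hf.le_add (hf.mem hQ) hWΩ
    rw [frobNorm_sub_comm] at h2
    have h3 : frobNorm (Q - X) ≤ 2 * (t * v) := by
      have e : Q - X = t • V - (W - Q) := by rw [hW]; abel
      rw [e]
      refine (frobNorm_sub_le _ _).trans ?_
      rw [frobNorm_smul, abs_of_pos ht0']
      nlinarith
    have h4 := mahaSq_le hℓ hb hX.1 (Q - X)
    have h5 : (ℓ : ℝ) / 2 * (ℓ - 1) * frobNorm (Q - X) ^ 2 ≤ ℓ / 2 * (ℓ - 1) * (2 * (t * v)) ^ 2 :=
      mul_le_mul_of_nonneg_left (pow_le_pow_left₀ (frobNorm_nonneg _) h3 2)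
        (mul_nonneg (by linarith) (by linarith))
    have h6 := mul_le_mul_of_nonneg_left (h4.trans h5)
      (by positivity : (0 : ℝ) ≤ 1 / (2 * lam))
    have h7 := mul_le_mul_of_nonneg_left (hr1.trans hWn) hf.lip_pos.le
    linarith
  obtain ⟨ξ, hξ, hξT⟩ := hf.exists_subgradient_orthogonal (hf.nhds X hX.1) (tangentSubmodule X) hT
  refine ⟨hX.1, ξ, hξ, (tangentSubmodule X).zero_mem, fun Z hZ => ?_⟩
  refine (sq_le_sq₀ (frobNorm_nonneg _) (frobNorm_nonneg _)).1 ?_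
  rw [sub_zero, frobNorm_sub_sq, hξT Z hZ]
  linarith [sq_nonneg (frobNorm Z)]

end Clarke

/-! ### Projections onto submanifold blocks -/

section BlockProjection

variable {m k k' : Type*} [Fintype m] [Fintype k] [Fintype k'] [DecidableEq k] [DecidableEq k']

/-- The symmetric part of a square matrix. -/
noncomputable def symPart (M : Matrix k k ℝ) : Matrix k k ℝ := (1 / 2 : ℝ) • (M + Mᵀ)

omit [Fintype k] [DecidableEq k] in
lemma transpose_symPart (M : Matrix k k ℝ) : (symPart M)ᵀ = symPart M := by
  rw [symPart, Matrix.transpose_smul, Matrix.transpose_add, Matrix.transpose_transpose, add_comm]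

omit [DecidableEq k] in
/-- Symmetric and skew-symmetric matrices are orthogonal. -/
lemma frobInner_symm_skew {S K : Matrix k k ℝ} (hS : Sᵀ = S) (hK : K + Kᵀ = 0) :
    frobInner S K = 0 := by
  have h1 : frobInner S Kᵀ = frobInner S K := by
    rw [← frobInner_transpose, Matrix.transpose_transpose, hS]
  have h2 : frobInner S (K + Kᵀ) = 0 := by rw [hK, frobInner_zero_right]
  rw [frobInner_add_right, h1] at h2
  linarith

omit [DecidableEq k] in
lemma frobNorm_symPart_le (M : Matrix k k ℝ) : frobNorm (symPart M) ≤ frobNorm M := by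
  rw [symPart, frobNorm_smul]
  have := frobNorm_add_le M Mᵀ
  rw [frobNorm_transpose] at this
  rw [abs_of_pos (by norm_num)]
  linarith

/-- The orthogonal projection of `U` onto the tangent space at `A` of the Stiefel matrices that
are orthogonal to `B`, when `A` and `B` have orthonormal columns and `Bᵀ A = 0`. -/
noncomputable def tangentProj (A : Matrix m k ℝ) (B : Matrix m k' ℝ) (U : Matrix m k ℝ) :
    Matrix m k ℝ :=
  U - B * (Bᵀ * U) - A * symPart (Aᵀ * U)

variable {A : Matrix m k ℝ} {B : Matrix m k' ℝ}

omit [DecidableEq k'] in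
lemma transpose_mul_tangentProj (hA : A ∈ stiefel m k) (hBA : Bᵀ * A = 0) (U : Matrix m k ℝ) :
    Aᵀ * tangentProj A B U = Aᵀ * U - symPart (Aᵀ * U) := by
  have hAB : Aᵀ * B = 0 := by simpa using congrArg Matrix.transpose hBA
  rw [tangentProj, Matrix.mul_sub, Matrix.mul_sub, ← Matrix.mul_assoc, ← Matrix.mul_assoc Aᵀ A, hAB,
    show Aᵀ * A = 1 from hA, Matrix.zero_mul, Matrix.one_mul, sub_zero]

omit [DecidableEq k'] in
lemma tangentProj_mem_stiefelTangent (hA : A ∈ stiefel m k) (hBA : Bᵀ * A = 0)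
    (U : Matrix m k ℝ) : tangentProj A B U ∈ stiefelTangent A := by
  change (tangentProj A B U)ᵀ * A + Aᵀ * tangentProj A B U = 0
  have h : (tangentProj A B U)ᵀ * A = (Aᵀ * tangentProj A B U)ᵀ := by
    rw [Matrix.transpose_mul, Matrix.transpose_transpose]
  rw [h, transpose_mul_tangentProj hA hBA, Matrix.transpose_sub, transpose_symPart, symPart]
  module

omit [DecidableEq k] in
lemma transpose_mul_tangentProj_eq_zero (hB : B ∈ stiefel m k') (hBA : Bᵀ * A = 0)
    (U : Matrix m k ℝ) : Bᵀ * tangentProj A B U = 0 := by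
  rw [tangentProj, Matrix.mul_sub, Matrix.mul_sub, ← Matrix.mul_assoc, ← Matrix.mul_assoc Bᵀ A, hBA,
    show Bᵀ * B = 1 from hB, Matrix.zero_mul, Matrix.one_mul, sub_self, sub_zero]

omit [DecidableEq k] [DecidableEq k'] in
lemma frobInner_sub_tangentProj (U : Matrix m k ℝ) {ξ : Matrix m k ℝ} (h1 : ξ ∈ stiefelTangent A)
    (h2 : Bᵀ * ξ = 0) : frobInner (U - tangentProj A B U) ξ = 0 := by
  have e : U - tangentProj A B U = B * (Bᵀ * U) + A * symPart (Aᵀ * U) := by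
    rw [tangentProj]; abel
  have h3 : Aᵀ * ξ + (Aᵀ * ξ)ᵀ = 0 := by
    rw [Matrix.transpose_mul, Matrix.transpose_transpose, add_comm]; exact h1
  rw [e, frobInner_add_left, frobInner_mul_left B, frobInner_mul_left A, h2, frobInner_zero_right,
    frobInner_symm_skew (transpose_symPart _) h3, add_zero]

lemma frobNorm_tangentProj_le (hA : A ∈ stiefel m k) (hB : B ∈ stiefel m k') (hBA : Bᵀ * A = 0)
    (U : Matrix m k ℝ) : frobNorm (tangentProj A B U) ≤ frobNorm U := by
  have h := frobInner_sub_tangentProj U (tangentProj_mem_stiefelTangent hA hBA U)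
    (transpose_mul_tangentProj_eq_zero hB hBA U)
  have h2 := frobNorm_add_sq (U - tangentProj A B U) (tangentProj A B U)
  rw [h, sub_add_cancel] at h2
  refine (sq_le_sq₀ (frobNorm_nonneg _) (frobNorm_nonneg _)).1 ?_
  linarith [sq_nonneg (frobNorm (U - tangentProj A B U))]

/-- Any nearest point of the tangent space of a block is given by the explicit projection. -/
lemma eq_tangentProj_of_mem_projSet (hA : A ∈ stiefel m k) (hB : B ∈ stiefel m k')
    (hBA : Bᵀ * A = 0) {U g : Matrix m k ℝ}
    (hg : g ∈ projSet {ξ | ξ ∈ stiefelTangent A ∧ Bᵀ * ξ = 0} U) : g = tangentProj A B U := by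
  obtain ⟨⟨hg1, hg2⟩, hg3⟩ := hg
  have h0 := hg3 _ ⟨tangentProj_mem_stiefelTangent hA hBA U,
    transpose_mul_tangentProj_eq_zero hB hBA U⟩
  have h1 := frobInner_sub_tangentProj U hg1 hg2
  have h2 := frobInner_sub_tangentProj U (tangentProj_mem_stiefelTangent hA hBA U)
    (transpose_mul_tangentProj_eq_zero hB hBA U)
  have e : U - g = (U - tangentProj A B U) + (tangentProj A B U - g) := by abel
  have h3 := frobNorm_add_sq (U - tangentProj A B U) (tangentProj A B U - g)
  rw [← e, frobInner_sub_right, h1, h2] at h3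
  have h4 := pow_le_pow_left₀ (frobNorm_nonneg _) h0 2
  have h5 : frobNorm (tangentProj A B U - g) = 0 := by
    nlinarith [frobNorm_nonneg (tangentProj A B U - g)]
  exact (sub_eq_zero.1 (frobNorm_eq_zero.1 h5)).symm

omit [Fintype k'] [DecidableEq k'] in
/-- A short step along a tangent vector has a unique nearest point in the block, and the distance
is of second order. -/
lemma exists_unique_nearest_block (hA : A ∈ stiefel m k) (hBA : Bᵀ * A = 0)
    {g : Matrix m k ℝ} (hg1 : g ∈ stiefelTangent A) (hg2 : Bᵀ * g = 0) {γ : ℝ}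
    (hγ : (γ * frobNorm g) ^ 2 < 1) :
    ∃ Q, ∀ Y ∈ projSet {Y | Y ∈ stiefel m k ∧ Bᵀ * Y = 0} (A - γ • g),
      Y = Q ∧ frobNorm (Y - (A - γ • g)) ≤ (γ * frobNorm g) ^ 2 := by
  set W := A - γ • g with hW
  have hWW : Wᵀ * W - 1 = γ ^ 2 • (gᵀ * g) := by
    have : Wᵀ * W = Aᵀ * A - γ • (gᵀ * A + Aᵀ * g) + γ ^ 2 • (gᵀ * g) := by
      simp only [hW, Matrix.transpose_sub, Matrix.transpose_smul, Matrix.sub_mul, Matrix.mul_sub,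
        Matrix.smul_mul, Matrix.mul_smul]
      module
    rw [this, show gᵀ * A + Aᵀ * g = 0 from hg1, show Aᵀ * A = 1 from hA]
    simp
  have hWn : frobNorm (Wᵀ * W - 1) ≤ (γ * frobNorm g) ^ 2 := by
    rw [hWW, frobNorm_smul, abs_of_nonneg (sq_nonneg γ), mul_pow]
    have := frobNorm_mul_le gᵀ g
    rw [frobNorm_transpose, ← sq] at this
    exact mul_le_mul_of_nonneg_left this (sq_nonneg γ)
  obtain ⟨Q, H, R, hQ, hH, hWQ, hQW, hr, -⟩ := exists_polar (hWn.trans_lt hγ)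
  have hBQ : Bᵀ * Q = 0 := by
    rw [hQW, ← Matrix.mul_assoc, hW, Matrix.mul_sub, Matrix.mul_smul, hBA, hg2]
    simp
  refine ⟨Q, fun Y hY => ?_⟩
  have h1 := hY.2 Q ⟨hQ, hBQ⟩
  refine ⟨?_, ?_⟩
  · rw [hWQ] at h1
    exact eq_of_polar_of_frobNorm_le hQ hY.1.1 hH h1
  · rw [frobNorm_sub_comm]
    exact h1.trans (hr.trans hWn)

end BlockProjection

/-! ### One step of the method -/

section Step

variable {n p ℓ : ℕ}

lemma idCols_apply (S : Finset (Fin p)) (i : Fin p) (j : {j // j ∈ S}) :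
    idCols S i j = if i = j.1 then 1 else 0 := rfl

lemma cols_eq_mul (S : Finset (Fin p)) (A : Matrix (Fin n) (Fin p) ℝ) :
    cols S A = A * idCols S := by
  ext i j
  rw [Matrix.mul_apply]
  simp only [idCols_apply]
  simp [cols]

lemma idCols_mem_stiefel (S : Finset (Fin p)) : idCols S ∈ stiefel (Fin p) {j // j ∈ S} := by
  change (idCols S)ᵀ * idCols S = 1
  ext i j
  rw [Matrix.mul_apply, Matrix.one_apply]
  simp only [Matrix.transpose_apply, idCols_apply, Subtype.ext_iff]
  simp [eq_comm]

lemma idCols_mul_transpose (S : Finset (Fin p)) : idCols S * (idCols S)ᵀ = colProj S := by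
  have := cols_mul_transpose_idCols S (1 : Matrix (Fin p) (Fin p) ℝ)
  rwa [Matrix.one_mul] at this

lemma transpose_idCols_compl_mul (S : Finset (Fin p)) : (idCols Sᶜ)ᵀ * idCols S = 0 := by
  ext i j
  have hi := Finset.mem_compl.1 i.2
  have : (j : Fin p) ≠ i := fun h => hi (h ▸ j.2)
  rw [Matrix.mul_apply]
  simp [Matrix.transpose_apply, idCols_apply, this]

lemma cols_mem_stiefel (S : Finset (Fin p)) {X : Matrix (Fin n) (Fin p) ℝ}
    (hX : X ∈ stiefel (Fin n) (Fin p)) : cols S X ∈ stiefel (Fin n) {j // j ∈ S} := by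
  change (cols S X)ᵀ * cols S X = 1
  rw [cols_eq_mul, Matrix.transpose_mul, Matrix.mul_assoc, ← Matrix.mul_assoc Xᵀ,
    show Xᵀ * X = 1 from hX, Matrix.one_mul]
  exact idCols_mem_stiefel S

lemma transpose_cols_compl_mul_cols (S : Finset (Fin p)) {X : Matrix (Fin n) (Fin p) ℝ}
    (hX : X ∈ stiefel (Fin n) (Fin p)) : (cols Sᶜ X)ᵀ * cols S X = 0 := by
  rw [cols_eq_mul, cols_eq_mul, Matrix.transpose_mul, Matrix.mul_assoc, ← Matrix.mul_assoc Xᵀ,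
    show Xᵀ * X = 1 from hX, Matrix.one_mul, transpose_idCols_compl_mul]

lemma eq_cols_add_cols_compl (S : Finset (Fin p)) (A : Matrix (Fin n) (Fin p) ℝ) :
    A = cols S A * (idCols S)ᵀ + cols Sᶜ A * (idCols Sᶜ)ᵀ := by
  rw [cols_mul_transpose_idCols, cols_mul_transpose_idCols, colProj_compl, ← Matrix.mul_add,
    add_sub_cancel, Matrix.mul_one]

lemma frobNorm_mul_transpose_idCols (S : Finset (Fin p)) (A : Matrix (Fin n) {j // j ∈ S} ℝ) :
    frobNorm (A * (idCols S)ᵀ) = frobNorm A := by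
  rw [← frobNorm_transpose, Matrix.transpose_mul, Matrix.transpose_transpose,
    frobNorm_stiefel_mul (idCols_mem_stiefel S), frobNorm_transpose]

lemma frobNorm_cols_le (S : Finset (Fin p)) (A : Matrix (Fin n) (Fin p) ℝ) :
    frobNorm (cols S A) ≤ frobNorm A := by
  rw [← frobNorm_mul_transpose_idCols, cols_mul_transpose_idCols]
  exact frobNorm_mul_colProj_le S A

/-- The partial Riemannian subgradient on the columns `S`, extended by zero to all columns. -/
noncomputable def partialGrad (S : Finset (Fin p)) (X G : Matrix (Fin n) (Fin p) ℝ) :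
    Matrix (Fin n) (Fin p) ℝ :=
  tangentProj (cols S X) (cols Sᶜ X) (cols S G) * (idCols S)ᵀ

lemma frobNorm_partialGrad_le (S : Finset (Fin p)) {X : Matrix (Fin n) (Fin p) ℝ}
    (hX : X ∈ stiefel (Fin n) (Fin p)) (G : Matrix (Fin n) (Fin p) ℝ) :
    frobNorm (partialGrad S X G) ≤ frobNorm G := by
  rw [partialGrad, frobNorm_mul_transpose_idCols]
  exact (frobNorm_tangentProj_le (cols_mem_stiefel S hX) (cols_mem_stiefel Sᶜ hX)
    (transpose_cols_compl_mul_cols S hX) _).trans (frobNorm_cols_le S G)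

/-- The partial Riemannian subgradient in terms of `p × p` column projections. -/
lemma partialGrad_eq (S : Finset (Fin p)) (X G : Matrix (Fin n) (Fin p) ℝ) :
    partialGrad S X G = G * colProj S - X * ((Xᵀ * G) * colProj S) +
      X * (colProj S * (Xᵀ * G - symPart (Xᵀ * G)) * colProj S) := by
  have h1 : cols Sᶜ X * ((cols Sᶜ X)ᵀ * cols S G) * (idCols S)ᵀ =
      X * ((Xᵀ * G) * colProj S) - X * (colProj S * (Xᵀ * G) * colProj S) := by
    rw [← Matrix.mul_assoc, cols_mul_transpose_cols, mul_cols, colProj_compl]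
    simp only [Matrix.mul_sub, Matrix.sub_mul, Matrix.mul_one, Matrix.mul_assoc]
  have h2 : cols S X * symPart ((cols S X)ᵀ * cols S G) * (idCols S)ᵀ =
      X * (colProj S * symPart (Xᵀ * G) * colProj S) := by
    simp only [symPart, cols_eq_mul, ← idCols_mul_transpose, Matrix.transpose_mul,
      Matrix.transpose_transpose, Matrix.mul_assoc, Matrix.mul_add, Matrix.add_mul, Matrix.mul_smul,
      Matrix.smul_mul]
  rw [partialGrad, tangentProj, Matrix.sub_mul, Matrix.sub_mul, h1, h2, cols_mul_transpose_idCols]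
  simp only [Matrix.mul_sub, Matrix.sub_mul]
  abel

/-- For short steps the update is uniquely determined and stays on the Stiefel manifold; it agrees
with the Euclidean step along the partial Riemannian subgradient up to second order. -/
lemma Step.expansion {S : Finset (Fin p)} {γ L : ℝ} {X G : Matrix (Fin n) (Fin p) ℝ}
    (hX : X ∈ stiefel (Fin n) (Fin p)) (hγ : 0 ≤ γ) (hγL : γ * L < 1) (hG : frobNorm G ≤ L) :
    ∃ Z : Matrix (Fin n) (Fin p) ℝ, ∀ X', Step S γ X G X' → X' = Z ∧ X' ∈ stiefel (Fin n) (Fin p) ∧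
      ∃ R, X' = X + (-(γ • partialGrad S X G) + R) ∧ frobNorm R ≤ (γ * L) ^ 2 := by
  have hA := cols_mem_stiefel S hX
  have hB := cols_mem_stiefel Sᶜ hX
  have hBA := transpose_cols_compl_mul_cols S hX
  set g := tangentProj (cols S X) (cols Sᶜ X) (cols S G) with hg
  have hgL : γ * frobNorm g ≤ γ * L := mul_le_mul_of_nonneg_left
    ((frobNorm_tangentProj_le hA hB hBA _).trans ((frobNorm_cols_le S G).trans hG)) hγ
  have hg0 : 0 ≤ γ * frobNorm g := mul_nonneg hγ (frobNorm_nonneg _)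
  obtain ⟨Q, hQ⟩ := exists_unique_nearest_block (γ := γ) hA hBA
    (tangentProj_mem_stiefelTangent hA hBA (cols S G))
    (transpose_mul_tangentProj_eq_zero hB hBA (cols S G)) (by rw [← hg]; nlinarith)
  refine ⟨Q * (idCols S)ᵀ + cols Sᶜ X * (idCols Sᶜ)ᵀ, ?_⟩
  rintro X' ⟨g', hg', hX', hc⟩
  obtain rfl : g' = g := eq_tangentProj_of_mem_projSet hA hB hBA hg'
  obtain ⟨h1, h2⟩ := hQ _ hX'
  have e := eq_cols_add_cols_compl S X'
  rw [hc] at e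
  refine ⟨by rw [← h1]; exact e, ?_, (cols S X' - (cols S X - γ • g)) * (idCols S)ᵀ, ?_, ?_⟩
  · have hY : (cols S X')ᵀ * cols S X' = 1 := hX'.1.1
    have hBY : (cols Sᶜ X)ᵀ * cols S X' = 0 := hX'.1.2
    have hYB : (cols S X')ᵀ * cols Sᶜ X = 0 := by simpa using congrArg Matrix.transpose hBY
    have hBB : (cols Sᶜ X)ᵀ * cols Sᶜ X = 1 := hB
    have hmul : ∀ {a b c d : Type} [Fintype a] [Fintype b] [Fintype c] [Fintype d]
        (M : Matrix a b ℝ) (U : Matrix b (Fin n) ℝ) (V : Matrix (Fin n) c ℝ) (N : Matrix c d ℝ),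
        M * U * (V * N) = M * (U * V) * N := by
      intros; simp only [Matrix.mul_assoc]
    change X'ᵀ * X' = 1
    rw [e]
    simp only [Matrix.transpose_add, Matrix.transpose_mul, Matrix.transpose_transpose,
      Matrix.add_mul, Matrix.mul_add, hmul, hY, hBY, hYB, hBB, Matrix.mul_one, Matrix.mul_zero,
      Matrix.zero_mul, idCols_mul_transpose, colProj_compl]
    simp
  · have e2 := eq_cols_add_cols_compl S X
    have e3 : (cols S X' - (cols S X - γ • g)) * (idCols S)ᵀ = cols S X' * (idCols S)ᵀ -
        cols S X * (idCols S)ᵀ + γ • partialGrad S X G := by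
      rw [partialGrad, ← hg, Matrix.sub_mul, Matrix.sub_mul, Matrix.smul_mul]
      abel
    rw [e3]
    nth_rw 1 [e]
    nth_rw 2 [e2]
    abel
  · rw [frobNorm_mul_transpose_idCols]
    exact h2.trans (pow_le_pow_left₀ hg0 hgL 2)

lemma Step.unique {S : Finset (Fin p)} {γ L : ℝ} {X G X₁ X₂ : Matrix (Fin n) (Fin p) ℝ}
    (hX : X ∈ stiefel (Fin n) (Fin p)) (hγ : 0 ≤ γ) (hγL : γ * L < 1) (hG : frobNorm G ≤ L)
    (h₁ : Step S γ X G X₁) (h₂ : Step S γ X G X₂) : X₁ = X₂ := by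
  obtain ⟨Z, hZ⟩ := Step.expansion (S := S) hX hγ hγL hG
  rw [(hZ X₁ h₁).1, (hZ X₂ h₂).1]

lemma Step.mem_stiefel {S : Finset (Fin p)} {γ L : ℝ} {X G X' : Matrix (Fin n) (Fin p) ℝ}
    (hX : X ∈ stiefel (Fin n) (Fin p)) (hγ : 0 ≤ γ) (hγL : γ * L < 1) (hG : frobNorm G ≤ L)
    (h : Step S γ X G X') : X' ∈ stiefel (Fin n) (Fin p) := by
  obtain ⟨Z, hZ⟩ := Step.expansion (S := S) hX hγ hγL hG
  exact (hZ X' h).2.1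

lemma Step.frobNorm_sub_le {S : Finset (Fin p)} {γ L : ℝ} {X G X' : Matrix (Fin n) (Fin p) ℝ}
    (hX : X ∈ stiefel (Fin n) (Fin p)) (hγ : 0 ≤ γ) (hγL : γ * L < 1) (hG : frobNorm G ≤ L)
    (h : Step S γ X G X') : frobNorm (X' - X) ≤ 2 * (γ * L) := by
  obtain ⟨Z, hZ⟩ := Step.expansion (S := S) hX hγ hγL hG
  obtain ⟨-, -, R, hR, hRL⟩ := hZ X' h
  have h0 : 0 ≤ γ * L := mul_nonneg hγ ((frobNorm_nonneg _).trans hG)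
  rw [hR, add_sub_cancel_left]
  refine (frobNorm_add_le _ _).trans ?_
  rw [frobNorm_neg, frobNorm_smul, abs_of_nonneg hγ]
  have := mul_le_mul_of_nonneg_left ((frobNorm_partialGrad_le S hX G).trans hG) hγ
  nlinarith

variable {C : Fin ℓ → Finset (Fin p)} {b : Fin p → Fin ℓ}

/-- The partial Riemannian subgradients sum up, to a multiple, to the averaging operator applied to
the full Riemannian subgradient `G - X * symPart (Xᵀ * G)`. -/
lemma sum_partialGrad (hb : ∀ j a, j ∈ C a ↔ b j = a) (X G : Matrix (Fin n) (Fin p) ℝ) :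
    ∑ s : BlockPair ℓ, partialGrad (pairCols C s) X G =
      ((ℓ : ℝ) - 1) • (G - X * symPart (Xᵀ * G)) -
        ((ℓ : ℝ) - 2) • (X * offBlock b (Xᵀ * G - symPart (Xᵀ * G))) := by
  simp only [partialGrad_eq]
  rw [Finset.sum_add_distrib, Finset.sum_sub_distrib, ← Matrix.mul_sum, ← Matrix.mul_sum,
    ← Matrix.mul_sum, ← Matrix.mul_sum, sum_colProj hb, sum_colProj_mul_mul hb]
  simp only [Matrix.mul_sub, Matrix.mul_smul, Matrix.mul_one, map_sub, smul_sub]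
  abel

/-- The first-order change of the squared Mahalanobis distance to `Y` under a unit step, averaged
over the pairs. The left factor is `ℓ / 2` times the average of the partial Riemannian subgradients
(`sum_partialGrad`) and the right factor is `-1 / ℓ` times the gradient of the squared distance in
`X` (`mahaSq_step_le`).
The variation of the metric cancels the damping of the averaging operator up to an error that is
quadratic in `Y - X`. -/
lemma averaged_first_order (hℓ : 2 ≤ ℓ) (b : Fin p → Fin ℓ) {X Y G : Matrix (Fin n) (Fin p) ℝ}
    (hX : X ∈ stiefel (Fin n) (Fin p)) (hY : Y ∈ stiefel (Fin n) (Fin p)) {L : ℝ}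
    (hG : frobNorm G ≤ L) :
    2 * frobInner ((G - X * symPart (Xᵀ * G)) - (((ℓ : ℝ) - 2) / (ℓ - 1)) •
      (X * offBlock b (Xᵀ * G - symPart (Xᵀ * G)))) (Y - ((ℓ : ℝ) - 2) • (Y * (offBlock b (Xᵀ * Y))ᵀ))
      ≤ 2 * frobInner G (Y - X) + (2 * ℓ - 3) * L * frobNorm (Y - X) ^ 2 := by
  have hℓ' : (2 : ℝ) ≤ ℓ := by exact_mod_cast hℓ
  have h1 : (ℓ : ℝ) - 1 ≠ 0 := by linarith
  have hXX : Xᵀ * X = 1 := hX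
  have hYY : Yᵀ * Y = 1 := hY
  have hL0 : 0 ≤ L := (frobNorm_nonneg _).trans hG
  set S := symPart (Xᵀ * G) with hS
  set K := Xᵀ * G - S with hK
  set κ : ℝ := ((ℓ : ℝ) - 2) / (ℓ - 1) with hκ
  have hκ0 : 0 ≤ κ := div_nonneg (by linarith) (by linarith)
  have hκ1 : κ ≤ 1 := by rw [hκ, div_le_one (by linarith)]; linarith
  have hκ2 : ((ℓ : ℝ) - 2) * (1 - κ) = κ := by rw [hκ]; field_simp; ring
  have hSt : Sᵀ = S := transpose_symPart _
  have hKt : Kᵀ = -K := by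
    rw [hK, Matrix.transpose_sub, hSt, hS, symPart]; module
  set P := G - X * S with hP
  have hXP : Xᵀ * P = K := by
    rw [hP, Matrix.mul_sub, ← Matrix.mul_assoc, hXX, Matrix.one_mul]
  set M := P - κ • (X * offBlock b K) with hM
  set Δ := Y - X with hΔ
  have hSL : frobNorm S ≤ L :=
    (frobNorm_symPart_le _).trans ((frobNorm_stiefel_transpose_mul_le hX G).trans hG)
  have hML : frobNorm M ≤ L := by
    have e1 : frobNorm M ^ 2 = frobNorm P ^ 2 - (2 * κ - κ ^ 2) * frobNorm (offBlock b K) ^ 2 := by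
      rw [hM, frobNorm_sub_sq, frobNorm_smul, frobInner_smul_right, frobInner_comm,
        frobInner_mul_left, hXP, frobInner_offBlock_left, frobNorm_stiefel_mul hX, ← frobNorm_sq,
        mul_pow, sq_abs]
      ring
    have e2 : frobNorm P ^ 2 = frobNorm G ^ 2 - frobNorm S ^ 2 := by
      have e3 : frobInner G (X * S) = frobNorm S ^ 2 := by
        have e4 : Xᵀ * G = S + K := by rw [hK]; abel
        rw [frobInner_comm, frobInner_mul_left, e4, frobInner_add_right,
          frobInner_symm_skew hSt (K := K) (by rw [hKt, add_neg_cancel]), frobNorm_sq, add_zero]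
      rw [hP, frobNorm_sub_sq, e3, frobNorm_stiefel_mul hX]
      ring
    refine le_trans ?_ hG
    refine (sq_le_sq₀ (frobNorm_nonneg _) (frobNorm_nonneg _)).1 ?_
    have : 0 ≤ (2 * κ - κ ^ 2) * frobNorm (offBlock b K) ^ 2 :=
      mul_nonneg (by nlinarith) (sq_nonneg _)
    linarith [sq_nonneg (frobNorm S)]
  have hoY : offBlock b (Xᵀ * Y) = offBlock b (Xᵀ * Δ) := by
    rw [hΔ, Matrix.mul_sub, hXX, map_sub, offBlock_one, sub_zero]
  -- The contribution of the moving metric, split at `Y = X + Δ`.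
  have hMY : frobInner M (Y * (offBlock b (Xᵀ * Y))ᵀ) =
      -(1 - κ) * frobInner (offBlock b K) (offBlock b (Xᵀ * Y)) +
        frobInner (Mᵀ * Δ) (offBlock b (Xᵀ * Y)) := by
    have e1 : frobInner M (Y * (offBlock b (Xᵀ * Y))ᵀ) =
        frobInner (Mᵀ * Y) (offBlock b (Xᵀ * Y)) := by
      rw [frobInner_comm, frobInner_mul_left, ← frobInner_transpose, Matrix.transpose_transpose,
        Matrix.transpose_mul, Matrix.transpose_transpose, frobInner_comm]
    have e2 : Mᵀ * Y = Mᵀ * X + Mᵀ * Δ := by rw [← Matrix.mul_add, hΔ, add_sub_cancel]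
    have e3 : Mᵀ * X = -(K - κ • offBlock b K) := by
      have : Xᵀ * M = K - κ • offBlock b K := by
        rw [hM, Matrix.mul_sub, hXP, Matrix.mul_smul, ← Matrix.mul_assoc, hXX, Matrix.one_mul]
      have h : Mᵀ * X = (Xᵀ * M)ᵀ := by rw [Matrix.transpose_mul, Matrix.transpose_transpose]
      rw [h, this, Matrix.transpose_sub, Matrix.transpose_smul, ← offBlock_transpose, hKt, map_neg]
      module
    rw [e1, e2, frobInner_add_left, e3, frobInner_neg_left, frobInner_sub_left,
      frobInner_smul_left, frobInner_offBlock_right]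
    ring
  have hPY : 2 * frobInner P Y = 2 * frobInner G Δ + frobInner S (Δᵀ * Δ) := by
    have e1 : Δᵀ * Δ = (2 : ℝ) • (1 : Matrix (Fin p) (Fin p) ℝ) - (Xᵀ * Y + (Xᵀ * Y)ᵀ) := by
      rw [hΔ, Matrix.transpose_sub, Matrix.sub_mul, Matrix.mul_sub, Matrix.mul_sub, hXX, hYY,
        Matrix.transpose_mul, Matrix.transpose_transpose]
      module
    have e2 : frobInner S (Xᵀ * Y)ᵀ = frobInner S (Xᵀ * Y) := by
      rw [← frobInner_transpose, Matrix.transpose_transpose, hSt]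
    have e3 : frobInner S 1 = frobInner G X := by
      have h2 : frobInner K 1 = 0 := by
        rw [frobInner_comm]
        exact frobInner_symm_skew Matrix.transpose_one (by rw [hKt, add_neg_cancel])
      have h3 : frobInner (Xᵀ * G) 1 = frobInner G X := by
        rw [frobInner_mul_left, Matrix.transpose_transpose, Matrix.mul_one]
      rw [hK, frobInner_sub_left, h3] at h2
      linarith
    rw [e1, hP, frobInner_sub_left, frobInner_mul_left, frobInner_sub_right _ _ S, frobInner_smul_right,
      frobInner_add_right, e2, e3, hΔ, frobInner_sub_right]
    ring
  have hPX : frobInner (X * offBlock b K) Y = frobInner (offBlock b K) (offBlock b (Xᵀ * Y)) := by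
    rw [frobInner_mul_left, frobInner_offBlock_left]
  have key : 2 * frobInner M (Y - ((ℓ : ℝ) - 2) • (Y * (offBlock b (Xᵀ * Y))ᵀ)) =
      2 * frobInner G Δ + frobInner S (Δᵀ * Δ) -
        2 * (ℓ - 2) * frobInner (Mᵀ * Δ) (offBlock b (Xᵀ * Y)) := by
    rw [frobInner_sub_right, frobInner_smul_right, hMY, ← hPY, hM, frobInner_sub_left,
      frobInner_smul_left, hPX]
    linear_combination 2 * frobInner (offBlock b K) (offBlock b (Xᵀ * Y)) * hκ2
  rw [key, hoY]
  set d := frobNorm Δ with hd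
  have hd0 : 0 ≤ d := frobNorm_nonneg _
  have b1 : frobInner S (Δᵀ * Δ) ≤ L * d ^ 2 :=
    (frobInner_le _ _).trans (mul_le_mul hSL (frobNorm_transpose_mul_self_le Δ)
      (frobNorm_nonneg _) hL0)
  have b2 : -(L * d * d) ≤ frobInner (Mᵀ * Δ) (offBlock b (Xᵀ * Δ)) := by
    refine le_trans (neg_le_neg ?_) (neg_le_frobInner _ _)
    refine mul_le_mul ?_ (frobNorm_offBlock_transpose_mul_le b hX Δ) (frobNorm_nonneg _)
      (mul_nonneg hL0 hd0)
    have := frobNorm_mul_le Mᵀ Δ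
    rw [frobNorm_transpose] at this
    exact this.trans (mul_le_mul_of_nonneg_right hML hd0)
  have b3 := mul_le_mul_of_nonneg_left b2 (by linarith : (0 : ℝ) ≤ 2 * (ℓ - 2))
  linarith

/-- The second-order constant in the one-step estimate `mahaSq_step_le`: the first summand bounds the
effect of the remainder in `Step.expansion`, the second one the quadratic part of the squared
Mahalanobis distance. -/
noncomputable def stepConst (p ℓ : ℕ) (L : ℝ) : ℝ :=
  (ℓ * (ℓ - 1) * √p + 2 * ℓ * (ℓ - 2)) * L ^ 2

/-- One step changes the squared Mahalanobis distance to `Y` to first order by a linear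
function of the partial Riemannian subgradient. -/
lemma mahaSq_step_le (hℓ : 2 ≤ ℓ) (hb : ∀ j a, j ∈ C a ↔ b j = a) {S : Finset (Fin p)} {γ L : ℝ}
    {X G X' Y : Matrix (Fin n) (Fin p) ℝ} (hX : X ∈ stiefel (Fin n) (Fin p))
    (hY : Y ∈ stiefel (Fin n) (Fin p)) (hγ : 0 ≤ γ) (hγL : γ * L < 1) (hG : frobNorm G ≤ L)
    (h : Step S γ X G X') :
    mahaSq C X' (Y - X') ≤ mahaSq C X (Y - X) + γ * (ℓ * frobInner (partialGrad S X G)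
      (Y - ((ℓ : ℝ) - 2) • (Y * (offBlock b (Xᵀ * Y))ᵀ))) + stepConst p ℓ L * γ ^ 2 := by
  have hℓ' : (2 : ℝ) ≤ ℓ := by exact_mod_cast hℓ
  have hU := h.frobNorm_sub_le hX hγ hγL hG
  obtain ⟨Z, hZ⟩ := Step.expansion (S := S) hX hγ hγL hG
  obtain ⟨-, hX', R, hR, hRL⟩ := hZ X' h
  rw [mahaSq_sub hℓ hb hX hY, mahaSq_sub hℓ hb hX' hY]
  set U := X' - X with hUdef
  have hX'U : X' = X + U := by rw [hUdef, add_sub_cancel]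
  have hUR : U = -(γ • partialGrad S X G) + R := by rw [hUdef, hR, add_sub_cancel_left]
  set Φ := Y - ((ℓ : ℝ) - 2) • (Y * (offBlock b (Xᵀ * Y))ᵀ) with hΦ
  have hΦn : frobNorm Φ ≤ (ℓ - 1) * √p := by
    have hYn : frobNorm Y = √p := by
      rw [← Real.sqrt_sq (frobNorm_nonneg Y), frobNorm_sq_stiefel hY, Fintype.card_fin]
    refine (frobNorm_sub_le _ _).trans ?_
    rw [frobNorm_smul, abs_of_nonneg (by linarith), frobNorm_stiefel_mul hY, frobNorm_transpose]
    have := frobNorm_offBlock_transpose_mul_le b hX Y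
    nlinarith
  have e1 : frobInner (offBlock b (Xᵀ * Y)) (offBlock b (Uᵀ * Y)) =
      frobInner U (Y * (offBlock b (Xᵀ * Y))ᵀ) := by
    rw [← frobInner_offBlock_left, frobInner_comm, ← frobInner_transpose, Matrix.transpose_mul,
      Matrix.transpose_transpose, frobInner_mul_left, ← frobInner_comm, Matrix.transpose_transpose,
      frobInner_comm]
  have e2 : frobNorm (offBlock b (X'ᵀ * Y)) ^ 2 = frobNorm (offBlock b (Xᵀ * Y)) ^ 2 +
      2 * frobInner U (Y * (offBlock b (Xᵀ * Y))ᵀ) + frobNorm (offBlock b (Uᵀ * Y)) ^ 2 := by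
    rw [hX'U, Matrix.transpose_add, Matrix.add_mul, map_add, frobNorm_add_sq, e1]
  have e3 : frobNorm (offBlock b (Uᵀ * Y)) ≤ 2 * (γ * L) := by
    refine (frobNorm_offBlock_le _ _).trans (le_trans ?_ hU)
    rw [← frobNorm_transpose, Matrix.transpose_mul, Matrix.transpose_transpose]
    exact frobNorm_stiefel_transpose_mul_le hY U
  have e4 : frobInner X' Y = frobInner X Y + frobInner U Y := by rw [hX'U, frobInner_add_left]
  have e5 : frobInner U Φ = -γ * frobInner (partialGrad S X G) Φ + frobInner R Φ := by
    rw [hUR, frobInner_add_left, frobInner_neg_left, frobInner_smul_left]; ring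
  have e6 : frobInner U Φ = frobInner U Y - (ℓ - 2) * frobInner U (Y * (offBlock b (Xᵀ * Y))ᵀ) := by
    rw [hΦ, frobInner_sub_right, frobInner_smul_right]
  have e7 : -((γ * L) ^ 2 * ((ℓ - 1) * √p)) ≤ frobInner R Φ :=
    le_trans (neg_le_neg (mul_le_mul hRL hΦn (frobNorm_nonneg _) (sq_nonneg _)))
      (neg_le_frobInner R Φ)
  have e8 := mul_le_mul_of_nonneg_left (pow_le_pow_left₀ (frobNorm_nonneg _) e3 2)
    (by nlinarith : (0 : ℝ) ≤ ℓ / 2 * (ℓ - 2))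
  have e9 := mul_le_mul_of_nonneg_left e7 (by linarith : (0 : ℝ) ≤ ℓ)
  rw [e2, e4, stepConst]
  have e10 : frobInner U Y - (ℓ - 2) * frobInner U (Y * (offBlock b (Xᵀ * Y))ᵀ) =
    -γ * frobInner (partialGrad S X G) Φ + frobInner R Φ := e6.symm.trans e5
  linear_combination e8 + e9 - (ℓ : ℝ) * e10

end Step

/-! ### Expected decrease of the envelope -/

section Descent

variable {n p ℓ : ℕ} {C : Fin ℓ → Finset (Fin p)} {b : Fin p → Fin ℓ}
  {f : Matrix (Fin n) (Fin p) ℝ → ℝ} {Ω : Set (Matrix (Fin n) (Fin p) ℝ)} {τ L lam : ℝ}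

lemma card_blockPair (ℓ : ℕ) : Fintype.card (BlockPair ℓ) = ℓ.choose 2 :=
  (Fintype.card_finset_len (α := Fin ℓ) 2).trans (by rw [Fintype.card_fin])

/-- The adaptive Moreau envelope, i.e. the optimal value of the prox subproblem. -/
noncomputable def envelope (f : Matrix (Fin n) (Fin p) ℝ → ℝ) (C : Fin ℓ → Finset (Fin p))
    (lam : ℝ) (X : Matrix (Fin n) (Fin p) ℝ) : ℝ :=
  f (prox f C lam X) + 1 / (2 * lam) * mahaSq C X (prox f C lam X - X)

/-- The expected decrease of the adaptive Moreau envelope in one step, with the average over the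
pairs written as a sum. -/
lemma sum_envelope_le (hf : WeaklyConvexNearStiefel f Ω τ L) (hℓ : 2 ≤ ℓ)
    (hb : ∀ j a, j ∈ C a ↔ b j = a) (hlam : 0 < lam) {X G : Matrix (Fin n) (Fin p) ℝ}
    (hX : X ∈ stiefel (Fin n) (Fin p)) (hG : G ∈ clarkeSubdiff f X) {γ : ℝ} (hγ : 0 ≤ γ)
    (hγL : γ * L < 1) {X' : BlockPair ℓ → Matrix (Fin n) (Fin p) ℝ}
    (hX' : ∀ s, Step (pairCols C s) γ X G (X' s)) :
    ∑ s, envelope f C lam (X' s) ≤ (ℓ.choose 2 : ℕ) * (envelope f C lam X -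
      1 / (2 * lam) * ((ℓ / (2 * lam) - τ - (2 * ℓ - 1) * L) *
        (γ * frobNorm (prox f C lam X - X) ^ 2)) +
      1 / (2 * lam) * stepConst p ℓ L * γ ^ 2) := by
  have hℓ' : (2 : ℝ) ≤ ℓ := by exact_mod_cast hℓ
  have hL := hf.lip_pos
  have hGL := hf.frobNorm_subgradient_le hX hG
  have hYp := prox_mem_proxSet (lam := lam) hf hℓ hb hX
  rw [envelope]
  set Y := prox f C lam X with hYdef
  set s₀ : ℝ := 1 / (2 * lam) with hs
  have hs0 : 0 < s₀ := by positivity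
  have hls' : (ℓ : ℝ) / (2 * lam) = ℓ * s₀ := by rw [hs]; ring
  rw [hls']
  set N : ℝ := ((ℓ.choose 2 : ℕ) : ℝ) with hN
  have hN2 : 2 * N = ℓ * (ℓ - 1) := by rw [hN, Nat.cast_choose_two]; ring
  have hN0 : 0 ≤ N := Nat.cast_nonneg _
  have hsum1 : ∀ c : ℝ, ∑ _s : BlockPair ℓ, c = N * c := by
    intro c
    rw [Finset.sum_const, Finset.card_univ, card_blockPair, nsmul_eq_mul]
  have h1 : ∀ s, envelope f C lam (X' s) ≤ f Y + s₀ * mahaSq C (X' s) (Y - X' s) := by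
    intro s
    exact (prox_mem_proxSet (lam := lam) hf hℓ hb ((hX' s).mem_stiefel hX hγ hγL hGL)).2 Y hYp.1
  set Φ := Y - ((ℓ : ℝ) - 2) • (Y * (offBlock b (Xᵀ * Y))ᵀ) with hΦ
  have h2 : ∑ s, mahaSq C (X' s) (Y - X' s) ≤ N * mahaSq C X (Y - X) +
      γ * (ℓ * frobInner (∑ s : BlockPair ℓ, partialGrad (pairCols C s) X G) Φ) +
      N * (stepConst p ℓ L * γ ^ 2) := by
    refine (Finset.sum_le_sum fun s _ =>
      mahaSq_step_le hℓ hb hX hYp.1 hγ hγL hGL (hX' s)).trans (le_of_eq ?_)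
    rw [Finset.sum_add_distrib, Finset.sum_add_distrib, hsum1, hsum1, ← Finset.mul_sum,
      ← Finset.mul_sum, frobInner_sum_left]
  have h3 := averaged_first_order hℓ b hX hYp.1 hGL
  have h4 : (ℓ : ℝ) * frobInner (∑ s : BlockPair ℓ, partialGrad (pairCols C s) X G) Φ =
      N * (2 * frobInner ((G - X * symPart (Xᵀ * G)) - (((ℓ : ℝ) - 2) / (ℓ - 1)) •
      (X * offBlock b (Xᵀ * G - symPart (Xᵀ * G)))) Φ) := by
    have e : ∑ s : BlockPair ℓ, partialGrad (pairCols C s) X G = ((ℓ : ℝ) - 1) •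
        ((G - X * symPart (Xᵀ * G)) - (((ℓ : ℝ) - 2) / (ℓ - 1)) •
        (X * offBlock b (Xᵀ * G - symPart (Xᵀ * G)))) := by
      rw [sum_partialGrad hb, smul_sub _ (G - _), smul_smul,
        mul_div_cancel₀ _ (by linarith : (ℓ : ℝ) - 1 ≠ 0)]
    rw [e, frobInner_smul_left]
    linear_combination (-frobInner ((G - X * symPart (Xᵀ * G)) - (((ℓ : ℝ) - 2) / (ℓ - 1)) •
      (X * offBlock b (Xᵀ * G - symPart (Xᵀ * G)))) Φ) * hN2
  set I := 2 * frobInner ((G - X * symPart (Xᵀ * G)) - (((ℓ : ℝ) - 2) / (ℓ - 1)) •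
      (X * offBlock b (Xᵀ * G - symPart (Xᵀ * G)))) Φ with hI
  set d := frobNorm (Y - X) with hd
  have h5 := hf.subgradient_inequality hX hYp.1 hG
  have h6 := mahaSq_le_of_mem_proxSet hX hYp
  have h7 := mul_le_mul_of_nonneg_left (le_mahaSq hℓ hb hX (Y - X)) hs0.le
  rw [← hs] at h6
  have h8 : I ≤ -(ℓ * s₀ - τ - (2 * ℓ - 1) * L) * d ^ 2 := by
    have : 0 ≤ 2 * L * d ^ 2 := by positivity
    linarith
  have h9 : ∑ s, envelope f C lam (X' s) ≤ N * f Y + s₀ * ∑ s, mahaSq C (X' s) (Y - X' s) := by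
    refine (Finset.sum_le_sum fun s _ => h1 s).trans (le_of_eq ?_)
    rw [Finset.sum_add_distrib, hsum1, Finset.mul_sum]
  rw [h4] at h2
  have h10 := mul_le_mul_of_nonneg_left h2 hs0.le
  have h11 := mul_le_mul_of_nonneg_left h8 (mul_nonneg hs0.le (mul_nonneg hγ hN0))
  linarith

end Descent

/-! ### Adaptedness of the iterates -/

section Iterates

variable {n p ℓ : ℕ} {C : Fin ℓ → Finset (Fin p)}
  {f : Matrix (Fin n) (Fin p) ℝ → ℝ} {Ω : Set (Matrix (Fin n) (Fin p) ℝ)} {τ L : ℝ}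
  {γ : ℕ → ℝ} {X₀ : Matrix (Fin n) (Fin p) ℝ}
  {G X : ℕ → (ℕ → BlockPair ℓ) → Matrix (Fin n) (Fin p) ℝ}

lemma IsIterates.mem_stiefel (hX : IsIterates f C γ X₀ G X)
    (hf : WeaklyConvexNearStiefel f Ω τ L) (hX₀ : X₀ ∈ stiefel (Fin n) (Fin p))
    (hγ : ∀ k, 0 ≤ γ k) (hγL : ∀ k, γ k * L < 1) (k : ℕ) (ω : ℕ → BlockPair ℓ) :
    X k ω ∈ stiefel (Fin n) (Fin p) := by
  induction k with
  | zero => rw [hX.init]; exact hX₀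
  | succ k ih =>
    exact (hX.step k ω).mem_stiefel ih (hγ k) (hγL k)
      (hf.frobNorm_subgradient_le ih (hX.subgrad k ω))

/-- The iterates depend on the past pairs only, since the projections in the update are unique. -/
lemma IsIterates.nonanticipating_iterate (hX : IsIterates f C γ X₀ G X)
    (hf : WeaklyConvexNearStiefel f Ω τ L) (hX₀ : X₀ ∈ stiefel (Fin n) (Fin p))
    (hγ : ∀ k, 0 ≤ γ k) (hγL : ∀ k, γ k * L < 1) (k : ℕ) :
    ∀ ω ω' : ℕ → BlockPair ℓ, (∀ i < k, ω i = ω' i) → X k ω = X k ω' := by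
  induction k with
  | zero => intro ω ω' _; rw [hX.init, hX.init]
  | succ k ih =>
    intro ω ω' h
    have hx := ih ω ω' fun i hi => h i (hi.trans (Nat.lt_succ_self k))
    have hg := hX.nonanticipating k ω ω' fun i hi => h i (hi.trans (Nat.lt_succ_self k))
    have hmem := hX.mem_stiefel hf hX₀ hγ hγL k ω
    have h1 := hX.step k ω
    have h2 := hX.step k ω'
    rw [← hx, ← hg, ← h k (Nat.lt_succ_self k)] at h2
    exact Step.unique hmem (hγ k) (hγL k) (hf.frobNorm_subgradient_le hmem (hX.subgrad k ω)) h1 h2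

lemma IsIterates.step_update (hX : IsIterates f C γ X₀ G X)
    (hf : WeaklyConvexNearStiefel f Ω τ L) (hX₀ : X₀ ∈ stiefel (Fin n) (Fin p))
    (hγ : ∀ k, 0 ≤ γ k) (hγL : ∀ k, γ k * L < 1) (k : ℕ) (ω : ℕ → BlockPair ℓ)
    (s : BlockPair ℓ) :
    Step (pairCols C s) (γ k) (X k ω) (G k ω) (X (k + 1) (Function.update ω k s)) := by
  have h := hX.step k (Function.update ω k s)
  have hpast : ∀ i < k, Function.update ω k s i = ω i := fun i hi =>
    Function.update_of_ne hi.ne _ _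
  rwa [Function.update_self, hX.nonanticipating_iterate hf hX₀ hγ hγL k _ ω hpast,
    hX.nonanticipating k _ ω hpast] at h

end Iterates

/-! ### A lemma on real sequences -/

section Sequences

/-- A sequence whose increments are controlled by the step sizes and whose squares are summable
against them tends to zero: the increments of the cubes are summable. -/
lemma tendsto_zero_of_summable_mul_sq {a γ : ℕ → ℝ} {K : ℝ} (ha : ∀ k, 0 ≤ a k)
    (hγ : ∀ k, 0 ≤ γ k) (hγ1 : ∃ B, ∀ k, γ k ≤ B)
    (hγ_sum : Tendsto (fun N => ∑ k ∈ Finset.range N, γ k) atTop atTop)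
    (hγ_sq : Summable fun k => γ k ^ 2) (hsum : Summable fun k => γ k * a k ^ 2) (hK : 0 ≤ K)
    (hinc : ∀ k, |a (k + 1) - a k| ≤ K * γ k) : Tendsto a atTop (𝓝 0) := by
  obtain ⟨B, hB⟩ := hγ1
  have hcube : ∀ k, |a (k + 1) ^ 3 - a k ^ 3| ≤
      (9 / 2 * K) * (γ k * a k ^ 2) + (5 / 2 * K ^ 3 * B) * γ k ^ 2 := by
    intro k
    have h1 := hinc k
    have e : a (k + 1) ^ 3 - a k ^ 3 = (a (k + 1) - a k) *
        (a (k + 1) ^ 2 + a (k + 1) * a k + a k ^ 2) := by ring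
    have h2 : a (k + 1) ≤ a k + K * γ k := by linarith [(abs_le.1 h1).2]
    have hKγ : 0 ≤ K * γ k := mul_nonneg hK (hγ k)
    have h3 : a (k + 1) ^ 2 + a (k + 1) * a k + a k ^ 2 ≤ 9 / 2 * a k ^ 2 + 5 / 2 * (K * γ k) ^ 2 := by
      have h4 : a (k + 1) ^ 2 ≤ (a k + K * γ k) ^ 2 := pow_le_pow_left₀ (ha _) h2 2
      have h5 : a (k + 1) * a k ≤ (a k + K * γ k) * a k := mul_le_mul_of_nonneg_right h2 (ha k)
      nlinarith [sq_nonneg (a k - K * γ k)]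
    rw [e, abs_mul, abs_of_nonneg (by have := ha k; have := ha (k + 1); positivity :
      0 ≤ a (k + 1) ^ 2 + a (k + 1) * a k + a k ^ 2)]
    refine (mul_le_mul h1 h3 (by have := ha k; have := ha (k + 1); positivity) hKγ).trans ?_
    have h6 : γ k * γ k ^ 2 ≤ B * γ k ^ 2 := mul_le_mul_of_nonneg_right (hB k) (sq_nonneg _)
    have h7 := mul_le_mul_of_nonneg_left h6 (by positivity : 0 ≤ 5 / 2 * K ^ 3)
    nlinarith
  have hs : Summable fun k => |a (k + 1) ^ 3 - a k ^ 3| :=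
    Summable.of_nonneg_of_le (fun _ => abs_nonneg _) hcube
      ((hsum.mul_left _).add (hγ_sq.mul_left _))
  have hs2 : Summable fun k => dist (a k ^ 3) (a k.succ ^ 3) := by
    simpa only [Real.dist_eq, abs_sub_comm] using hs
  obtain ⟨l, hl⟩ := cauchySeq_tendsto_of_complete (cauchySeq_of_summable_dist hs2)
  have hl0 : 0 ≤ l := ge_of_tendsto' hl fun k => pow_nonneg (ha k) 3
  have hroot : Tendsto a atTop (𝓝 (l ^ ((1 : ℝ) / 3))) := by
    have h := hl.rpow_const (p := 1 / 3) (Or.inr (by norm_num))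
    refine h.congr fun k => ?_
    rw [← Real.rpow_natCast (a k) 3, ← Real.rpow_mul (ha k)]
    norm_num
  set r := l ^ ((1 : ℝ) / 3)
  have hr0 : 0 ≤ r := Real.rpow_nonneg hl0 _
  rcases hr0.eq_or_lt with h0 | h0
  · rwa [← h0] at hroot
  · exfalso
    -- A positive limit would make the step sizes summable.
    have h1 : ∀ᶠ k in atTop, r / 2 < a k := hroot.eventually_const_lt (by linarith)
    obtain ⟨k₀, hk₀⟩ := eventually_atTop.1 h1
    have h2 : Summable fun k => γ (k + k₀) := by
      refine Summable.of_nonneg_of_le (fun _ => hγ _) (fun k => ?_)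
        (((summable_nat_add_iff k₀).2 hsum).mul_left ((r / 2) ^ 2)⁻¹)
      rw [← div_eq_inv_mul, le_div_iff₀ (by positivity)]
      exact mul_le_mul_of_nonneg_left (pow_le_pow_left₀ (by positivity)
        (hk₀ _ (Nat.le_add_left _ _)).le 2) (hγ _)
    exact not_tendsto_atTop_of_tendsto_nhds
      ((summable_nat_add_iff k₀).1 h2).hasSum.tendsto_sum_nat hγ_sum

end Sequences

/-! ### Averaging over the random pairs -/

section Averages

variable {ℓ : ℕ}

instance : MeasurableSingletonClass (BlockPair ℓ) := ⟨fun _ => trivial⟩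

lemma blockPair_nonempty (hℓ : 2 ≤ ℓ) : Nonempty (BlockPair ℓ) := by
  rw [← Fintype.card_pos_iff, card_blockPair]
  exact Nat.choose_pos hℓ

lemma isProbabilityMeasure_uniformOn_blockPair (hℓ : 2 ≤ ℓ) :
    IsProbabilityMeasure (uniformOn (Set.univ : Set (BlockPair ℓ))) :=
  have := blockPair_nonempty hℓ
  isProbabilityMeasure_uniformOn Set.finite_univ Set.univ_nonempty

lemma integral_uniformOn_blockPair (h : BlockPair ℓ → ℝ) :
    ∫ s, h s ∂(uniformOn (Set.univ : Set (BlockPair ℓ))) =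
      ((ℓ.choose 2 : ℕ) : ℝ)⁻¹ * ∑ s, h s := by
  rw [uniformOn, ProbabilityTheory.cond, integral_smul_measure, Measure.restrict_univ,
    integral_count]
  simp [Measure.count_univ, card_blockPair]

lemma measurable_update_pair (k : ℕ) : Measurable fun q : (ℕ → BlockPair ℓ) × BlockPair ℓ =>
    Function.update q.1 k q.2 := by
  refine measurable_pi_lambda _ fun i => ?_
  by_cases hi : i = k
  · subst hi
    simpa using measurable_snd
  · simp only [Function.update_of_ne hi]
    exact (measurable_pi_apply i).comp measurable_fst

/-- Redrawing the `k`-th pair does not change the law of the sequence of pairs. -/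
lemma map_update_pairMeasure (hℓ : 2 ≤ ℓ) (k : ℕ) :
    ((pairMeasure ℓ).prod (uniformOn (Set.univ : Set (BlockPair ℓ)))).map
      (fun q => Function.update q.1 k q.2) = pairMeasure ℓ := by
  have := isProbabilityMeasure_uniformOn_blockPair hℓ
  have : IsProbabilityMeasure (pairMeasure ℓ) := by unfold pairMeasure; infer_instance
  refine Measure.eq_infinitePi _ fun s t ht => ?_
  rw [Measure.map_apply (measurable_update_pair k)
    (MeasurableSet.pi (Finset.countable_toSet s) fun i _ => ht i)]
  have e : (fun q : (ℕ → BlockPair ℓ) × BlockPair ℓ => Function.update q.1 k q.2) ⁻¹'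
      (Set.pi s t) = (Set.pi (s.erase k : Finset ℕ) t) ×ˢ (if k ∈ s then t k else Set.univ) := by
    ext q
    simp only [Set.mem_preimage, Set.mem_pi, Set.mem_prod, Finset.mem_coe, Finset.mem_erase]
    constructor
    · intro h
      refine ⟨fun i hi => ?_, ?_⟩
      · have := h i hi.2
        rwa [Function.update_of_ne hi.1] at this
      · split_ifs with hk
        · simpa using h k hk
        · trivial
    · rintro ⟨h1, h2⟩ i hi
      by_cases hik : i = k
      · subst hik
        rw [if_pos hi] at h2
        simpa using h2
      · rw [Function.update_of_ne hik]
        exact h1 i ⟨hik, hi⟩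
  rw [e, Measure.prod_prod, pairMeasure, Measure.infinitePi_pi _ fun i _ => ht i]
  split_ifs with hk
  · rw [mul_comm, Finset.mul_prod_erase s (fun i => uniformOn (Set.univ : Set (BlockPair ℓ)) (t i)) hk]
  · rw [measure_univ, mul_one, Finset.erase_eq_of_notMem hk]

lemma isProbabilityMeasure_pairMeasure (hℓ : 2 ≤ ℓ) : IsProbabilityMeasure (pairMeasure ℓ) := by
  have := isProbabilityMeasure_uniformOn_blockPair hℓ
  unfold pairMeasure
  infer_instance

/-- A function of finitely many coordinates is measurable and bounded. -/
lemma measurable_bounded_of_finite_dependence {k : ℕ} {h : (ℕ → BlockPair ℓ) → ℝ} (hℓ : 2 ≤ ℓ)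
    (hh : ∀ ω ω', (∀ i < k, ω i = ω' i) → h ω = h ω') :
    Measurable h ∧ ∃ B, ∀ ω, ‖h ω‖ ≤ B := by
  obtain ⟨s₀⟩ := blockPair_nonempty hℓ
  set h' : (Fin k → BlockPair ℓ) → ℝ := fun x => h fun i => if hi : i < k then x ⟨i, hi⟩ else s₀
  have e : h = h' ∘ fun ω (i : Fin k) => ω i := by
    funext ω
    refine hh _ _ fun i hi => ?_
    simp [hi]
  refine ⟨?_, ∑ x, ‖h' x‖, fun ω => ?_⟩
  · rw [e]
    exact (measurable_of_finite _).comp (measurable_pi_lambda _ fun i => measurable_pi_apply _)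
  · rw [show h ω = h' fun i => ω i from congrFun e ω]
    exact Finset.single_le_sum (f := fun x => ‖h' x‖) (fun _ _ => norm_nonneg _)
      (Finset.mem_univ fun i : Fin k => ω i)

lemma integrable_of_finite_dependence {k : ℕ} {h : (ℕ → BlockPair ℓ) → ℝ} (hℓ : 2 ≤ ℓ)
    (hh : ∀ ω ω', (∀ i < k, ω i = ω' i) → h ω = h ω') : Integrable h (pairMeasure ℓ) := by
  have := isProbabilityMeasure_pairMeasure hℓ
  obtain ⟨hm, B, hB⟩ := measurable_bounded_of_finite_dependence hℓ hh
  exact Integrable.of_bound hm.aestronglyMeasurable B (Eventually.of_forall hB)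

/-- The expectation of a function of the first `k + 1` pairs is computed by averaging over the
last of these pairs. -/
lemma integral_eq_integral_average {k : ℕ} {h : (ℕ → BlockPair ℓ) → ℝ} (hℓ : 2 ≤ ℓ)
    (hh : ∀ ω ω', (∀ i < k + 1, ω i = ω' i) → h ω = h ω') :
    ∫ ω, h ω ∂(pairMeasure ℓ) =
      ∫ ω, ((ℓ.choose 2 : ℕ) : ℝ)⁻¹ * ∑ s, h (Function.update ω k s) ∂(pairMeasure ℓ) := by
  have := isProbabilityMeasure_pairMeasure hℓ
  have := isProbabilityMeasure_uniformOn_blockPair hℓ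
  obtain ⟨hm, B, hB⟩ := measurable_bounded_of_finite_dependence hℓ hh
  have hu := measurable_update_pair (ℓ := ℓ) k
  conv_lhs => rw [← map_update_pairMeasure hℓ k]
  rw [integral_map hu.aemeasurable hm.aestronglyMeasurable, integral_prod]
  · simp only [integral_uniformOn_blockPair]
  · exact Integrable.of_bound (hm.comp hu).aestronglyMeasurable B
      (Eventually.of_forall fun q => hB _)

end Averages

/-! ### Almost-sure convergence -/

section Convergence

variable {n p ℓ : ℕ} {C : Fin ℓ → Finset (Fin p)} {b : Fin p → Fin ℓ}
  {f : Matrix (Fin n) (Fin p) ℝ → ℝ} {Ω : Set (Matrix (Fin n) (Fin p) ℝ)} {τ L lam : ℝ}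
  {γ : ℕ → ℝ} {X₀ : Matrix (Fin n) (Fin p) ℝ}
  {G X : ℕ → (ℕ → BlockPair ℓ) → Matrix (Fin n) (Fin p) ℝ}

/-- The distance of a point to its adaptive proximal point. -/
noncomputable def proxDist (f : Matrix (Fin n) (Fin p) ℝ → ℝ) (C : Fin ℓ → Finset (Fin p))
    (lam : ℝ) (X : Matrix (Fin n) (Fin p) ℝ) : ℝ :=
  frobNorm (prox f C lam X - X)

lemma proxDist_nonneg (X : Matrix (Fin n) (Fin p) ℝ) : 0 ≤ proxDist f C lam X :=
  frobNorm_nonneg _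

lemma proxDist_lipschitz (hf : WeaklyConvexNearStiefel f Ω τ L) (hℓ : 2 ≤ ℓ)
    (hb : ∀ j a, j ∈ C a ↔ b j = a) (hlam : 0 < lam)
    (hμ : 0 < (ℓ : ℝ) / (2 * lam) - τ - (2 * ℓ - 1) * L) :
    ∃ K : ℝ, 0 ≤ K ∧ ∀ X ∈ stiefel (Fin n) (Fin p), ∀ X' ∈ stiefel (Fin n) (Fin p),
      |proxDist f C lam X' - proxDist f C lam X| ≤ K * frobNorm (X' - X) := by
  obtain ⟨K, hK0, hK⟩ := proxSet_lipschitz hf hℓ hb hlam hμ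
  have key : ∀ X ∈ stiefel (Fin n) (Fin p), ∀ X' ∈ stiefel (Fin n) (Fin p),
      proxDist f C lam X' - proxDist f C lam X ≤ (K + 1) * frobNorm (X' - X) := by
    intro X hX X' hX'
    have h1 := hK X hX X' hX' _ (prox_mem_proxSet hf hℓ hb hX) _ (prox_mem_proxSet hf hℓ hb hX')
    have e : prox f C lam X' - X' = (prox f C lam X' - prox f C lam X) +
      ((prox f C lam X - X) - (X' - X)) := by abel
    have h2 := frobNorm_add_le (prox f C lam X' - prox f C lam X) ((prox f C lam X - X) - (X' - X))
    have h3 := frobNorm_sub_le (prox f C lam X - X) (X' - X)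
    rw [← e] at h2
    simp only [proxDist]
    linarith
  refine ⟨K + 1, by linarith, fun X hX X' hX' => abs_sub_le_iff.2 ⟨key X hX X' hX', ?_⟩⟩
  rw [frobNorm_sub_comm]
  exact key X' hX' X hX

lemma le_envelope (hf : WeaklyConvexNearStiefel f Ω τ L) (hℓ : 2 ≤ ℓ)
    (hb : ∀ j a, j ∈ C a ↔ b j = a) (hlam : 0 < lam) {X X₀ : Matrix (Fin n) (Fin p) ℝ}
    (hX₀ : X₀ ∈ stiefel (Fin n) (Fin p)) (hX : X ∈ stiefel (Fin n) (Fin p)) :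
    f X₀ - L * (2 * √p) ≤ envelope f C lam X := by
  have hn : ∀ {U : Matrix (Fin n) (Fin p) ℝ}, U ∈ stiefel (Fin n) (Fin p) → frobNorm U = √p := by
    intro U hU
    rw [← Real.sqrt_sq (frobNorm_nonneg U), frobNorm_sq_stiefel hU, Fintype.card_fin]
  have hY := (prox_mem_proxSet (lam := lam) hf hℓ hb hX).1
  have h1 := hf.le_add (hf.mem hX₀) (hf.mem hY)
  have h2 := frobNorm_sub_le X₀ (prox f C lam X)
  rw [hn hX₀, hn hY] at h2
  have h3 := mul_le_mul_of_nonneg_left h2 hf.lip_pos.le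
  have h4 := (mul_nonneg (by positivity) (sq_nonneg _)).trans (le_mahaSq hℓ hb hX (prox f C lam X - X))
  have h5 : 0 ≤ 1 / (2 * lam) * mahaSq C X (prox f C lam X - X) := mul_nonneg (by positivity) h4
  rw [envelope]
  linarith

/-- In expectation, the squared distances to the proximal points are summable against the step
sizes. -/
lemma summable_integral_proxDist (hf : WeaklyConvexNearStiefel f Ω τ L) (hℓ : 2 ≤ ℓ)
    (hb : ∀ j a, j ∈ C a ↔ b j = a) (hlam : 0 < lam)
    (hμ : 0 < (ℓ : ℝ) / (2 * lam) - τ - (2 * ℓ - 1) * L)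
    (hγ : ∀ k, 0 ≤ γ k) (hγL : ∀ k, γ k * L < 1) (hγ_sq : Summable fun k => γ k ^ 2)
    (hX₀ : X₀ ∈ stiefel (Fin n) (Fin p)) (hX : IsIterates f C γ X₀ G X) :
    Summable fun k => ∫ ω, γ k * proxDist f C lam (X k ω) ^ 2 ∂(pairMeasure ℓ) := by
  have hprob := isProbabilityMeasure_pairMeasure hℓ
  set μ := (ℓ : ℝ) / (2 * lam) - τ - (2 * ℓ - 1) * L with hμdef
  set s : ℝ := 1 / (2 * lam) with hs
  have hs0 : 0 < s := by positivity
  set E : ℕ → ℝ := fun k => ∫ ω, envelope f C lam (X k ω) ∂(pairMeasure ℓ) with hE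
  set D : ℕ → ℝ := fun k => ∫ ω, γ k * proxDist f C lam (X k ω) ^ 2 ∂(pairMeasure ℓ) with hD
  have hdep := hX.nonanticipating_iterate hf hX₀ hγ hγL
  have hmem := hX.mem_stiefel hf hX₀ hγ hγL
  have hEint : ∀ k, Integrable (fun ω => envelope f C lam (X k ω)) (pairMeasure ℓ) := fun k =>
    integrable_of_finite_dependence hℓ fun ω ω' h => by rw [hdep k ω ω' h]
  have hDint : ∀ k, Integrable (fun ω => γ k * proxDist f C lam (X k ω) ^ 2) (pairMeasure ℓ) :=
    fun k => integrable_of_finite_dependence hℓ fun ω ω' h => by rw [hdep k ω ω' h]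
  have hN : (0 : ℝ) < (ℓ.choose 2 : ℕ) := by exact_mod_cast Nat.choose_pos hℓ
  have hstep : ∀ k, E (k + 1) ≤ E k - s * μ * D k + s * stepConst p ℓ L * γ k ^ 2 := by
    intro k
    have h1 : E (k + 1) = _ := integral_eq_integral_average (k := k) hℓ
      fun ω ω' h => by rw [hdep (k + 1) ω ω' h]
    have hAint : Integrable (fun ω => ((ℓ.choose 2 : ℕ) : ℝ)⁻¹ *
        ∑ t, envelope f C lam (X (k + 1) (Function.update ω k t))) (pairMeasure ℓ) := by
      refine integrable_of_finite_dependence (k := k) hℓ fun ω ω' h => ?_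
      have e : ∀ t, X (k + 1) (Function.update ω k t) = X (k + 1) (Function.update ω' k t) := by
        refine fun t => hdep (k + 1) _ _ fun i hi => ?_
        by_cases hik : i = k
        · subst hik; simp
        · rw [Function.update_of_ne hik, Function.update_of_ne hik]
          exact h i (by omega)
      simp only [e]
    have hBint : Integrable (fun ω => envelope f C lam (X k ω) -
        s * μ * (γ k * proxDist f C lam (X k ω) ^ 2)) (pairMeasure ℓ) :=
      (hEint k).sub ((hDint k).const_mul _)
    have h2 : ∫ ω, (envelope f C lam (X k ω) - s * μ * (γ k * proxDist f C lam (X k ω) ^ 2)) +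
        s * stepConst p ℓ L * γ k ^ 2 ∂(pairMeasure ℓ) =
        E k - s * μ * D k + s * stepConst p ℓ L * γ k ^ 2 := by
      rw [integral_add hBint (integrable_const _),
        integral_sub (hEint k) ((hDint k).const_mul _), integral_const_mul, integral_const,
        probReal_univ, one_smul]
    rw [h1, ← h2]
    refine integral_mono hAint (hBint.add (integrable_const _)) fun ω => ?_
    have h3 := sum_envelope_le hf hℓ hb hlam (hmem k ω) (hX.subgrad k ω) (hγ k) (hγL k)
      (X' := fun t => X (k + 1) (Function.update ω k t))
      (hX.step_update hf hX₀ hγ hγL k ω)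
    simp only
    rw [inv_mul_le_iff₀ hN]
    refine h3.trans (le_of_eq ?_)
    simp only [proxDist]
    ring
  have hlow : ∀ k, f X₀ - L * (2 * √p) ≤ E k := by
    intro k
    have h := integral_mono (integrable_const (f X₀ - L * (2 * √p))) (hEint k)
      (fun ω => le_envelope hf hℓ hb hlam hX₀ (hmem k ω))
    simpa using h
  have hD0 : ∀ k, 0 ≤ D k := fun k =>
    integral_nonneg fun ω => mul_nonneg (hγ k) (sq_nonneg _)
  have htel : ∀ K, s * μ * ∑ k ∈ Finset.range K, D k ≤
      E 0 - E K + s * stepConst p ℓ L * ∑ k ∈ Finset.range K, γ k ^ 2 := by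
    intro K
    induction K with
    | zero => simp
    | succ K ih =>
      rw [Finset.sum_range_succ, Finset.sum_range_succ]
      linarith [hstep K]
  have hK0 : 0 ≤ s * stepConst p ℓ L := by
    have hℓ' : (2 : ℝ) ≤ ℓ := by exact_mod_cast hℓ
    refine mul_nonneg hs0.le (mul_nonneg (add_nonneg ?_ ?_) (sq_nonneg _))
    · exact mul_nonneg (mul_nonneg (by linarith) (by linarith)) (Real.sqrt_nonneg _)
    · exact mul_nonneg (by linarith) (by linarith)
  refine summable_of_sum_range_le (c := (E 0 - (f X₀ - L * (2 * √p)) +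
    s * stepConst p ℓ L * ∑' k, γ k ^ 2) / (s * μ)) hD0 fun K => ?_
  rw [le_div_iff₀ (mul_pos hs0 hμ)]
  have h1 := hγ_sq.sum_le_tsum (Finset.range K) fun k _ => sq_nonneg (γ k)
  have h2 := mul_le_mul_of_nonneg_left h1 hK0
  linarith [htel K, hlow K]

/-- A sequence of nonnegative random variables with summable expectations is summable almost
surely. -/
lemma ae_summable_of_summable_integral {α : Type*} {m : MeasurableSpace α} {ν : Measure α}
    {g : ℕ → α → ℝ} (hg : ∀ k, Integrable (g k) ν) (hg0 : ∀ k x, 0 ≤ g k x)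
    (hs : Summable fun k => ∫ x, g k x ∂ν) : ∀ᵐ x ∂ν, Summable fun k => g k x := by
  have hm : ∀ k, AEMeasurable (fun x => ENNReal.ofReal (g k x)) ν := fun k =>
    (hg k).aestronglyMeasurable.aemeasurable.ennreal_ofReal
  have h1 : ∫⁻ x, ∑' k, ENNReal.ofReal (g k x) ∂ν ≠ ⊤ := by
    rw [lintegral_tsum hm]
    simp_rw [← fun k => ofReal_integral_eq_lintegral_ofReal (hg k)
      (Eventually.of_forall (hg0 k))]
    exact hs.tsum_ofReal_ne_top
  filter_upwards [ae_lt_top' (AEMeasurable.tsum hm) h1] with x hx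
  have h2 := ENNReal.summable_toReal hx.ne
  simpa only [ENNReal.toReal_ofReal (hg0 _ x)] using h2

lemma ae_tendsto_proxDist (hf : WeaklyConvexNearStiefel f Ω τ L) (hℓ : 2 ≤ ℓ)
    (hb : ∀ j a, j ∈ C a ↔ b j = a) (hlam : 0 < lam)
    (hμ : 0 < (ℓ : ℝ) / (2 * lam) - τ - (2 * ℓ - 1) * L)
    (hγ : ∀ k, 0 ≤ γ k) (hγL : ∀ k, γ k * L < 1)
    (hγ_sum : Tendsto (fun K => ∑ k ∈ Finset.range K, γ k) atTop atTop)
    (hγ_sq : Summable fun k => γ k ^ 2)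
    (hX₀ : X₀ ∈ stiefel (Fin n) (Fin p)) (hX : IsIterates f C γ X₀ G X) :
    ∀ᵐ ω ∂(pairMeasure ℓ), Tendsto (fun k => proxDist f C lam (X k ω)) atTop (𝓝 0) := by
  have hL := hf.lip_pos
  have hdep := hX.nonanticipating_iterate hf hX₀ hγ hγL
  have hmem := hX.mem_stiefel hf hX₀ hγ hγL
  obtain ⟨K, hK0, hK⟩ := proxDist_lipschitz (lam := lam) hf hℓ hb hlam hμ
  filter_upwards [ae_summable_of_summable_integral
    (fun k => integrable_of_finite_dependence hℓ fun ω ω' h => by rw [hdep k ω ω' h])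
    (fun k ω => mul_nonneg (hγ k) (sq_nonneg _))
    (summable_integral_proxDist hf hℓ hb hlam hμ hγ hγL hγ_sq hX₀ hX)] with ω hω
  refine tendsto_zero_of_summable_mul_sq (K := K * (2 * L)) (fun k => proxDist_nonneg _) hγ
    ⟨1 / L, fun k => (le_div_iff₀ hL).2 (hγL k).le⟩ hγ_sum hγ_sq hω (by positivity) fun k => ?_
  have h1 := hK _ (hmem k ω) _ (hmem (k + 1) ω)
  have h2 := (hX.step k ω).frobNorm_sub_le (hmem k ω) (hγ k) (hγL k)
    (hf.frobNorm_subgradient_le (hmem k ω) (hX.subgrad k ω))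
  have h3 := mul_le_mul_of_nonneg_left h2 hK0
  linarith

lemma tendsto_surrogate (hℓ : 2 ≤ ℓ) (hb : ∀ j a, j ∈ C a ↔ b j = a) (hlam : 0 < lam)
    {x : ℕ → Matrix (Fin n) (Fin p) ℝ} (hx : ∀ k, x k ∈ stiefel (Fin n) (Fin p))
    (h : Tendsto (fun k => proxDist f C lam (x k)) atTop (𝓝 0)) :
    Tendsto (fun k => surrogate f C lam (x k)) atTop (𝓝 0) := by
  have h1 : Tendsto (fun k => 1 / lam * (√((ℓ : ℝ) / 2 * (ℓ - 1)) * proxDist f C lam (x k)))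
      atTop (𝓝 0) := by
    simpa using (h.const_mul (√((ℓ : ℝ) / 2 * (ℓ - 1)))).const_mul (1 / lam)
  refine squeeze_zero (fun k => mul_nonneg (by positivity) (Real.sqrt_nonneg _)) (fun k => ?_) h1
  refine mul_le_mul_of_nonneg_left ?_ (by positivity)
  have hℓ' : (2 : ℝ) ≤ ℓ := by exact_mod_cast hℓ
  refine Real.sqrt_le_iff.2 ⟨mul_nonneg (Real.sqrt_nonneg _) (proxDist_nonneg _), ?_⟩
  rw [mul_pow, Real.sq_sqrt (mul_nonneg (by linarith) (by linarith))]
  exact mahaSq_le hℓ hb (hx k) _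

lemma isStationary_of_mapClusterPt (hf : WeaklyConvexNearStiefel f Ω τ L) (hℓ : 2 ≤ ℓ)
    (hb : ∀ j a, j ∈ C a ↔ b j = a) (hlam : 0 < lam)
    (hμ : 0 < (ℓ : ℝ) / (2 * lam) - τ - (2 * ℓ - 1) * L)
    {x : ℕ → Matrix (Fin n) (Fin p) ℝ} (hx : ∀ k, x k ∈ stiefel (Fin n) (Fin p))
    (h : Tendsto (fun k => proxDist f C lam (x k)) atTop (𝓝 0))
    {Y : Matrix (Fin n) (Fin p) ℝ} (hY : MapClusterPt Y atTop x) : IsStationary f Y := by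
  rw [mapClusterPt_iff_frequently] at hY
  have hYmem : Y ∈ stiefel (Fin n) (Fin p) := by
    have hcl : IsClosed (stiefel (Fin n) (Fin p)) :=
      isClosed_eq (f := fun X : Matrix (Fin n) (Fin p) ℝ => Xᵀ * X) (by fun_prop) continuous_const
    by_contra hne
    obtain ⟨k, hk⟩ := (hY _ (hcl.isOpen_compl.mem_nhds hne)).exists
    exact hk (hx k)
  obtain ⟨K, hK0, hK⟩ := proxDist_lipschitz (lam := lam) hf hℓ hb hlam hμ
  have hdist : proxDist f C lam Y = 0 := by
    refine le_antisymm (le_of_forall_pos_le_add fun ε hε => ?_) (proxDist_nonneg _)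
    have hnhds : {Z : Matrix (Fin n) (Fin p) ℝ | frobNorm (Y - Z) < ε / (2 * (K + 1))} ∈ 𝓝 Y := by
      refine (isOpen_lt (continuous_frobNorm.comp (continuous_const.sub continuous_id))
        continuous_const).mem_nhds ?_
      change frobNorm (Y - id Y) < _
      rw [id, sub_self, frobNorm_eq_zero.2 rfl]
      positivity
    obtain ⟨k, hk1, hk2⟩ := ((hY _ hnhds).and_eventually
      (h.eventually_lt_const (half_pos hε))).exists
    have h1 := (abs_le.1 (hK (x k) (hx k) Y hYmem)).2
    have h2 : (K + 1) * frobNorm (Y - x k) ≤ ε / 2 := by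
      have h3 : frobNorm (Y - x k) < ε / (2 * (K + 1)) := hk1
      rw [lt_div_iff₀ (by positivity)] at h3
      linarith
    linarith [frobNorm_nonneg (Y - x k)]
  have hprox := prox_mem_proxSet (lam := lam) hf hℓ hb hYmem
  rw [sub_eq_zero.1 (frobNorm_eq_zero.1 hdist)] at hprox
  exact isStationary_of_mem_proxSet hf hℓ hb hlam hprox

end Convergence

end RSSM

theorem theorem4p11 {n p ℓ : ℕ} (hp : 1 ≤ p) (hpn : p ≤ n) (hℓ : 2 ≤ ℓ)
    (C : Fin ℓ → Finset (Fin p)) (hC : RSSM.IsPartition C)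
    (f : Matrix (Fin n) (Fin p) ℝ → ℝ) (Ω : Set (Matrix (Fin n) (Fin p) ℝ))
    (hΩ_bdd : ∃ R : ℝ, ∀ X ∈ Ω, RSSM.frobNorm X ≤ R)
    (hΩ_nhds : ∀ X ∈ RSSM.stiefel (Fin n) (Fin p), Ω ∈ 𝓝 X)
    (τ L : ℝ) (hτ : 0 ≤ τ) (hL : 0 < L)
    (hf_convex : ConvexOn ℝ Ω fun X => f X + τ / 2 * RSSM.frobNorm X ^ 2)
    (hf_lip : ∀ X ∈ Ω, ∀ Y ∈ Ω, |f X - f Y| ≤ L * RSSM.frobNorm (X - Y))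
    (γ : ℕ → ℝ) (hγ : ∀ k, 0 < γ k ∧ γ k < 1 / L)
    (hγ_sum : Tendsto (fun K => ∑ k ∈ Finset.range K, γ k) atTop atTop)
    (hγ_sq : Summable fun k => γ k ^ 2)
    (X₀ : Matrix (Fin n) (Fin p) ℝ) (hX₀ : X₀ ∈ RSSM.stiefel (Fin n) (Fin p))
    (G X : ℕ → (ℕ → RSSM.BlockPair ℓ) → Matrix (Fin n) (Fin p) ℝ)
    (hX : RSSM.IsIterates f C γ X₀ G X) :
    (∀ lam : ℝ, 0 < lam → lam < ℓ / (2 * (τ + (2 * ℓ - 1) * L)) →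
      (∀ Y ∈ RSSM.stiefel (Fin n) (Fin p), ∃! Z, Z ∈ RSSM.proxSet f C lam Y) ∧
      ∀ᵐ ω ∂(RSSM.pairMeasure ℓ),
        Tendsto (fun k => RSSM.surrogate f C lam (X k ω)) atTop (𝓝 0)) ∧
    ∀ᵐ ω ∂(RSSM.pairMeasure ℓ), ∀ Xbar : Matrix (Fin n) (Fin p) ℝ,
      MapClusterPt Xbar atTop (fun k => X k ω) → RSSM.IsStationary f Xbar := by
  obtain ⟨b, hb⟩ := hC.exists_label
  have hf : RSSM.WeaklyConvexNearStiefel f Ω τ L := ⟨hΩ_nhds, hf_convex, hf_lip, hτ, hL⟩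
  have hℓ' : (2 : ℝ) ≤ ℓ := by exact_mod_cast hℓ
  have hγ0 : ∀ k, 0 ≤ γ k := fun k => (hγ k).1.le
  have hγL : ∀ k, γ k * L < 1 := fun k => (lt_div_iff₀ hL).1 (hγ k).2
  have hmem := hX.mem_stiefel hf hX₀ hγ0 hγL
  have hden : 0 < τ + (2 * ℓ - 1) * L := by
    have : 0 < (2 * (ℓ : ℝ) - 1) * L := mul_pos (by linarith) hL
    linarith
  have hμ : ∀ lam : ℝ, 0 < lam → lam < ℓ / (2 * (τ + (2 * ℓ - 1) * L)) →
      0 < (ℓ : ℝ) / (2 * lam) - τ - (2 * ℓ - 1) * L := by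
    intro lam h0 h1
    rw [lt_div_iff₀ (by positivity)] at h1
    have : τ + (2 * ℓ - 1) * L < (ℓ : ℝ) / (2 * lam) := by
      rw [lt_div_iff₀ (by positivity)]
      linarith
    linarith
  refine ⟨fun lam h0 h1 => ⟨fun Y hY => RSSM.existsUnique_proxSet hf hℓ hb h0 (hμ lam h0 h1) hY,
    ?_⟩, ?_⟩
  · filter_upwards [RSSM.ae_tendsto_proxDist hf hℓ hb h0 (hμ lam h0 h1) hγ0 hγL hγ_sum hγ_sq hX₀ hX]
      with ω hω
    exact RSSM.tendsto_surrogate hℓ hb h0 (fun k => hmem k ω) hω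
  · -- Stationarity does not involve `lam`, so any admissible value serves.
    have hpos : 0 < (ℓ : ℝ) / (2 * (τ + (2 * ℓ - 1) * L)) :=
      div_pos (by linarith) (by linarith)
    have h0 := half_pos hpos
    have h1 := hμ _ h0 (half_lt_self hpos)
    filter_upwards [RSSM.ae_tendsto_proxDist hf hℓ hb h0 h1 hγ0 hγL hγ_sum hγ_sq hX₀ hX] with ω hω
    exact fun Xbar hXbar =>
      RSSM.isStationary_of_mapClusterPt hf hℓ hb h0 h1 (fun k => hmem k ω) hω hXbar
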